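/- Let $\theta$ be an irrational real number and let $A_\theta$ be the rotation $C^*$-algebra generated by unitaries $U,V$ with $VU=e^{2\pi i\theta}UV$. Let $\alpha_s$, $s\in\mathbb R^2$, be the automorphisms with $\alpha_s(U^nV^m)=e^{i(s_1n+s_2m)}U^nV^m$, let $A_\theta^\infty=\{a\in A_\theta : s\mapsto\alpha_s(a)\text{ is } C^\infty\}$, let $\delta_1,\delta_2$ be the derivations of $A_\theta^\infty$ with $\delta_1U=U$, $\delta_1V=0$, $\delta_2U=0$, $\delta_2V=V$, and let $\partial=\delta_1+i\delta_2$. Let $\tau$ be the trace on $A_\theta$ with $\tau(1)=1$ and $\tau(U^nV^m)=0$ for $(n,m)\neq(0,0)$, and let $\mathcal H_0$ be the completion of $A_\theta$ for $\langle a,b\rangle=\tau(b^*a)$. Let $\mathcal H^{(1,0)}$ be the Hilbert space completion of the finite sums $\sum a\,\partial b$, $a,b\in A_\theta^\infty$, for $\langle a\,\partial b,a'\,\partial b'\rangle=\tau\big((a')^*a(\partial b)(\partial b')^*\big)$; it is a bimodule over $A_\theta$ by left and right multiplication. Let $h=h^*\in A_\theta^\infty$, $k=e^{h/2}$, $\varphi(a)=\tau(ae^{-h})$,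 and let $\mathcal H_\varphi$ be the completion of $A_\theta$ for $\langle a,b\rangle_\varphi=\varphi(b^*a)$, on which $A_\theta$ acts by left multiplication. Let $\Delta(x)=e^{-h}xe^{h}$ be the modular operator of $\varphi$ and let $J_\varphi$ be the Tomita antiunitary of $\mathcal H_\varphi$, determined by $J_\varphi\Delta^{1/2}a=a^*$ for $a\in A_\theta$. Let $\partial_\varphi$ be the closure of $\partial:A_\theta^\infty\to\mathcal H^{(1,0)}$ as an unbounded operator from $\mathcal H_\varphi$ to $\mathcal H^{(1,0)}$, let $\triangle=\partial^*\partial$ be the Laplacian on $\mathcal H_0$ (with $\partial$ closed from $\mathcal H_0$ to $\mathcal H^{(1,0)}$), and let $$\mathcal H=\mathcal H_\varphi\oplus\mathcal H^{(1,0)},\qquad D=\begin{pmatrix}0&\partial_\varphi^*\\ \partial_\varphi&0\end{pmatrix},\qquad \gamma=\begin{pmatrix}1&0\\0&-1\end{pmatrix}.$$ 1. The subalgebra $A_\theta^\infty$ is dense in $A_\theta$, and the left action on $\mathcal H$ together with $D$ and $\gamma$ gives an even spectral triple $(A_\theta^\infty,\mathcal H,D)$: $D$ is self-adjoint with compact resolvent,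 each $a\in A_\theta^\infty$ preserves the domain of $D$ and $Da-aD$ is bounded, and the self-adjoint involution $\gamma$ commutes with $A_\theta^\infty$ and anticommutes with $D$. 2. Let $a\mapsto a^{\rm op}$ be the right action of $A_\theta$ on $\mathcal H$ given by $J_\varphi a^*J_\varphi$ on $\mathcal H_\varphi$ and by right multiplication by $a$ on $\mathcal H^{(1,0)}$. Together with $D$ and $\gamma$ it gives an even twisted spectral triple over the opposite algebra of $A_\theta^\infty$, with twisting automorphism $\sigma(a^{\rm op})=(k^{-1}ak)^{\rm op}$ (which satisfies $\sigma(x^*)=\sigma^{-1}(x)^*$): each $a^{\rm op}$, $a\in A_\theta^\infty$, preserves the domain of $D$ and $$D\,a^{\rm op}-(k^{-1}ak)^{\rm op}D$$ is bounded, and $\gamma$ commutes with the right action. 3. For every $s\in\mathbb C$ with $\mathrm{Re}(s)>2$ the operators $|D|^{-s}$ and $(k\triangle k)^{-s/2}$ (taken to be zero on the kernels; $k$ acts on $\mathcal H_0$ by left multiplication) are of trace class, and $$\mathrm{Trace}(|D|^{-s})=2\,\mathrm{Trace}\big((k\triangle k)^{-s/2}\big).$$ -/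

import Mathlib

open scoped ComplexOrder InnerProductSpace ContDiff

noncomputable section

namespace NCTorus

/-- The Hilbert space `ℓ²(ℤ²)`. -/
abbrev L2 : Type := lp (fun _ : ℤ × ℤ => ℂ) 2

theorem norm_circle (z : Circle) : ‖(z : ℂ)‖ = 1 := Circle.norm_coe z

/-- The unitary operator `(W f)(p) = c p * f (p - d)` on `ℓ²(ℤ²)`. -/
def phaseShift (c : ℤ × ℤ → Circle) (d : ℤ × ℤ) : L2 ≃ₗᵢ[ℂ] L2 where
  toFun f := ⟨fun p => c p * f (p - d), by
    have := (memℓp_gen_iff (p := 2) (by norm_num)).1 f.2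
    refine (memℓp_gen_iff (p := 2) (by norm_num)).2 ?_
    simp only [norm_mul, norm_circle, one_mul]
    exact (Equiv.subRight d).summable_iff.2 this⟩
  invFun f := ⟨fun p => (c (p + d))⁻¹ * f (p + d), by
    have := (memℓp_gen_iff (p := 2) (by norm_num)).1 f.2
    refine (memℓp_gen_iff (p := 2) (by norm_num)).2 ?_
    simp only [norm_mul, norm_circle, one_mul]
    exact (Equiv.addRight d).summable_iff.2 this⟩
  map_add' f g := by
    ext p
    exact mul_add _ _ _
  map_smul' a f := by ext p; simp; ring
  left_inv f := by ext p; simp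
  right_inv f := by ext p; simp
  norm_map' f := by
    rw [lp.norm_eq_tsum_rpow (by norm_num), lp.norm_eq_tsum_rpow (by norm_num)]
    congr 1
    refine Eq.trans ?_ ((Equiv.subRight d).tsum_eq (fun p => ‖f p‖ ^ (ENNReal.toReal 2)))
    refine tsum_congr fun p => ?_
    change ‖(c p : ℂ) * f (p - d)‖ ^ _ = _
    rw [norm_mul, norm_circle, one_mul]
    rfl

@[simp] theorem phaseShift_apply (c : ℤ × ℤ → Circle) (d : ℤ × ℤ) (f : L2) (p : ℤ × ℤ) :
    phaseShift c d f p = c p * f (p - d) := rfl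

@[simp] theorem phaseShift_symm_apply (c : ℤ × ℤ → Circle) (d : ℤ × ℤ) (f : L2) (p : ℤ × ℤ) :
    (phaseShift c d).symm f p = (c (p + d) : ℂ)⁻¹ * f (p + d) := rfl

/-- The unitary `U` on `ℓ²(ℤ²)`: `U e_{n,m} = e_{n+1,m}`, that is, left multiplication by `U` when
`e_{n,m}` stands for the monomial `Uⁿ Vᵐ`. -/
def opU : L2 →L[ℂ] L2 := (phaseShift 1 (1, 0)).toContinuousLinearEquiv

/-- The unitary `V` on `ℓ²(ℤ²)`: `V e_{n,m} = e^{2πi n θ} e_{n,m+1}`, that is, left multiplication by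
`V` when `e_{n,m}` stands for `Uⁿ Vᵐ` and `V U = e^{2πiθ} U V`. -/
def opV (θ : ℝ) : L2 →L[ℂ] L2 :=
  (phaseShift (fun p => Circle.exp (2 * Real.pi * θ * p.1)) (0, 1)).toContinuousLinearEquiv

@[simp] theorem opU_apply (f : L2) (p : ℤ × ℤ) : opU f p = f (p - (1, 0)) := by
  change (phaseShift 1 (1, 0)) f p = _
  simp

@[simp] theorem opV_apply (θ : ℝ) (f : L2) (p : ℤ × ℤ) :
    opV θ f p = Circle.exp (2 * Real.pi * θ * p.1) * f (p - (0, 1)) := rfl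

/-- The commutation relation `V U = e^{2πiθ} U V`. -/
theorem opV_mul_opU (θ : ℝ) :
    opV θ * opU = Complex.exp (2 * Real.pi * Complex.I * θ) • (opU * opV θ) := by
  ext f p
  change opV θ (opU f) p = _ * opU (opV θ f) p
  simp only [opU_apply, opV_apply, Circle.coe_exp, sub_sub, ← mul_assoc, ← Complex.exp_add]
  rw [add_comm]
  congr 2
  push_cast [Prod.fst_sub]; ring

/-- The rotation algebra `A_θ` as a norm closed `*`-subalgebra of the bounded operators on `ℓ²(ℤ²)`:
the C⋆-algebra generated by the unitaries `U` and `V`. -/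
def rotationAlgebra (θ : ℝ) : StarSubalgebra ℂ (L2 →L[ℂ] L2) :=
  (StarAlgebra.adjoin ℂ {opU, opV θ}).topologicalClosure

theorem isClosed_rotationAlgebra (θ : ℝ) : IsClosed (rotationAlgebra θ : Set (L2 →L[ℂ] L2)) :=
  StarSubalgebra.isClosed_topologicalClosure _

/-- The rotation C⋆-algebra `A_θ`, as a type. -/
def Alg (θ : ℝ) : Type := rotationAlgebra θ

instance (θ : ℝ) : CStarAlgebra (Alg θ) :=
  haveI := isClosed_rotationAlgebra θ
  inferInstanceAs (CStarAlgebra (rotationAlgebra θ))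

instance (θ : ℝ) : PartialOrder (Alg θ) := CStarAlgebra.spectralOrder (Alg θ)
instance (θ : ℝ) : StarOrderedRing (Alg θ) := CStarAlgebra.spectralOrderedRing (Alg θ)

/-- The inclusion of `A_θ` in the bounded operators on `ℓ²(ℤ²)`. -/
def toOp (θ : ℝ) : Alg θ →⋆ₐ[ℂ] (L2 →L[ℂ] L2) := (rotationAlgebra θ).subtype

theorem norm_toOp {θ : ℝ} (a : Alg θ) : ‖toOp θ a‖ = ‖a‖ := rfl
theorem toOp_injective (θ : ℝ) : Function.Injective (toOp θ) := Subtype.val_injective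
theorem toOp_mem {θ : ℝ} (a : Alg θ) : toOp θ a ∈ rotationAlgebra θ := a.2
theorem isometry_toOp (θ : ℝ) : Isometry (toOp θ) := isometry_subtype_coe

/-- The generator `U` of `A_θ`. -/
def U (θ : ℝ) : Alg θ := ⟨opU, StarSubalgebra.le_topologicalClosure _ (StarAlgebra.subset_adjoin _ _ (by simp))⟩
/-- The generator `V` of `A_θ`. -/
def V (θ : ℝ) : Alg θ := ⟨opV θ, StarSubalgebra.le_topologicalClosure _ (StarAlgebra.subset_adjoin _ _ (by simp))⟩

theorem toOp_U (θ : ℝ) : toOp θ (U θ) = opU := rfl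
theorem toOp_V (θ : ℝ) : toOp θ (V θ) = opV θ := rfl

/-- Diagonal unitary `e_{n,m} ↦ e^{i (s₁ n + s₂ m)} e_{n,m}`. -/
def diagUnitary (s : ℝ × ℝ) : L2 ≃ₗᵢ[ℂ] L2 :=
  phaseShift (fun p => Circle.exp (s.1 * p.1 + s.2 * p.2)) 0

theorem conj_opU (s : ℝ × ℝ) :
    (diagUnitary s).conjStarAlgEquiv opU = (Circle.exp s.1 : ℂ) • opU := by
  ext f p
  simp only [LinearIsometryEquiv.conjStarAlgEquiv_apply_apply, diagUnitary, phaseShift_apply,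
    opU_apply, phaseShift_symm_apply, smul_apply, lp.coeFn_smul, Pi.smul_apply,
    smul_eq_mul, sub_zero, add_zero, Circle.coe_exp, ← Complex.exp_neg, ← mul_assoc,
    ← Complex.exp_add]
  congr 2
  push_cast [Prod.fst_sub, Prod.snd_sub]; ring

theorem conj_opV (θ : ℝ) (s : ℝ × ℝ) :
    (diagUnitary s).conjStarAlgEquiv (opV θ) = (Circle.exp s.2 : ℂ) • opV θ := by
  ext f p
  simp only [LinearIsometryEquiv.conjStarAlgEquiv_apply_apply, diagUnitary, phaseShift_apply,
    opV_apply, phaseShift_symm_apply, smul_apply, lp.coeFn_smul, Pi.smul_apply,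
    smul_eq_mul, sub_zero, add_zero, Circle.coe_exp, ← Complex.exp_neg, ← mul_assoc,
    ← Complex.exp_add]
  congr 2
  push_cast [Prod.fst_sub, Prod.snd_sub]; ring

theorem conj_mem {θ : ℝ} (s : ℝ × ℝ) (a : L2 →L[ℂ] L2) (ha : a ∈ rotationAlgebra θ) :
    (diagUnitary s).conjStarAlgEquiv a ∈ rotationAlgebra θ := by
  let f : (L2 →L[ℂ] L2) →⋆ₐ[ℂ] (L2 →L[ℂ] L2) := ((diagUnitary s).conjStarAlgEquiv : _ →⋆ₐ[ℂ] _)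
  have hf : Continuous f := map_continuous f
  have : rotationAlgebra θ ≤ (rotationAlgebra θ).comap f := by
    refine StarSubalgebra.topologicalClosure_minimal (StarAlgebra.adjoin_le ?_) ?_
    · rintro x (rfl | rfl)
      · change (diagUnitary s).conjStarAlgEquiv opU ∈ rotationAlgebra θ
        rw [conj_opU]
        exact SMulMemClass.smul_mem _ (toOp_mem (U θ))
      · change (diagUnitary s).conjStarAlgEquiv (opV θ) ∈ rotationAlgebra θ
        rw [conj_opV]
        exact SMulMemClass.smul_mem _ (toOp_mem (V θ))
    · exact (isClosed_rotationAlgebra θ).preimage hf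
  exact this ha

/-- The action of `s ∈ ℝ²` on `A_θ` by the automorphism `α_s` with
`α_s (Uⁿ Vᵐ) = e^{i (s₁ n + s₂ m)} Uⁿ Vᵐ`. -/
def alpha (θ : ℝ) (s : ℝ × ℝ) : Alg θ →⋆ₐ[ℂ] Alg θ :=
  StarAlgHom.codRestrict
    (((diagUnitary s).conjStarAlgEquiv : (L2 →L[ℂ] L2) →⋆ₐ[ℂ] (L2 →L[ℂ] L2)).comp (toOp θ))
    (rotationAlgebra θ) fun a => conj_mem s _ a.2

theorem alpha_U (θ : ℝ) (s : ℝ × ℝ) : alpha θ s (U θ) = (Circle.exp s.1 : ℂ) • U θ :=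
  toOp_injective θ (conj_opU s)

theorem alpha_V (θ : ℝ) (s : ℝ × ℝ) : alpha θ s (V θ) = (Circle.exp s.2 : ℂ) • V θ :=
  toOp_injective θ (conj_opV θ s)

/-- The `*`-subalgebra `A_θ^∞` of smooth elements: those `a` for which `s ↦ α_s (a)` is a `C^∞` map
from `ℝ²` to `A_θ`. -/
def smooth (θ : ℝ) : StarSubalgebra ℂ (Alg θ) where
  carrier := {a | ContDiff ℝ ∞ fun s : ℝ × ℝ => alpha θ s a}
  mul_mem' {a b} ha hb := by
    have h : ContDiff ℝ ∞ fun s : ℝ × ℝ => alpha θ s a * alpha θ s b := ContDiff.mul ha hb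
    simpa using h
  add_mem' {a b} ha hb := by
    have h : ContDiff ℝ ∞ fun s : ℝ × ℝ => alpha θ s a + alpha θ s b := ContDiff.add ha hb
    simpa using h
  algebraMap_mem' c := by
    simp only [Set.mem_ofPred_eq, AlgHomClass.commutes]
    exact contDiff_const
  star_mem' ha := by
    simp only [Set.mem_ofPred_eq, map_star] at *
    exact (starL' ℝ : Alg θ ≃L[ℝ] Alg θ).contDiff.comp ha

theorem exp_mem_smooth {θ : ℝ} {a : Alg θ} (ha : a ∈ smooth θ) : NormedSpace.exp a ∈ smooth θ := by
  change ContDiff ℝ ∞ fun s : ℝ × ℝ => alpha θ s (NormedSpace.exp a)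
  let : NormedAlgebra ℚ (Alg θ) := .restrictScalars ℚ ℂ (Alg θ)
  have h (s : ℝ × ℝ) : alpha θ s (NormedSpace.exp a) = NormedSpace.exp (alpha θ s a) :=
    NormedSpace.map_exp _ (map_continuous _) a
  simp only [h]
  have h2 : ContDiff ℝ ∞ (NormedSpace.exp : Alg θ → Alg θ) :=
    AnalyticOnNhd.contDiff fun x _ => NormedSpace.exp_analytic (𝕂 := ℝ) x
  exact h2.comp ha

/-- The derivation `δ₁ = -i ∂/∂s₁ α_s` at `s = 0` (used on smooth elements only); `δ₁ U = U`, `δ₁ V = 0`. -/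
def delta₁ {θ : ℝ} (a : Alg θ) : Alg θ := -Complex.I • deriv (fun t : ℝ => alpha θ (t, 0) a) 0
/-- The derivation `δ₂ = -i ∂/∂s₂ α_s` at `s = 0` (used on smooth elements only); `δ₂ U = 0`, `δ₂ V = V`. -/
def delta₂ {θ : ℝ} (a : Alg θ) : Alg θ := -Complex.I • deriv (fun t : ℝ => alpha θ (0, t) a) 0

theorem smooth_diff₁ {θ : ℝ} (a : smooth θ) :
    DifferentiableAt ℝ (fun t : ℝ => alpha θ (t, 0) a) 0 := by
  have h : ContDiff ℝ ∞ fun s : ℝ × ℝ => alpha θ s a := a.2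
  exact ((h.comp (contDiff_id.prodMk contDiff_const)).differentiable (by simp)) 0

theorem smooth_diff₂ {θ : ℝ} (a : smooth θ) :
    DifferentiableAt ℝ (fun t : ℝ => alpha θ (0, t) a) 0 := by
  have h : ContDiff ℝ ∞ fun s : ℝ × ℝ => alpha θ s a := a.2
  exact ((h.comp (contDiff_const.prodMk contDiff_id)).differentiable (by simp)) 0

/-- The operator `∂ = δ₁ + i δ₂` on `A_θ^∞`. -/
def del (θ : ℝ) : smooth θ →ₗ[ℂ] Alg θ where
  toFun a := delta₁ (a : Alg θ) + Complex.I • delta₂ (a : Alg θ)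
  map_add' a b := by
    have h (s : ℝ × ℝ) : alpha θ s ((a + b : smooth θ) : Alg θ) = alpha θ s a + alpha θ s b :=
      map_add (alpha θ s) (a : Alg θ) b
    simp only [delta₁, delta₂, h]
    rw [deriv_fun_add (smooth_diff₁ a) (smooth_diff₁ b),
      deriv_fun_add (smooth_diff₂ a) (smooth_diff₂ b)]
    module
  map_smul' c a := by
    have h (s : ℝ × ℝ) : alpha θ s ((c • a : smooth θ) : Alg θ) = c • alpha θ s a :=
      map_smul (alpha θ s) c (a : Alg θ)
    simp only [delta₁, delta₂, h, RingHom.id_apply]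
    rw [deriv_fun_const_smul c (smooth_diff₁ a), deriv_fun_const_smul c (smooth_diff₂ a)]
    module

theorem U_mem_smooth (θ : ℝ) : U θ ∈ smooth θ := by
  change ContDiff ℝ ∞ fun s : ℝ × ℝ => alpha θ s (U θ)
  simp only [alpha_U, Circle.coe_exp]
  exact ((Complex.ofRealCLM.contDiff.comp contDiff_fst).mul contDiff_const).cexp.smul
    contDiff_const

theorem V_mem_smooth (θ : ℝ) : V θ ∈ smooth θ := by
  change ContDiff ℝ ∞ fun s : ℝ × ℝ => alpha θ s (V θ)
  simp only [alpha_V, Circle.coe_exp]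
  exact ((Complex.ofRealCLM.contDiff.comp contDiff_snd).mul contDiff_const).cexp.smul
    contDiff_const

theorem hasDerivAt_exp_smul {θ : ℝ} (a : Alg θ) :
    HasDerivAt (fun t : ℝ => (Circle.exp t : ℂ) • a) (Complex.I • a) 0 := by
  have h : HasDerivAt (fun t : ℝ => Complex.exp (t * Complex.I)) Complex.I 0 := by
    have := ((hasDerivAt_id (0 : ℂ)).mul_const Complex.I).cexp.comp_ofReal (z := 0)
    simpa using this
  simpa [Circle.coe_exp] using h.smul_const a

theorem delta₁_U (θ : ℝ) : delta₁ (U θ) = U θ := by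
  simp only [delta₁, alpha_U, (hasDerivAt_exp_smul (U θ)).deriv, smul_smul]; simp
theorem delta₁_V (θ : ℝ) : delta₁ (V θ) = 0 := by simp [delta₁, alpha_V]
theorem delta₂_U (θ : ℝ) : delta₂ (U θ) = 0 := by simp [delta₂, alpha_U]
theorem delta₂_V (θ : ℝ) : delta₂ (V θ) = V θ := by
  simp only [delta₂, alpha_V, (hasDerivAt_exp_smul (V θ)).deriv, smul_smul]; simp

theorem dense_of_mem {θ : ℝ} {S : StarSubalgebra ℂ (Alg θ)} (hU : U θ ∈ S) (hV : V θ ∈ S) :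
    Dense (S : Set (Alg θ)) := by
  have h : StarAlgebra.adjoin ℂ {opU, opV θ} ≤ S.map (toOp θ) := by
    refine StarAlgebra.adjoin_le ?_
    rintro x (rfl | rfl)
    exacts [⟨U θ, hU, rfl⟩, ⟨V θ, hV, rfl⟩]
  intro a
  rw [(isometry_toOp θ).isEmbedding.closure_eq_preimage_closure_image]
  exact closure_mono h a.2

theorem dense_smooth (θ : ℝ) : Dense (smooth θ : Set (Alg θ)) :=
  dense_of_mem (U_mem_smooth θ) (V_mem_smooth θ)

/-- The vector `e_{0,0}` of `ℓ²(ℤ²)`. -/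
def vac : L2 := lp.single 2 (0, 0) 1

/-- The functional `a ↦ ⟨e_{0,0}, a e_{0,0}⟩` on `A_θ`, as a linear map; it vanishes on `Uⁿ Vᵐ` for
`(n, m) ≠ (0, 0)` and takes the value `1` at `1`. -/
def tauLin (θ : ℝ) : Alg θ →ₗ[ℂ] ℂ where
  toFun a := ⟪vac, toOp θ a vac⟫_ℂ
  map_add' a b := by simp
  map_smul' c a := by simp

theorem tauLin_star_mul_self {θ : ℝ} (a : Alg θ) :
    tauLin θ (star a * a) = (‖toOp θ a vac‖ ^ 2 : ℝ) := by
  change ⟪vac, toOp θ (star a * a) vac⟫_ℂ = _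
  rw [map_mul, map_star]
  change ⟪vac, star (toOp θ a) (toOp θ a vac)⟫_ℂ = _
  rw [ContinuousLinearMap.star_eq_adjoint,
    ContinuousLinearMap.adjoint_inner_right, inner_self_eq_norm_sq_to_K]
  simp

/-- The trace `τ` of `A_θ`, as a positive linear functional. -/
def tau (θ : ℝ) : Alg θ →ₚ[ℂ] ℂ := PositiveLinearMap.mk₀ (tauLin θ) fun a ha => by
  obtain ⟨b, rfl⟩ := CStarAlgebra.nonneg_iff_eq_star_mul_self.1 ha
  rw [tauLin_star_mul_self]
  exact_mod_cast sq_nonneg ‖toOp θ b vac‖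

theorem tau_apply {θ : ℝ} (a : Alg θ) : tau θ a = ⟪vac, toOp θ a vac⟫_ℂ := rfl

/-- Right multiplication by `U` on the basis `e_{n,m} = Uⁿ Vᵐ`; it commutes with `A_θ`. -/
def rightU (θ : ℝ) : L2 ≃ₗᵢ[ℂ] L2 :=
  phaseShift (fun p => Circle.exp (2 * Real.pi * θ * p.2)) (1, 0)
/-- Right multiplication by `V` on the basis `e_{n,m} = Uⁿ Vᵐ`; it commutes with `A_θ`. -/
def rightV : L2 ≃ₗᵢ[ℂ] L2 := phaseShift 1 (0, 1)

theorem comm_of_comm {θ : ℝ} (R : L2 ≃ₗᵢ[ℂ] L2) (hU : ∀ f, opU (R f) = R (opU f))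
    (hV : ∀ f, opV θ (R f) = R (opV θ f)) (a : Alg θ) (f : L2) :
    toOp θ a (R f) = R (toOp θ a f) := by
  let Rc : L2 →L[ℂ] L2 := R.toContinuousLinearEquiv
  have hU' (f : L2) : opU (R.symm f) = R.symm (opU f) := by
    rw [LinearIsometryEquiv.eq_symm_apply, ← hU, R.apply_symm_apply]
  have hV' (f : L2) : opV θ (R.symm f) = R.symm (opV θ f) := by
    rw [LinearIsometryEquiv.eq_symm_apply, ← hV, R.apply_symm_apply]
  have hst : star Rc = (R.symm.toContinuousLinearEquiv : L2 →L[ℂ] L2) :=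
    R.adjoint_eq_symm
  have key : rotationAlgebra θ ≤ StarSubalgebra.centralizer ℂ {Rc} := by
    refine StarSubalgebra.topologicalClosure_minimal (StarAlgebra.adjoin_le ?_)
      (Set.isClosed_centralizer _)
    rintro x (rfl | rfl) <;> rw [SetLike.mem_coe, StarSubalgebra.mem_centralizer_iff] <;>
      rintro y rfl <;> rw [hst]
    · exact ⟨by ext1 f; exact (hU f).symm, by ext1 f; exact (hU' f).symm⟩
    · exact ⟨by ext1 f; exact (hV f).symm, by ext1 f; exact (hV' f).symm⟩
  have := ((StarSubalgebra.mem_centralizer_iff ℂ).1 (key (toOp_mem a)) Rc rfl).1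
  exact (DFunLike.congr_fun this f).symm

theorem comm_rightU {θ : ℝ} (a : Alg θ) (f : L2) :
    toOp θ a (rightU θ f) = rightU θ (toOp θ a f) := by
  refine comm_of_comm _ (fun f => ?_) (fun f => ?_) a f
  · ext p
    simp only [rightU, phaseShift_apply, opU_apply]
    simp [sub_sub]
  · ext p
    simp only [rightU, phaseShift_apply, opV_apply, Circle.coe_exp, ← mul_assoc,
      ← Complex.exp_add, sub_sub]
    rw [add_comm (1, 0)]
    congr 2
    push_cast [Prod.fst_sub, Prod.snd_sub]; ring

theorem comm_rightV {θ : ℝ} (a : Alg θ) (f : L2) :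
    toOp θ a (rightV f) = rightV (toOp θ a f) := by
  refine comm_of_comm _ (fun f => ?_) (fun f => ?_) a f
  · ext p
    simp [rightV, phaseShift_apply, opU_apply, sub_sub]
  · ext p
    simp [rightV, phaseShift_apply, opV_apply, sub_sub]

theorem phaseShift_vac {c c' : ℤ × ℤ → Circle} {d : ℤ × ℤ} (h : c d = c' d) :
    phaseShift c d vac = phaseShift c' d vac := by
  ext p
  by_cases hp : p = d
  · subst hp; simp [h]
  · have : p - d ≠ (0, 0) := fun h' => hp (sub_eq_zero.1 h')
    simp [vac, lp.single_apply, Pi.single_eq_of_ne this]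

theorem phaseShift_symm_vac {c c' : ℤ × ℤ → Circle} {d : ℤ × ℤ} (h : c 0 = c' 0) :
    (phaseShift c d).symm vac = (phaseShift c' d).symm vac := by
  ext p
  by_cases hp : p + d = 0
  · simp [hp, h]
  · have : p + d ≠ (0, 0) := hp
    simp [vac, lp.single_apply, Pi.single_eq_of_ne this]

theorem tau_mul_comm_aux {θ : ℝ} (x : Alg θ) (L R : L2 ≃ₗᵢ[ℂ] L2)
    (hL : ∀ f, toOp θ x f = L f) (hR : ∀ (a : Alg θ) f, toOp θ a (R f) = R (toOp θ a f))
    (hv : L vac = R vac) (hv' : L.symm vac = R.symm vac) (a : Alg θ) :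
    tau θ (x * a) = tau θ (a * x) := by
  rw [tau_apply, tau_apply, map_mul, map_mul]
  change ⟪vac, toOp θ x (toOp θ a vac)⟫_ℂ = ⟪vac, toOp θ a (toOp θ x vac)⟫_ℂ
  have key (W : L2 ≃ₗᵢ[ℂ] L2) (f : L2) : ⟪vac, W f⟫_ℂ = ⟪W.symm vac, f⟫_ℂ := by
    rw [← W.inner_map_map (W.symm vac) f, W.apply_symm_apply]
  rw [hL, hL, hv, hR, key, key, hv']

theorem tau_star {θ : ℝ} (a : Alg θ) : tau θ (star a) = star (tau θ a) := by
  rw [tau_apply, tau_apply, map_star, ContinuousLinearMap.star_eq_adjoint,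
    ContinuousLinearMap.adjoint_inner_right]
  exact (inner_conj_symm _ _).symm

theorem continuous_tau (θ : ℝ) : Continuous (tau θ) := by
  have h : Continuous (toOp θ) := (isometry_toOp θ).continuous
  change Continuous fun a => ⟪vac, toOp θ a vac⟫_ℂ
  fun_prop

/-- The elements `x` with `τ(x a) = τ(a x)` for all `a`. -/
def tracial (θ : ℝ) : StarSubalgebra ℂ (Alg θ) where
  carrier := {x | ∀ a, tau θ (x * a) = tau θ (a * x)}
  mul_mem' {x y} hx hy a := by rw [mul_assoc, hx, mul_assoc, hy, mul_assoc]
  add_mem' {x y} hx hy a := by rw [add_mul, mul_add, map_add, map_add, hx, hy]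
  algebraMap_mem' c a := by rw [Algebra.commutes]
  star_mem' {x} hx a := by
    have := hx (star a)
    rw [← star_inj, ← tau_star, ← tau_star, star_mul, star_mul, star_star] at this
    exact this.symm

/-- The functional `τ` is a trace. -/
theorem tau_mul_comm {θ : ℝ} (a b : Alg θ) : tau θ (a * b) = tau θ (b * a) := by
  have hd : Dense (tracial θ : Set (Alg θ)) := by
    refine dense_of_mem (fun a => ?_) (fun a => ?_)
    · exact tau_mul_comm_aux _ (phaseShift 1 (1, 0)) (rightU θ) (fun _ => rfl) comm_rightU
        (phaseShift_vac (by simp)) (phaseShift_symm_vac (by simp)) a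
    · exact tau_mul_comm_aux _ (phaseShift _ (0, 1)) rightV (fun _ => rfl) comm_rightV
        (phaseShift_vac (by simp)) (phaseShift_symm_vac (by simp)) a
  have hc : IsClosed {x : Alg θ | tau θ (x * b) = tau θ (b * x)} :=
    isClosed_eq ((continuous_tau θ).comp (by fun_prop)) ((continuous_tau θ).comp (by fun_prop))
  exact hc.closure_subset_iff.2 (fun x (hx : ∀ a, tau θ (x * a) = tau θ (a * x)) => hx b) (hd a)

/-- The element `e^{t h}` of `A_θ^∞`, for a self-adjoint `h ∈ A_θ^∞` and a real `t`. -/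
def expS {θ : ℝ} (h : selfAdjoint (smooth θ)) (t : ℝ) : smooth θ :=
  ⟨NormedSpace.exp ((t : ℂ) • ((h : smooth θ) : Alg θ)), exp_mem_smooth (SMulMemClass.smul_mem _ (h : smooth θ).2)⟩

theorem expS_add {θ : ℝ} (h : selfAdjoint (smooth θ)) (s t : ℝ) :
    expS h (s + t) = expS h s * expS h t := by
  let : NormedAlgebra ℚ (Alg θ) := .restrictScalars ℚ ℂ (Alg θ)
  refine Subtype.ext ?_
  change NormedSpace.exp _ = NormedSpace.exp _ * NormedSpace.exp _
  rw [Complex.ofReal_add, add_smul, NormedSpace.exp_add_of_commute]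
  exact ((Commute.refl _).smul_left _).smul_right _

theorem expS_zero {θ : ℝ} (h : selfAdjoint (smooth θ)) : expS h 0 = 1 := by
  refine Subtype.ext ?_
  change NormedSpace.exp _ = (1 : Alg θ)
  simp

theorem star_expS {θ : ℝ} (h : selfAdjoint (smooth θ)) (t : ℝ) : star (expS h t) = expS h t := by
  refine Subtype.ext ?_
  change star (NormedSpace.exp _) = NormedSpace.exp _
  have hh : star ((h : smooth θ) : Alg θ) = (h : smooth θ) := congrArg Subtype.val h.2
  rw [NormedSpace.star_exp, star_smul, hh]
  simp

/-- The Weyl factor `k = e^{h/2}`, as an invertible element of `A_θ^∞`. -/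
def weyl {θ : ℝ} (h : selfAdjoint (smooth θ)) : (smooth θ)ˣ where
  val := expS h (1 / 2)
  inv := expS h (-(1 / 2))
  val_inv := by rw [← expS_add, add_neg_cancel, expS_zero]
  inv_val := by rw [← expS_add, neg_add_cancel, expS_zero]

theorem exp_neg_eq {θ : ℝ} (h : selfAdjoint (smooth θ)) :
    NormedSpace.exp (-((h : smooth θ) : Alg θ)) = expS h (-(1 / 2)) * expS h (-(1 / 2)) := by
  have h1 : ((expS h (-1) : smooth θ) : Alg θ) = NormedSpace.exp (-((h : smooth θ) : Alg θ)) := by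
    change NormedSpace.exp _ = _
    simp
  have h2 := congrArg Subtype.val (expS_add h (-(1 / 2)) (-(1 / 2)))
  rw [show (-(1 / 2) + -(1 / 2) : ℝ) = -1 by norm_num] at h2
  exact h1.symm.trans h2

theorem tau_mul_exp {θ : ℝ} (h : selfAdjoint (smooth θ)) (a : Alg θ) :
    tau θ (a * NormedSpace.exp (-((h : smooth θ) : Alg θ))) =
      tau θ (expS h (-(1 / 2)) * a * expS h (-(1 / 2))) := by
  rw [exp_neg_eq, ← mul_assoc, tau_mul_comm, mul_assoc]

/-- The positive linear functional `φ(a) = τ(a e^{-h})` on `A_θ`. -/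
def phi {θ : ℝ} (h : selfAdjoint (smooth θ)) : Alg θ →ₚ[ℂ] ℂ :=
  PositiveLinearMap.mk₀
    ((tauLin θ) ∘ₗ LinearMap.mulRight ℂ (NormedSpace.exp (-((h : smooth θ) : Alg θ))))
    fun a ha => by
      change 0 ≤ tau θ (a * NormedSpace.exp (-((h : smooth θ) : Alg θ)))
      have hs : star (expS h (-(1 / 2)) : Alg θ) = expS h (-(1 / 2)) :=
        congrArg Subtype.val (star_expS h _)
      rw [tau_mul_exp]
      refine (tau θ).map_nonneg ?_
      have := star_left_conjugate_nonneg ha (expS h (-(1 / 2)) : Alg θ)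
      rwa [hs] at this

theorem phi_apply {θ : ℝ} (h : selfAdjoint (smooth θ)) (a : Alg θ) :
    phi h a = tau θ (a * NormedSpace.exp (-((h : smooth θ) : Alg θ))) := rfl

section GNS
variable {θ : ℝ}

/-- The canonical map from `A_θ` to its Hilbert space completion for the inner product
`(a, b) ↦ ψ(a^* b)` (antilinear in the first variable). -/
def toGNS (ψ : Alg θ →ₚ[ℂ] ℂ) : Alg θ →ₗ[ℂ] ψ.GNS :=
  (UniformSpace.Completion.toComplₗᵢ (𝕜 := ℂ) (E := ψ.PreGNS)).toLinearMap ∘ₗ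
    ψ.toPreGNS.toLinearMap

theorem inner_toGNS (ψ : Alg θ →ₚ[ℂ] ℂ) (a b : Alg θ) :
    ⟪toGNS ψ a, toGNS ψ b⟫_ℂ = ψ (star a * b) :=
  UniformSpace.Completion.inner_coe _ _

theorem denseRange_toGNS (ψ : Alg θ →ₚ[ℂ] ℂ) : DenseRange (toGNS ψ) :=
  UniformSpace.Completion.denseRange_coe (α := ψ.PreGNS)

theorem gns_toGNS (ψ : Alg θ →ₚ[ℂ] ℂ) (a b : Alg θ) :
    ψ.gnsStarAlgHom a (toGNS ψ b) = toGNS ψ (a * b) :=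
  ψ.gnsNonUnitalStarAlgHom_apply_coe

theorem norm_toGNS_le (ψ : Alg θ →ₚ[ℂ] ℂ) (a : Alg θ) : ‖toGNS ψ a‖ ≤ ‖a‖ * ‖toGNS ψ 1‖ := by
  have := gns_toGNS ψ a 1
  rw [mul_one] at this
  rw [← this]
  exact ((ψ.gnsStarAlgHom a).le_opNorm _).trans
    (mul_le_mul_of_nonneg_right (NonUnitalStarAlgHom.norm_apply_le ψ.gnsStarAlgHom a) (norm_nonneg _))

theorem continuous_toGNS (ψ : Alg θ →ₚ[ℂ] ℂ) : Continuous (toGNS ψ) :=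
  ((toGNS ψ).mkContinuous ‖toGNS ψ 1‖ fun a => (norm_toGNS_le ψ a).trans_eq (mul_comm _ _)).continuous

/-- The antiunitary operator on the completion extending an antilinear bijection of `A_θ` that
preserves the norm given by `ψ`. -/
def extendConj (ψ : Alg θ →ₚ[ℂ] ℂ) (T : Alg θ ≃ₗ⋆[ℂ] Alg θ)
    (hT : ∀ a, ψ (star (T a) * T a) = ψ (star a * a)) : ψ.GNS ≃ₗᵢ⋆[ℂ] ψ.GNS :=
  T.extendOfIsometry (toGNS ψ) (toGNS ψ) (denseRange_toGNS ψ) (denseRange_toGNS ψ) fun a => by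
    rw [← sq_eq_sq₀ (norm_nonneg _) (norm_nonneg _)]
    have h := hT a
    rw [← inner_toGNS, ← inner_toGNS, inner_self_eq_norm_sq_to_K, inner_self_eq_norm_sq_to_K] at h
    exact_mod_cast h

theorem extendConj_toGNS (ψ : Alg θ →ₚ[ℂ] ℂ) (T : Alg θ ≃ₗ⋆[ℂ] Alg θ)
    (hT : ∀ a, ψ (star (T a) * T a) = ψ (star a * a)) (a : Alg θ) :
    extendConj ψ T hT (toGNS ψ a) = toGNS ψ (T a) :=
  LinearEquiv.extendOfIsometry_eq ..

theorem extendConj_invol (ψ : Alg θ →ₚ[ℂ] ℂ) (T : Alg θ ≃ₗ⋆[ℂ] Alg θ)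
    (hT : ∀ a, ψ (star (T a) * T a) = ψ (star a * a)) (hT2 : ∀ a, T (T a) = a) (x : ψ.GNS) :
    extendConj ψ T hT (extendConj ψ T hT x) = x := by
  refine (denseRange_toGNS ψ).induction_on x ?_ fun a => ?_
  · exact isClosed_eq (by fun_prop) continuous_id
  · rw [extendConj_toGNS, extendConj_toGNS, hT2]

end GNS

section Reps
variable {B E F : Type*} [Ring B] [StarRing B] [Algebra ℂ B] [StarModule ℂ B]
  [NormedAddCommGroup E] [InnerProductSpace ℂ E]
  [NormedAddCommGroup F] [InnerProductSpace ℂ F]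

theorem inner_conj_swap (J : E ≃ₗᵢ⋆[ℂ] E) (x y : E) : ⟪J x, J y⟫_ℂ = ⟪y, x⟫_ℂ := by
  rw [inner_eq_sum_norm_sq_div_four, inner_eq_sum_norm_sq_div_four]
  have h1 (a b : E) : ‖J a + J b‖ = ‖b + a‖ := by rw [← map_add, J.norm_map, add_comm]
  have h2 (a b : E) : ‖J a - J b‖ = ‖b - a‖ := by rw [← map_sub, J.norm_map, norm_sub_rev]
  have h3 (a b : E) : ‖J a - (RCLike.I : ℂ) • J b‖ = ‖b - (RCLike.I : ℂ) • a‖ := by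
    have e1 : J a - (RCLike.I : ℂ) • J b = J (a + (RCLike.I : ℂ) • b) := by
      rw [map_add, J.map_smulₛₗ]
      simp [sub_eq_add_neg]
    have e2 : b - (RCLike.I : ℂ) • a = (-Complex.I) • (a + (RCLike.I : ℂ) • b) := by
      rw [smul_add, smul_smul]
      simp [sub_eq_add_neg, add_comm]
    rw [e1, e2, J.norm_map, norm_smul]
    simp
  have h4 (a b : E) : ‖J a + (RCLike.I : ℂ) • J b‖ = ‖b + (RCLike.I : ℂ) • a‖ := by
    have e1 : J a + (RCLike.I : ℂ) • J b = J (a - (RCLike.I : ℂ) • b) := by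
      rw [map_sub, J.map_smulₛₗ]
      simp [sub_eq_add_neg]
    have e2 : b + (RCLike.I : ℂ) • a = Complex.I • (a - (RCLike.I : ℂ) • b) := by
      rw [smul_sub, smul_smul]
      simp [add_comm]
    rw [e1, e2, J.norm_map, norm_smul]
    simp
  rw [h1, h2, h3, h4]

/-- The diagonal operator `S ⊕ T` on the Hilbert sum `E ⊕ F`. -/
def diagOp (S : E →L[ℂ] E) (T : F →L[ℂ] F) : WithLp 2 (E × F) →L[ℂ] WithLp 2 (E × F) :=
  (WithLp.prodContinuousLinearEquiv 2 ℂ E F).symm.toContinuousLinearMap ∘L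
    (S.prodMap T) ∘L (WithLp.prodContinuousLinearEquiv 2 ℂ E F).toContinuousLinearMap

theorem diagOp_apply (S : E →L[ℂ] E) (T : F →L[ℂ] F) (x : WithLp 2 (E × F)) :
    diagOp S T x = WithLp.toLp 2 (S x.fst, T x.snd) := rfl

variable [CompleteSpace E] [CompleteSpace F]

/-- The right action `a ↦ J π(a)^* J`, as a `*`-representation of the opposite algebra, for an
antiunitary involution `J` and a `*`-representation `π`. -/
def opRep (J : E ≃ₗᵢ⋆[ℂ] E) (hJ : ∀ x, J (J x) = x) (π : B →⋆ₐ[ℂ] (E →L[ℂ] E)) :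
    Bᵐᵒᵖ →⋆ₐ[ℂ] (E →L[ℂ] E) where
  toFun a := (J : E →L⋆[ℂ] E).comp ((π (star a.unop)).comp (J : E →L⋆[ℂ] E))
  map_one' := by ext x; simp [hJ]
  map_mul' a b := by ext x; simp [hJ]
  map_zero' := by ext x; simp
  map_add' a b := by ext x; simp
  commutes' c := by ext x; simp [hJ, Algebra.algebraMap_eq_smul_one]
  map_star' a := by
    rw [ContinuousLinearMap.star_eq_adjoint, ContinuousLinearMap.eq_adjoint_iff]
    intro x y
    have h (u v : E) : ⟪J u, v⟫_ℂ = ⟪J v, u⟫_ℂ := by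
      rw [← inner_conj_swap J v, hJ]
    change ⟪J (π (star (star a.unop)) (J x)), y⟫_ℂ = ⟪x, J (π (star a.unop) (J y))⟫_ℂ
    rw [h, map_star π (star a.unop), ContinuousLinearMap.star_eq_adjoint,
      ContinuousLinearMap.adjoint_inner_right, ← inner_conj_symm x, h, inner_conj_symm]

theorem opRep_apply (J : E ≃ₗᵢ⋆[ℂ] E) (hJ : ∀ x, J (J x) = x) (π : B →⋆ₐ[ℂ] (E →L[ℂ] E))
    (a : Bᵐᵒᵖ) (x : E) : opRep J hJ π a x = J (π (star a.unop) (J x)) := rfl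

/-- The direct sum of two `*`-representations on the Hilbert sum `E ⊕ F`. -/
def directSum (π : B →⋆ₐ[ℂ] (E →L[ℂ] E)) (ρ : B →⋆ₐ[ℂ] (F →L[ℂ] F)) :
    B →⋆ₐ[ℂ] (WithLp 2 (E × F) →L[ℂ] WithLp 2 (E × F)) where
  toFun b := diagOp (π b) (ρ b)
  map_one' := by rw [map_one, map_one]; rfl
  map_mul' a b := by rw [map_mul, map_mul]; rfl
  map_zero' := by rw [map_zero, map_zero]; rfl
  map_add' a b := by rw [map_add, map_add]; rfl
  commutes' c := by rw [AlgHomClass.commutes π, AlgHomClass.commutes ρ]; rfl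
  map_star' a := by
    rw [ContinuousLinearMap.star_eq_adjoint, ContinuousLinearMap.eq_adjoint_iff]
    intro x y
    simp [diagOp_apply, WithLp.prod_inner_apply, map_star, ContinuousLinearMap.star_eq_adjoint,
      ContinuousLinearMap.adjoint_inner_left]

/-- The restriction of a `*`-representation to an invariant closed subspace. -/
def restrictRep (K : Submodule ℂ E) [CompleteSpace K] (π : B →⋆ₐ[ℂ] (E →L[ℂ] E))
    (hK : ∀ b, ∀ x ∈ K, π b x ∈ K) : B →⋆ₐ[ℂ] (K →L[ℂ] K) where
  toFun b := ((π b) ∘L K.subtypeL).codRestrict K fun x => hK b x x.2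
  map_one' := by ext x; simp
  map_mul' a b := by
    ext x
    change π (a * b) x = π a (π b x)
    rw [map_mul]; rfl
  map_zero' := by ext x; simp
  map_add' a b := by
    ext x
    change π (a + b) x = π a x + π b x
    rw [map_add]; rfl
  commutes' c := by ext x; simp [Algebra.algebraMap_eq_smul_one]
  map_star' a := by
    rw [ContinuousLinearMap.star_eq_adjoint, ContinuousLinearMap.eq_adjoint_iff]
    intro x y
    change ⟪π (star a) x, (y : E)⟫_ℂ = ⟪(x : E), π a y⟫_ℂ
    rw [map_star, ContinuousLinearMap.star_eq_adjoint, ContinuousLinearMap.adjoint_inner_left]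

end Reps

section H10
variable (θ : ℝ)

/-- The Hilbert space `H_0`: the completion of `A_θ` for the inner product `τ(b^* a)`. -/
abbrev H0 : Type := (tau θ).GNS

/-- The space of finite sums `∑ a ∂b` with `a, b ∈ A_θ^∞`. -/
def forms : Submodule ℂ (Alg θ) :=
  Submodule.span ℂ {η | ∃ a b : smooth θ, η = (a : Alg θ) * del θ b}

/-- The space `H^{(1,0)}` of `(1,0)`-forms: the Hilbert space completion of the finite sums `∑ a ∂b`,
realised as a closed subspace of `H_0`. The inner product is the one of `inner_forms`. -/
def H10 : Submodule ℂ (H0 θ) := ((forms θ).map (toGNS (tau θ))).topologicalClosure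

instance : CompleteSpace (H10 θ) := (Submodule.isClosed_topologicalClosure _).completeSpace_coe

variable {θ}

/-- The inner product of `H^{(1,0)}`, namely `⟨a ∂b, a' ∂b'⟩ = τ((a')^* a (∂b) (∂b')^*)`, with the
linear variable in second place. -/
theorem inner_forms (a b a' b' : smooth θ) :
    ⟪toGNS (tau θ) (a' * del θ b'), toGNS (tau θ) (a * del θ b)⟫_ℂ =
      tau θ (star (a' : Alg θ) * a * del θ b * star (del θ b')) := by
  rw [inner_toGNS, star_mul, mul_assoc, tau_mul_comm]
  simp only [mul_assoc]

theorem del_mem_forms (b : smooth θ) : del θ b ∈ forms θ :=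
  Submodule.subset_span ⟨1, b, by simp⟩

theorem toGNS_mem_H10 {η : Alg θ} (hη : η ∈ forms θ) : toGNS (tau θ) η ∈ H10 θ :=
  Submodule.le_topologicalClosure _ ⟨η, hη, rfl⟩

theorem star_U_mul_U : star (U θ) * U θ = 1 := by
  refine toOp_injective θ ?_
  rw [map_mul, map_star, map_one, toOp_U]
  have hst : star opU = ((phaseShift 1 (1, 0)).symm.toContinuousLinearEquiv : L2 →L[ℂ] L2) :=
    (phaseShift 1 (1, 0)).adjoint_eq_symm
  rw [hst]
  ext1 f
  exact (phaseShift 1 (1, 0)).symm_apply_apply f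

theorem H10_eq_top : H10 θ = ⊤ := by
  have h (a : smooth θ) : toGNS (tau θ) a ∈ H10 θ := by
    refine toGNS_mem_H10 (Submodule.subset_span ⟨a * star ⟨U θ, U_mem_smooth θ⟩,
      ⟨U θ, U_mem_smooth θ⟩, ?_⟩)
    change (a : Alg θ) = a * star (U θ) * (delta₁ (U θ) + Complex.I • delta₂ (U θ))
    rw [delta₁_U, delta₂_U, smul_zero, add_zero, mul_assoc, star_U_mul_U, mul_one]
  have hd := (denseRange_toGNS (tau θ)).dense_image (continuous_toGNS _) (dense_smooth θ)
  refine eq_top_iff.2 fun x _ => ?_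
  have hc : IsClosed (H10 θ : Set (H0 θ)) := Submodule.isClosed_topologicalClosure _
  refine hc.closure_subset_iff.2 ?_ (hd x)
  rintro _ ⟨a, ha, rfl⟩
  exact h ⟨a, ha⟩

end H10

section Operators
variable {E F G : Type*} [NormedAddCommGroup E] [InnerProductSpace ℂ E]
  [NormedAddCommGroup F] [InnerProductSpace ℂ F] [NormedAddCommGroup G] [InnerProductSpace ℂ G]

/-- The composition `S ∘ T` of unbounded operators on its natural domain
`{x ∈ dom T | T x ∈ dom S}`. -/
def pcomp (S : F →ₗ.[ℂ] G) (T : E →ₗ.[ℂ] F) : E →ₗ.[ℂ] G where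
  domain :=
    { carrier := {x | ∃ hx : x ∈ T.domain, T ⟨x, hx⟩ ∈ S.domain}
      add_mem' := by
        rintro x y ⟨hx, hx'⟩ ⟨hy, hy'⟩
        refine ⟨add_mem hx hy, ?_⟩
        have := add_mem hx' hy'
        rwa [← LinearPMap.map_add] at this
      zero_mem' := ⟨zero_mem _, by
        have : T ⟨0, zero_mem _⟩ = 0 := T.map_zero
        rw [this]; exact zero_mem _⟩
      smul_mem' := by
        rintro c x ⟨hx, hx'⟩
        refine ⟨Submodule.smul_mem _ c hx, ?_⟩
        have := Submodule.smul_mem _ c hx'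
        rwa [← LinearPMap.map_smul] at this }
  toFun :=
    { toFun := fun x => S ⟨T ⟨x, x.2.fst⟩, x.2.snd⟩
      map_add' := fun x y => by
        rw [← LinearPMap.map_add]
        congr 1
        exact Subtype.ext (T.map_add ⟨x, x.2.fst⟩ ⟨y, y.2.fst⟩)
      map_smul' := fun c x => by
        rw [RingHom.id_apply, ← LinearPMap.map_smul]
        congr 1
        exact Subtype.ext (T.map_smul c ⟨x, x.2.fst⟩) }

/-- A bounded operator as an everywhere defined unbounded one. -/
def ofCLM (L : E →L[ℂ] F) : E →ₗ.[ℂ] F := (L : E →ₗ[ℂ] F).toPMap ⊤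

/-- The operator matrix `[[0, S], [T, 0]]` on the Hilbert sum `E ⊕ F`, with domain
`dom T ⊕ dom S`. -/
def offDiag (S : F →ₗ.[ℂ] E) (T : E →ₗ.[ℂ] F) : WithLp 2 (E × F) →ₗ.[ℂ] WithLp 2 (E × F) where
  domain := (T.domain.prod S.domain).comap (WithLp.linearEquiv 2 ℂ (E × F)).toLinearMap
  toFun :=
    { toFun := fun x => WithLp.toLp 2 (S ⟨x.1.snd, x.2.2⟩, T ⟨x.1.fst, x.2.1⟩)
      map_add' := fun x y => by
        refine congrArg (WithLp.toLp 2) (Prod.ext ?_ ?_)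
        · exact S.map_add ⟨x.1.snd, x.2.2⟩ ⟨y.1.snd, y.2.2⟩
        · exact T.map_add ⟨x.1.fst, x.2.1⟩ ⟨y.1.fst, y.2.1⟩
      map_smul' := fun c x => by
        refine congrArg (WithLp.toLp 2) (Prod.ext ?_ ?_)
        · exact S.map_smul c ⟨x.1.snd, x.2.2⟩
        · exact T.map_smul c ⟨x.1.fst, x.2.1⟩ }

end Operators

section Del
variable {θ : ℝ}

/-- The graph of `∂ : A_θ^∞ → H^{(1,0)}` inside `H_ψ × H^{(1,0)}`, where `H_ψ` is the completion of
`A_θ` for the inner product given by `ψ`. -/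
def delGraph (ψ : Alg θ →ₚ[ℂ] ℂ) : Submodule ℂ (ψ.GNS × H10 θ) :=
  LinearMap.range (((toGNS ψ) ∘ₗ (smooth θ).subtype.toLinearMap).prod
    (((toGNS (tau θ)) ∘ₗ del θ).codRestrict (H10 θ) fun b => toGNS_mem_H10 (del_mem_forms b)))

/-- The operator `∂` viewed as a closed unbounded operator from `H_ψ` to `H^{(1,0)}`: the closure of
`∂` on `A_θ^∞`. For `ψ = τ` and `ψ = φ` the closure of the graph is a graph, see
`delOp_tau_graph` and `delOp_phi_graph`. -/
def delOp (ψ : Alg θ →ₚ[ℂ] ℂ) : ψ.GNS →ₗ.[ℂ] H10 θ := (delGraph ψ).topologicalClosure.toLinearPMap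

/-- The formal adjoint `∂^* = δ₁ - i δ₂`. -/
def delStar (θ : ℝ) (a : Alg θ) : Alg θ := delta₁ a - Complex.I • delta₂ a

theorem tau_alpha (s : ℝ × ℝ) (a : Alg θ) : tau θ (alpha θ s a) = tau θ a := by
  have h1 : (diagUnitary s).symm vac = vac := by
    ext p
    by_cases hp : p = (0, 0)
    · subst hp; simp [diagUnitary]
    · simp [diagUnitary, vac, lp.single_apply, Pi.single_eq_of_ne hp]
  change ⟪vac, diagUnitary s (toOp θ a ((diagUnitary s).symm vac))⟫_ℂ = ⟪vac, toOp θ a vac⟫_ℂ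
  rw [h1, ← (diagUnitary s).inner_map_map vac (toOp θ a vac)]
  congr 1
  rw [← (diagUnitary s).symm_apply_eq, h1]

theorem tau_deriv_aux (u v : ℝ → Alg θ) (hu : DifferentiableAt ℝ u 0) (hv : DifferentiableAt ℝ v 0)
    (hc : ∀ t, tau θ (star (u t) * v t) = tau θ (star (u 0) * v 0)) :
    tau θ (star (-Complex.I • deriv u 0) * v 0) = tau θ (star (u 0) * (-Complex.I • deriv v 0)) := by
  let L : Alg θ →L[ℂ] ℂ := ⟨(tau θ).toLinearMap, continuous_tau θ⟩
  have h1 := (hu.hasDerivAt.star.mul hv.hasDerivAt)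
  have h2 := (L.restrictScalars ℝ).hasFDerivAt.comp_hasDerivAt (0 : ℝ) h1
  have h3 : HasDerivAt (fun t => tau θ (star (u t) * v t)) 0 (0 : ℝ) := by
    simp only [hc]; exact hasDerivAt_const _ _
  have h4 : tau θ (star (deriv u 0) * v 0 + star (u 0) * deriv v 0) = 0 := h2.unique h3
  rw [map_add] at h4
  simp only [star_smul, smul_mul_assoc, mul_smul_comm, map_smul, star_neg, Complex.star_def,
    Complex.conj_I, neg_neg, smul_eq_mul]
  linear_combination Complex.I * h4

theorem tau_del (a c : smooth θ) :
    tau θ (star (del θ a) * c) = tau θ (star (a : Alg θ) * delStar θ c) := by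
  have hc (s : ℝ × ℝ) : tau θ (star (alpha θ s a) * alpha θ s c) = tau θ (star (a : Alg θ) * c) := by
    rw [← map_star, ← map_mul, tau_alpha]
  have h0 (b : Alg θ) : alpha θ (0, 0) b = b := by
    refine toOp_injective θ ?_
    ext f p
    change diagUnitary (0, 0) (toOp θ b ((diagUnitary (0, 0)).symm f)) p = _
    have : (diagUnitary (0, 0)).symm f = f := by ext q; simp [diagUnitary]
    rw [this]; simp [diagUnitary]
  have h1 := tau_deriv_aux _ _ (smooth_diff₁ a) (smooth_diff₁ c) fun t => by rw [hc, hc]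
  have h2 := tau_deriv_aux _ _ (smooth_diff₂ a) (smooth_diff₂ c) fun t => by rw [hc, hc]
  rw [h0, h0] at h1 h2
  change tau θ (star (delta₁ (a : Alg θ) + Complex.I • delta₂ (a : Alg θ)) * c) =
    tau θ (star (a : Alg θ) * (delta₁ (c : Alg θ) - Complex.I • delta₂ (c : Alg θ)))
  change tau θ (star (delta₁ (a : Alg θ)) * c) = tau θ (star (a : Alg θ) * delta₁ (c : Alg θ)) at h1
  change tau θ (star (delta₂ (a : Alg θ)) * c) = tau θ (star (a : Alg θ) * delta₂ (c : Alg θ)) at h2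
  simp only [star_add, star_smul, add_mul, mul_sub, smul_mul_assoc, mul_smul_comm, map_add, map_sub,
    map_smul, h1, h2, Complex.star_def, Complex.conj_I, smul_eq_mul]
  ring

/-- The closure of the graph of `∂` is the graph of an operator. -/
theorem delOp_graph (ψ : Alg θ →ₚ[ℂ] ℂ) (e : Alg θ) (he : ∀ a, ψ (a * e) = tau θ a) :
    (delOp ψ).graph = (delGraph ψ).topologicalClosure := by
  refine Submodule.toLinearPMap_graph_eq _ fun x hx hx0 => ?_
  have key (c : smooth θ) : ⟪(x.2 : H0 θ), toGNS (tau θ) c⟫_ℂ = 0 := by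
    have hcl : IsClosed {x : ψ.GNS × H10 θ | ⟪(x.2 : H0 θ), toGNS (tau θ) c⟫_ℂ =
        ⟪x.1, toGNS ψ (delStar θ c * e)⟫_ℂ} :=
      isClosed_eq (by fun_prop) (by fun_prop)
    have : x ∈ {x : ψ.GNS × H10 θ | ⟪(x.2 : H0 θ), toGNS (tau θ) c⟫_ℂ =
        ⟪x.1, toGNS ψ (delStar θ c * e)⟫_ℂ} := by
      refine hcl.closure_subset_iff.2 ?_ hx
      rintro _ ⟨a, rfl⟩
      change ⟪toGNS (tau θ) (del θ a), toGNS (tau θ) c⟫_ℂ =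
        ⟪toGNS ψ a, toGNS ψ (delStar θ c * e)⟫_ℂ
      rw [inner_toGNS, inner_toGNS, ← mul_assoc, he, tau_del]
    rw [this, hx0, inner_zero_left]
  have hd := (denseRange_toGNS (tau θ)).dense_image (continuous_toGNS _) (dense_smooth θ)
  refine Subtype.ext (hd.eq_zero_of_inner_left (𝕜 := ℂ) fun v hv' => ?_)
  obtain ⟨c, hc, hv⟩ := hv'
  rw [← hv]
  exact key ⟨c, hc⟩

theorem delOp_tau_graph : (delOp (tau θ)).graph = (delGraph (tau θ)).topologicalClosure :=
  delOp_graph _ 1 fun a => by rw [mul_one]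

theorem delOp_phi_graph (h : selfAdjoint (smooth θ)) :
    (delOp (phi h)).graph = (delGraph (phi h)).topologicalClosure :=
  delOp_graph _ (expS h 1) fun a => by
    have h2 := congrArg Subtype.val (expS_add h 1 (-1))
    have h1 : ((expS h (-1) : smooth θ) : Alg θ) = NormedSpace.exp (-((h : smooth θ) : Alg θ)) := by
      change NormedSpace.exp _ = _
      simp
    rw [add_neg_cancel, expS_zero] at h2
    rw [phi_apply, ← h1, mul_assoc]
    exact (congrArg (fun z => tau θ (a * z)) h2).symm.trans (congrArg (tau θ) (mul_one a))

end Del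

section Tomita
variable {θ : ℝ}

/-- The power `Δ^t (x) = e^{-t h} x e^{t h}` of the modular operator `Δ (x) = e^{-h} x e^h` of `φ`. -/
def modularPow (h : selfAdjoint (smooth θ)) (t : ℝ) : Alg θ →ₗ[ℂ] Alg θ :=
  LinearMap.mulLeft ℂ (expS h (-t) : Alg θ) ∘ₗ LinearMap.mulRight ℂ (expS h t : Alg θ)

theorem modularPow_apply (h : selfAdjoint (smooth θ)) (t : ℝ) (x : Alg θ) :
    modularPow h t x = expS h (-t) * (x * expS h t) := rfl

theorem coe_expS_mul (h : selfAdjoint (smooth θ)) (s t : ℝ) :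
    (expS h s : Alg θ) * expS h t = expS h (s + t) :=
  (congrArg Subtype.val (expS_add h s t)).symm

theorem coe_expS_zero (h : selfAdjoint (smooth θ)) : (expS h 0 : Alg θ) = 1 :=
  congrArg Subtype.val (expS_zero h)

theorem coe_star_expS (h : selfAdjoint (smooth θ)) (t : ℝ) :
    star (expS h t : Alg θ) = expS h t := congrArg Subtype.val (star_expS h t)

theorem modularPow_modularPow (h : selfAdjoint (smooth θ)) (s t : ℝ) (x : Alg θ) :
    modularPow h s (modularPow h t x) = modularPow h (s + t) x := by
  simp only [modularPow_apply]
  rw [show -(s + t) = -s + -t by ring, ← coe_expS_mul, add_comm s t, ← coe_expS_mul]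
  simp only [mul_assoc]

theorem modularPow_zero (h : selfAdjoint (smooth θ)) (x : Alg θ) : modularPow h 0 x = x := by
  simp [modularPow_apply, coe_expS_zero]

theorem star_modularPow (h : selfAdjoint (smooth θ)) (t : ℝ) (x : Alg θ) :
    star (modularPow h t x) = modularPow h (-t) (star x) := by
  simp [modularPow_apply, coe_star_expS, mul_assoc]

/-- The antilinear map `x ↦ (Δ^{-1/2} x)^*` on `A_θ`. -/
def tomitaPre (h : selfAdjoint (smooth θ)) : Alg θ ≃ₗ⋆[ℂ] Alg θ where
  toFun x := star (modularPow h (-(1 / 2)) x)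
  invFun x := star (modularPow h (-(1 / 2)) x)
  map_add' x y := by simp
  map_smul' c x := by simp
  left_inv x := by
    beta_reduce
    rw [star_modularPow, star_modularPow, star_modularPow, star_star, modularPow_modularPow]; simp [modularPow_zero]
  right_inv x := by
    beta_reduce
    rw [star_modularPow, star_modularPow, star_modularPow, star_star, modularPow_modularPow]; simp [modularPow_zero]

theorem tomitaPre_apply (h : selfAdjoint (smooth θ)) (x : Alg θ) :
    tomitaPre h x = star (modularPow h (-(1 / 2)) x) := rfl

theorem phi_tomitaPre (h : selfAdjoint (smooth θ)) (x : Alg θ) :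
    phi h (star (tomitaPre h x) * tomitaPre h x) = phi h (star x * x) := by
  have hab : (expS h (1 / 2) : Alg θ) * expS h (-(1 / 2)) = 1 := by
    rw [coe_expS_mul, add_neg_cancel, coe_expS_zero]
  have hba : (expS h (-(1 / 2)) : Alg θ) * expS h (1 / 2) = 1 := by
    rw [coe_expS_mul, neg_add_cancel, coe_expS_zero]
  rw [tomitaPre_apply, star_star, star_modularPow, neg_neg, phi_apply, phi_apply, exp_neg_eq,
    modularPow_apply, modularPow_apply, neg_neg]
  generalize (expS h (1 / 2) : Alg θ) = a at *
  generalize (expS h (-(1 / 2)) : Alg θ) = b at *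
  calc tau θ (a * (x * b) * (b * (star x * a)) * (b * b))
      = tau θ (a * (x * b * b * star x * (a * b) * b)) := by simp only [mul_assoc]
    _ = tau θ (x * b * b * star x * (b * a)) := by
      rw [hab, mul_one, tau_mul_comm]; simp only [mul_assoc]
    _ = tau θ (star x * x * (b * b)) := by
      rw [hba, mul_one, tau_mul_comm]; simp only [mul_assoc]

/-- The Tomita antilinear unitary `J_φ` in `H_φ`: the antiunitary part in the polar decomposition
`a^* = J_φ Δ^{1/2} a`, see `tomitaJ_modular`. -/
def tomitaJ (h : selfAdjoint (smooth θ)) : (phi h).GNS ≃ₗᵢ⋆[ℂ] (phi h).GNS :=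
  extendConj (phi h) (tomitaPre h) (phi_tomitaPre h)

theorem tomitaJ_involutive (h : selfAdjoint (smooth θ)) (x : (phi h).GNS) :
    tomitaJ h (tomitaJ h x) = x :=
  extendConj_invol _ _ _ (fun a => (tomitaPre h).left_inv a) x

theorem tomitaJ_modular (h : selfAdjoint (smooth θ)) (a : Alg θ) :
    tomitaJ h (toGNS (phi h) (modularPow h (1 / 2) a)) = toGNS (phi h) (star a) := by
  rw [tomitaJ, extendConj_toGNS, tomitaPre_apply, modularPow_modularPow, neg_add_cancel,
    modularPow_zero]

/-- The antiunitary involution of `H_0` extending `a ↦ a^*`. -/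
def starJ (θ : ℝ) : H0 θ ≃ₗᵢ⋆[ℂ] H0 θ :=
  extendConj (tau θ) (starLinearEquiv ℂ) fun a => by
    change tau θ (star (star a) * star a) = _
    rw [star_star, tau_mul_comm]

theorem starJ_involutive (x : H0 θ) : starJ θ (starJ θ x) = x :=
  extendConj_invol _ _ _ (fun a => star_star a) x

/-- The right multiplication `b ↦ b a` on `H_0`. -/
def rightH0 (θ : ℝ) : (Alg θ)ᵐᵒᵖ →⋆ₐ[ℂ] (H0 θ →L[ℂ] H0 θ) :=
  opRep (starJ θ) starJ_involutive (tau θ).gnsStarAlgHom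

theorem rightH0_toGNS (a b : Alg θ) :
    rightH0 θ (.op a) (toGNS (tau θ) b) = toGNS (tau θ) (b * a) := by
  have hs (x : Alg θ) : starJ θ (toGNS (tau θ) x) = toGNS (tau θ) (star x) :=
    extendConj_toGNS _ _ _ x
  rw [rightH0, opRep_apply, hs, MulOpposite.unop_op, gns_toGNS, hs, star_mul, star_star, star_star]

/-- The left action of `A_θ` on `H^{(1,0)}` by left multiplication. -/
def leftH10 (θ : ℝ) : Alg θ →⋆ₐ[ℂ] (H10 θ →L[ℂ] H10 θ) :=
  restrictRep (H10 θ) (tau θ).gnsStarAlgHom fun _ _ _ => H10_eq_top (θ := θ) ▸ Submodule.mem_top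

/-- The right action of `A_θ` on `H^{(1,0)}` by right multiplication. -/
def rightH10 (θ : ℝ) : (Alg θ)ᵐᵒᵖ →⋆ₐ[ℂ] (H10 θ →L[ℂ] H10 θ) :=
  restrictRep (H10 θ) (rightH0 θ) fun _ _ _ => H10_eq_top (θ := θ) ▸ Submodule.mem_top

/-- The Hilbert space `H = H_φ ⊕ H^{(1,0)}`. -/
abbrev HS (h : selfAdjoint (smooth θ)) : Type := WithLp 2 ((phi h).GNS × H10 θ)

instance (h : selfAdjoint (smooth θ)) : NormedAddCommGroup (HS h) := inferInstance
instance (h : selfAdjoint (smooth θ)) : InnerProductSpace ℂ (HS h) := inferInstance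
instance (h : selfAdjoint (smooth θ)) : NormedSpace ℂ (HS h) := inferInstance
/-- The left action of `A_θ` on `H = H_φ ⊕ H^{(1,0)}`. -/
def leftAction (h : selfAdjoint (smooth θ)) : Alg θ →⋆ₐ[ℂ] (HS h →L[ℂ] HS h) :=
  directSum (phi h).gnsStarAlgHom (leftH10 θ)

/-- The right action `a ↦ a^op` of `A_θ` on `H = H_φ ⊕ H^{(1,0)}`: `a ↦ J_φ a^* J_φ` on `H_φ` and
right multiplication on `H^{(1,0)}`. -/
def rightAction (h : selfAdjoint (smooth θ)) : (Alg θ)ᵐᵒᵖ →⋆ₐ[ℂ] (HS h →L[ℂ] HS h) :=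
  directSum (opRep (tomitaJ h) (tomitaJ_involutive h) (phi h).gnsStarAlgHom) (rightH10 θ)

/-- The grading `γ = 1 ⊕ (-1)` of `H = H_φ ⊕ H^{(1,0)}`. -/
def grading (h : selfAdjoint (smooth θ)) : HS h →L[ℂ] HS h := diagOp 1 (-1)

/-- The operator `D = [[0, ∂_φ^*], [∂_φ, 0]]` on `H = H_φ ⊕ H^{(1,0)}`. -/
def dirac (h : selfAdjoint (smooth θ)) : HS h →ₗ.[ℂ] HS h :=
  offDiag (delOp (phi h)).adjoint (delOp (phi h))

/-- The inclusion of the opposite algebra of `A_θ^∞` in that of `A_θ`. -/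
def smoothOp (θ : ℝ) : (smooth θ)ᵐᵒᵖ →⋆ₐ[ℂ] (Alg θ)ᵐᵒᵖ where
  toFun a := .op (a.unop : Alg θ)
  map_one' := rfl
  map_mul' _ _ := rfl
  map_zero' := rfl
  map_add' _ _ := rfl
  commutes' _ := rfl
  map_star' _ := rfl

/-- The automorphism `a^op ↦ (k⁻¹ a k)^op` of the opposite algebra of `A_θ^∞`. -/
def twist (h : selfAdjoint (smooth θ)) : (smooth θ)ᵐᵒᵖ ≃ₐ[ℂ] (smooth θ)ᵐᵒᵖ where
  toFun a := .op (↑(weyl h)⁻¹ * a.unop * weyl h)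
  invFun a := .op (weyl h * a.unop * ↑(weyl h)⁻¹)
  left_inv a := by
    refine MulOpposite.unop_injective ?_
    simp [mul_assoc]
  right_inv a := by
    refine MulOpposite.unop_injective ?_
    simp [mul_assoc]
  map_mul' a b := by
    refine MulOpposite.unop_injective ?_
    simp [mul_assoc]
  map_add' a b := by
    refine MulOpposite.unop_injective ?_
    simp [mul_add, add_mul]
  commutes' c := by
    refine MulOpposite.unop_injective ?_
    simp [← Algebra.commutes, mul_assoc]

/-- The Laplacian `∂^* ∂` on `H_0`. -/
def laplacian (θ : ℝ) : H0 θ →ₗ.[ℂ] H0 θ :=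
  pcomp (delOp (tau θ)).adjoint (delOp (tau θ))

/-- The operator `k ∘ (∂^* ∂) ∘ k` on `H_0`, with `k = e^{h/2}` acting by left multiplication. -/
def weylLaplacian (h : selfAdjoint (smooth θ)) : H0 θ →ₗ.[ℂ] H0 θ :=
  let K := ofCLM ((tau θ).gnsStarAlgHom ((weyl h : smooth θ) : Alg θ))
  pcomp K (pcomp (laplacian θ) K)

end Tomita

section SpectralTriple
variable {𝒜 H : Type*} [Ring 𝒜] [StarRing 𝒜] [Algebra ℂ 𝒜] 
  [NormedAddCommGroup H] [InnerProductSpace ℂ H] [CompleteSpace H]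

/-- Every non-real `z` is in the resolvent set of `D` and `(D - z)⁻¹` is compact. -/
def HasCompactResolvent (D : H →ₗ.[ℂ] H) : Prop :=
  ∀ z : ℂ, z.im ≠ 0 → ∃ R : H →L[ℂ] H, IsCompactOperator R ∧
    (∀ y : H, ∃ hy : R y ∈ D.domain, D ⟨R y, hy⟩ - z • R y = y) ∧
    ∀ x : D.domain, R (D x - z • (x : H)) = x

/-- `S` maps the domain of `D` to itself and `D S - T D` is bounded there. -/
def IsBoundedTwistedCommutator (D : H →ₗ.[ℂ] H) (S T : H →L[ℂ] H) : Prop :=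
  ∃ B : H →L[ℂ] H, ∀ x : D.domain, ∃ hx : S x ∈ D.domain, D ⟨S x, hx⟩ - T (D x) = B x

/-- `(𝒜, H, D)` is an even twisted spectral triple for the representation `π`, the automorphism `σ`
of the `*`-algebra `𝒜` (with `σ(a^*) = (σ⁻¹ a)^*`) and the grading `γ`: the operator `D` is
self-adjoint with compact resolvent, the twisted commutators `D a - σ(a) D` are bounded, and `γ` is a
self-adjoint involution that commutes with `𝒜` and anticommutes with `D`. -/
structure IsEvenTwistedSpectralTriple (π : 𝒜 →⋆ₐ[ℂ] (H →L[ℂ] H)) (σ : 𝒜 ≃ₐ[ℂ] 𝒜)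
    (D : H →ₗ.[ℂ] H) (γ : H →L[ℂ] H) : Prop where
  star_twist : ∀ a, σ (star a) = star (σ.symm a)
  selfAdjoint : IsSelfAdjoint D
  compactResolvent : HasCompactResolvent D
  bounded : ∀ a, IsBoundedTwistedCommutator D (π a) (π (σ a))
  grading_star : IsSelfAdjoint γ
  grading_sq : γ * γ = 1
  grading_comm : ∀ a, γ * π a = π a * γ
  grading_anti : ∀ x : D.domain, ∃ hx : γ x ∈ D.domain, D ⟨γ x, hx⟩ = -γ (D x)

/-- An even spectral triple: the untwisted case, with bounded commutators `D a - a D`. -/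
def IsEvenSpectralTriple (π : 𝒜 →⋆ₐ[ℂ] (H →L[ℂ] H)) (D : H →ₗ.[ℂ] H) (γ : H →L[ℂ] H) : Prop :=
  IsEvenTwistedSpectralTriple π AlgEquiv.refl D γ

end SpectralTriple

section Trace
variable {H : Type} [NormedAddCommGroup H] [InnerProductSpace ℂ H]

/-- `P = |T|^z` for an operator `T` with an orthonormal basis of eigenvectors with real eigenvalues,
with the usual convention that `|T|^z` is zero on the kernel of `T`. -/
def IsAbsPower (T : H →ₗ.[ℂ] H) (z : ℂ) (P : H →L[ℂ] H) : Prop :=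
  ∃ (ι : Type) (b : HilbertBasis ι ℂ H) (μ : ι → ℝ),
    (∀ i, ∃ hi : b i ∈ T.domain, T ⟨b i, hi⟩ = (μ i : ℂ) • b i) ∧
    ∀ i, P (b i) = (if μ i = 0 then 0 else ((|μ i| : ℝ) : ℂ) ^ z) • b i

/-- `P = T^z` for a positive operator `T` with an orthonormal basis of eigenvectors, with the usual
convention that `T^z` is zero on the kernel of `T`. -/
def IsPosPower (T : H →ₗ.[ℂ] H) (z : ℂ) (P : H →L[ℂ] H) : Prop :=
  ∃ (ι : Type) (b : HilbertBasis ι ℂ H) (μ : ι → ℝ),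
    (∀ i, 0 ≤ μ i ∧ ∃ hi : b i ∈ T.domain, T ⟨b i, hi⟩ = (μ i : ℂ) • b i) ∧
    ∀ i, P (b i) = (if μ i = 0 then 0 else (μ i : ℂ) ^ z) • b i

/-- `P` is of trace class with trace `t`: in every orthonormal basis the diagonal of `P` is
(unconditionally) summable, with sum `t`. -/
def HasTrace (P : H →L[ℂ] H) (t : ℂ) : Prop :=
  ∀ (ι : Type) (b : HilbertBasis ι ℂ H), HasSum (fun i => ⟪b i, P (b i)⟫_ℂ) t

end Trace

end NCTorus

end

/-!
The algebraic facts hidden in the definitions are that `J_φ a^* J_φ` is the right multiplication by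
`k⁻¹ a k` on `H_φ`, and that the identity of `A_θ` extends to an isomorphism `H_φ → H_0` under
which `∂_φ` becomes `∂`. It is the product `R_k W` of the unitary `W : a ↦ a k⁻¹` and of the right
multiplication by `k`. So `∂_φ = ∂ R_k W`, and everything is deduced from the operator `∂` on
`H_0`, which is diagonal in the basis of the monomials `Uⁿ Vᵐ`, with eigenvalues `n + i m`.

*Spectral triples.* For a closed densely defined `T` the operator `[[0, T†], [T, 0]]` is
self-adjoint (`isSelfAdjoint_offDiag`), by the orthogonal decomposition of the graph. Its resolvent
is compact if the domains of `T` and `T†` embed compactly, and for `T = ∂_φ` Rellich's criterion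
applies as `|n + i m| → ∞`. The Leibniz rule gives `∂(a b) = a ∂b + (∂a) b` and
`∂(b c) = (∂b) c + b ∂c`, hence bounded commutators of `∂_φ` with the left action and, with
`c = k⁻¹ a k`, bounded twisted commutators with the right action. The statements for `∂_φ^*` follow
by taking adjoints (`adjoint_commutator`); that the twist fits here as well amounts to
`σ(x^*) = σ⁻¹(x)^*`.

*Traces.* Since the domain of `∂_φ` embeds compactly, `∂_φ^* ∂_φ` has a Hilbert basis of
eigenvectors `b i`, with eigenvalues `μ i ≥ 0` (`exists_isSingularSystem`). Each `μ i ≠ 0` gives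
the two eigenvalues `± √μ i` of `D`, and the rest of the space is the kernel of `D`; this is the
factor `2` (`IsSingularSystem.exists_offDiag_eigenbasis`). On the other hand `W` carries
`∂_φ^* ∂_φ` to `R_k ∂^* ∂ R_k`, and the antiunitary `J : a ↦ a^*` of `H_0` intertwines the right
with the left multiplication by `k` and commutes with `∂^* ∂`. Hence `J W (b i)` is a Hilbert basis
of eigenvectors of `k ∂^* ∂ k`, with the same eigenvalues `μ i` (`weylLaplacian_weylConj`). Finally
`∑ μ i ^ (-σ)`, over `μ i ≠ 0`, is finite for `σ > 1`: the vectors `f i = ∂_φ (b i) / √μ i` are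
orthonormal with `‖∂^* f i‖² ≤ C μ i`, so `∑ (1 + C μ i) ^ (-σ)` is bounded by Jensen's inequality
by `∑ (1 + n² + m²) ^ (-σ)` (`IsSingularSystem.summable_rpow`).
-/

noncomputable section

namespace NCTorus

open LinearPMap Filter Topology

/-! ### Operator matrices of closed operators -/

section Adjoint
variable {E F : Type*} [NormedAddCommGroup E] [InnerProductSpace ℂ E]
  [NormedAddCommGroup F] [InnerProductSpace ℂ F]

theorem inner_self_eq_ofReal (x : E) : ⟪x, x⟫_ℂ = ((‖x‖ ^ 2 : ℝ) : ℂ) := by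
  rw [inner_self_eq_norm_sq_to_K]
  push_cast
  rfl

theorem mem_graph_iff_exists {T : E →ₗ.[ℂ] F} {x : E} {y : F} :
    (x, y) ∈ T.graph ↔ ∃ hx : x ∈ T.domain, T ⟨x, hx⟩ = y := by
  rw [LinearPMap.mem_graph_iff]
  constructor
  · rintro ⟨⟨u, hu⟩, rfl, h⟩; exact ⟨hu, h⟩
  · rintro ⟨hx, h⟩; exact ⟨⟨x, hx⟩, rfl, h⟩

theorem mem_offDiag_graph {S : F →ₗ.[ℂ] E} {T : E →ₗ.[ℂ] F} {a b : WithLp 2 (E × F)} :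
    (a, b) ∈ (offDiag S T).graph ↔ (a.fst, b.snd) ∈ T.graph ∧ (a.snd, b.fst) ∈ S.graph := by
  simp only [mem_graph_iff_exists]
  constructor
  · rintro ⟨⟨h1, h2⟩, rfl⟩
    exact ⟨⟨h1, rfl⟩, ⟨h2, rfl⟩⟩
  · rintro ⟨⟨h1, h3⟩, ⟨h2, h4⟩⟩
    refine ⟨⟨h1, h2⟩, ?_⟩
    change WithLp.toLp 2 (S ⟨a.snd, h2⟩, T ⟨a.fst, h1⟩) = b
    rw [h3, h4]
    rfl

theorem dense_offDiag_domain {S : F →ₗ.[ℂ] E} {T : E →ₗ.[ℂ] F} (hS : Dense (S.domain : Set F))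
    (hT : Dense (T.domain : Set E)) : Dense ((offDiag S T).domain : Set (WithLp 2 (E × F))) := by
  have h := (hT.prod hS).preimage (WithLp.prodContinuousLinearEquiv 2 ℂ E F).toHomeomorph.isOpenMap
  exact h

variable [CompleteSpace E]

theorem mem_adjoint_graph_iff {T : E →ₗ.[ℂ] F} (hT : Dense (T.domain : Set E)) {y : F} {z : E} :
    (y, z) ∈ T.adjoint.graph ↔ ∀ x w, (x, w) ∈ T.graph → ⟪z, x⟫_ℂ = ⟪y, w⟫_ℂ := by
  rw [mem_graph_iff_exists]
  constructor
  · rintro ⟨hy, rfl⟩ x w hxw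
    obtain ⟨hx, rfl⟩ := mem_graph_iff_exists.1 hxw
    exact adjoint_isFormalAdjoint hT ⟨y, hy⟩ ⟨x, hx⟩
  · intro h
    have h' : ∀ x : T.domain, ⟪z, x⟫_ℂ = ⟪y, T x⟫_ℂ := fun x => h _ _ (T.mem_graph x)
    exact ⟨mem_adjoint_domain_of_exists y ⟨z, h'⟩, adjoint_apply_eq hT _ h'⟩

variable [CompleteSpace F]

/-- Von Neumann's lemma: for a closed densely defined `T`, the graphs of `T` and of `-T†` (flipped)
are orthogonal complements of each other, so every pair `(u, v)` splits as
`(x, T x) + (T† w, -w)`, with `x` and `T x` depending continuously on `(u, v)`. -/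
theorem exists_graph_decomposition {T : E →ₗ.[ℂ] F} (hT : Dense (T.domain : Set E))
    (hc : T.IsClosed) : ∃ (S : E × F →L[ℂ] E) (B : E × F →L[ℂ] F), ∀ u v,
      (S (u, v), B (u, v)) ∈ T.graph ∧ (B (u, v) - v, u - S (u, v)) ∈ T.adjoint.graph := by
  let e := WithLp.prodContinuousLinearEquiv 2 ℂ E F
  let K : Submodule ℂ (WithLp 2 (E × F)) := T.graph.comap e.toLinearMap
  have hK : IsClosed (K : Set (WithLp 2 (E × F))) := hc.preimage e.continuous
  have : CompleteSpace K := hK.completeSpace_coe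
  let P := K.starProjection
  refine ⟨ContinuousLinearMap.fst ℂ E F ∘L e.toContinuousLinearMap ∘L P ∘L
    e.symm.toContinuousLinearMap, ContinuousLinearMap.snd ℂ E F ∘L e.toContinuousLinearMap ∘L P ∘L
    e.symm.toContinuousLinearMap, fun u v => ⟨?_, ?_⟩⟩
  · exact K.starProjection_apply_mem (e.symm (u, v))
  · rw [mem_adjoint_graph_iff hT]
    intro x w hxw
    have h := K.starProjection_inner_eq_zero (e.symm (u, v)) (e.symm (x, w)) hxw
    rw [WithLp.prod_inner_apply] at h
    change ⟪u - (P (e.symm (u, v))).fst, x⟫_ℂ + ⟪v - (P (e.symm (u, v))).snd, w⟫_ℂ = 0 at h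
    change ⟪u - (P (e.symm (u, v))).fst, x⟫_ℂ = ⟪(P (e.symm (u, v))).snd - v, w⟫_ℂ
    rw [eq_neg_of_add_eq_zero_left h, ← inner_neg_left, neg_sub]

/-- The inclusion `T ⊇ T††` for closed `T`. -/
theorem mem_graph_of_forall_adjoint {T : E →ₗ.[ℂ] F} (hT : Dense (T.domain : Set E))
    (hc : T.IsClosed) {u : E} {v : F}
    (h : ∀ y z, (y, z) ∈ T.adjoint.graph → ⟪v, y⟫_ℂ = ⟪u, z⟫_ℂ) : (u, v) ∈ T.graph := by
  obtain ⟨S, B, hSB⟩ := exists_graph_decomposition hT hc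
  obtain ⟨h1, h2⟩ := hSB u v
  set x := S (u, v)
  set w := B (u, v)
  have h3 := h _ _ h2
  have h4 := (mem_adjoint_graph_iff hT).1 h2 _ _ h1
  -- the remainder `(u - x, v - w)` is orthogonal to `(u, v)` and to `(x, w)`, hence to itself
  have h5 : ⟪u - x, u - x⟫_ℂ + ⟪v - w, v - w⟫_ℂ = 0 := by
    have h4' := congrArg (starRingEnd ℂ) h4
    rw [inner_conj_symm, inner_conj_symm] at h4'
    simp only [inner_sub_left, inner_sub_right] at h3 h4' ⊢
    linear_combination -h3 - h4'
  have h6 : ‖u - x‖ ^ 2 + ‖v - w‖ ^ 2 = 0 := by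
    have := congrArg Complex.re h5
    rwa [Complex.add_re, inner_self_eq_ofReal, inner_self_eq_ofReal, Complex.ofReal_re,
      Complex.ofReal_re] at this
  have hu : u = x := by
    rw [← sub_eq_zero, ← norm_eq_zero]; nlinarith [sq_nonneg ‖u - x‖, sq_nonneg ‖v - w‖]
  have hv : v = w := by
    rw [← sub_eq_zero, ← norm_eq_zero]; nlinarith [sq_nonneg ‖u - x‖, sq_nonneg ‖v - w‖]
  rw [hu, hv]; exact h1

theorem dense_adjoint_domain {T : E →ₗ.[ℂ] F} (hT : Dense (T.domain : Set E))
    (hc : T.IsClosed) : Dense (T.adjoint.domain : Set F) := by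
  rw [Submodule.dense_iff_topologicalClosure_eq_top, Submodule.topologicalClosure_eq_top_iff,
    Submodule.eq_bot_iff]
  intro v hv
  have h : ((0 : E), v) ∈ T.graph := mem_graph_of_forall_adjoint hT hc fun y z hyz => by
    rw [inner_zero_left]
    exact (Submodule.mem_orthogonal' _ _).1 hv _ (LinearPMap.mem_domain_of_mem_graph hyz)
  exact T.graph_fst_eq_zero_snd h rfl

theorem isSelfAdjoint_offDiag {T : E →ₗ.[ℂ] F} (hT : Dense (T.domain : Set E))
    (hc : T.IsClosed) : IsSelfAdjoint (offDiag T.adjoint T) := by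
  have hd := dense_offDiag_domain (dense_adjoint_domain hT hc) hT
  rw [LinearPMap.isSelfAdjoint_def]
  refine LinearPMap.eq_of_eq_graph (Submodule.ext fun ⟨a, b⟩ => ?_)
  rw [mem_adjoint_graph_iff hd, mem_offDiag_graph]
  constructor
  · intro h
    constructor
    · refine mem_graph_of_forall_adjoint hT hc fun y z hyz => ?_
      have := h (WithLp.toLp 2 (0, y)) (WithLp.toLp 2 (z, 0))
        (mem_offDiag_graph.2 ⟨zero_mem T.graph, hyz⟩)
      simpa [WithLp.prod_inner_apply] using this
    · rw [mem_adjoint_graph_iff hT]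
      intro x w hxw
      have := h (WithLp.toLp 2 (x, 0)) (WithLp.toLp 2 (0, w))
        (mem_offDiag_graph.2 ⟨hxw, zero_mem T.adjoint.graph⟩)
      simpa [WithLp.prod_inner_apply] using this
  · rintro ⟨h1, h2⟩ c d hcd
    obtain ⟨h3, h4⟩ := mem_offDiag_graph.1 hcd
    have h5 := (mem_adjoint_graph_iff hT).1 h2 _ _ h3
    have h6 := (mem_adjoint_graph_iff hT).1 h4 _ _ h1
    have h6' := congrArg (starRingEnd ℂ) h6
    rw [inner_conj_symm, inner_conj_symm] at h6'
    simp only [WithLp.prod_inner_apply, WithLp.ofLp_fst, WithLp.ofLp_snd]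
    rw [h5, h6', add_comm]

end Adjoint

/-! ### Resolvents of self-adjoint operators -/

section Resolvent
variable {H : Type} [NormedAddCommGroup H] [InnerProductSpace ℂ H] [CompleteSpace H]

theorem inner_self_conj_of_isSelfAdjoint {D : H →ₗ.[ℂ] H} (hD : IsSelfAdjoint D) {x y : H}
    (h : (x, y) ∈ D.graph) : (⟪x, y⟫_ℂ).im = 0 := by
  have h' : (x, y) ∈ D.adjoint.graph := by rwa [LinearPMap.isSelfAdjoint_def.1 hD]
  have h1 := (mem_adjoint_graph_iff hD.dense_domain).1 h' _ _ h
  rw [← Complex.conj_eq_iff_im, inner_conj_symm, h1]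

theorem norm_le_of_isSelfAdjoint {D : H →ₗ.[ℂ] H} (hD : IsSelfAdjoint D) (z : ℂ) {x y : H}
    (h : (x, y) ∈ D.graph) : |z.im| * ‖x‖ ≤ ‖y - z • x‖ := by
  have h1 : (⟪x, y - z • x⟫_ℂ).im = -(z.im * ‖x‖ ^ 2) := by
    rw [inner_sub_right, inner_smul_right, Complex.sub_im, inner_self_conj_of_isSelfAdjoint hD h,
      inner_self_eq_ofReal, Complex.im_mul_ofReal]
    ring
  have h2 : |z.im| * ‖x‖ ^ 2 ≤ ‖x‖ * ‖y - z • x‖ := by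
    calc |z.im| * ‖x‖ ^ 2 = |(⟪x, y - z • x⟫_ℂ).im| := by
          rw [h1, abs_neg, abs_mul, abs_of_nonneg (sq_nonneg ‖x‖)]
      _ ≤ ‖⟪x, y - z • x⟫_ℂ‖ := Complex.abs_im_le_norm _
      _ ≤ _ := norm_inner_le_norm _ _
  rcases (norm_nonneg x).eq_or_lt with hx | hx
  · rw [← hx]; simp
  · nlinarith

/-- A self-adjoint operator has a bounded resolvent at every non-real point. -/
theorem exists_resolvent {D : H →ₗ.[ℂ] H} (hD : IsSelfAdjoint D) {z : ℂ} (hz : z.im ≠ 0) :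
    ∃ R : H →L[ℂ] H, (∀ y, (R y, y + z • R y) ∈ D.graph) ∧
      ∀ x w, (x, w) ∈ D.graph → R (w - z • x) = x := by
  have hz' : 0 < |z.im| := abs_pos.2 hz
  have : CompleteSpace D.graph := by
    have h : _root_.IsClosed (D.graph : Set (H × H)) := hD.isClosed
    exact h.completeSpace_coe
  let g : D.graph →L[ℂ] H :=
    (ContinuousLinearMap.snd ℂ H H - z • ContinuousLinearMap.fst ℂ H H) ∘L D.graph.subtypeL
  have hg (p : D.graph) : g p = p.1.2 - z • p.1.1 := rfl
  have hb (p : D.graph) : |z.im| * ‖p.1.1‖ ≤ ‖g p‖ := norm_le_of_isSelfAdjoint hD z p.2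
  have hb1 (p : D.graph) : ‖p.1.1‖ ≤ |z.im|⁻¹ * ‖g p‖ := by
    rw [inv_mul_eq_div, le_div_iff₀ hz', mul_comm]; exact hb p
  have hb2 (p : D.graph) : ‖p.1.2‖ ≤ (1 + ‖z‖ * |z.im|⁻¹) * ‖g p‖ := by
    have : p.1.2 = g p + z • p.1.1 := by rw [hg]; abel
    calc ‖p.1.2‖ = ‖g p + z • p.1.1‖ := congrArg _ this
      _ ≤ ‖g p‖ + ‖z‖ * ‖p.1.1‖ := (norm_add_le _ _).trans_eq (by rw [norm_smul])
      _ ≤ ‖g p‖ + ‖z‖ * (|z.im|⁻¹ * ‖g p‖) := by gcongr; exact hb1 p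
      _ = _ := by ring
  have hanti : ∀ p, ‖p‖ ≤ (⟨|z.im|⁻¹ + (1 + ‖z‖ * |z.im|⁻¹), by positivity⟩ : NNReal) * ‖g p‖ := by
    intro p
    change max ‖p.1.1‖ ‖p.1.2‖ ≤ (|z.im|⁻¹ + (1 + ‖z‖ * |z.im|⁻¹)) * ‖g p‖
    rw [add_mul]
    exact max_le ((hb1 p).trans (le_add_of_nonneg_right (by positivity)))
      ((hb2 p).trans (le_add_of_nonneg_left (by positivity)))
  have hA := AddMonoidHomClass.antilipschitz_of_bound g hanti
  have hcl : IsClosed (Set.range g) := hA.isClosed_range g.uniformContinuous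
  have hcl' : IsClosed (g.range : Set H) := hcl
  have hsurj : g.range = ⊤ := by
    have : CompleteSpace g.range := hcl'.completeSpace_coe
    rw [← Submodule.orthogonal_eq_bot_iff, Submodule.eq_bot_iff]
    intro v hv
    have hv1 : (v, (starRingEnd ℂ) z • v) ∈ D.graph := by
      have : (v, (starRingEnd ℂ) z • v) ∈ D.adjoint.graph := by
        rw [mem_adjoint_graph_iff hD.dense_domain]
        intro x w hxw
        have h0 : ⟪v, w - z • x⟫_ℂ = 0 :=
          (Submodule.mem_orthogonal' _ _).1 hv _ ⟨⟨(x, w), hxw⟩, rfl⟩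
        rw [inner_smul_left, Complex.conj_conj]
        rw [inner_sub_right, inner_smul_right, sub_eq_zero] at h0
        exact h0.symm
      rwa [LinearPMap.isSelfAdjoint_def.1 hD] at this
    have h1 := norm_le_of_isSelfAdjoint hD ((starRingEnd ℂ) z) hv1
    rw [sub_self, norm_zero, Complex.conj_im, abs_neg] at h1
    rw [← norm_eq_zero]
    nlinarith [norm_nonneg v]
  let e : D.graph ≃ₗ[ℂ] H := LinearEquiv.ofBijective (g : D.graph →ₗ[ℂ] H)
    ⟨hA.injective, LinearMap.range_eq_top.1 hsurj⟩
  have he (p : D.graph) : e p = g p := rfl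
  have he' (y : H) : g (e.symm y) = y := e.apply_symm_apply y
  let R : H →L[ℂ] H := (LinearMap.fst ℂ H H ∘ₗ D.graph.subtype ∘ₗ e.symm.toLinearMap).mkContinuous
    |z.im|⁻¹ fun y => (hb1 (e.symm y)).trans_eq (by rw [he'])
  have hR (y : H) : R y = (e.symm y).1.1 := rfl
  refine ⟨R, fun y => ?_, fun x w hxw => ?_⟩
  · have h1 : y + z • R y = (e.symm y).1.2 := by
      rw [hR, ← sub_eq_iff_eq_add.1 ((hg _).symm.trans (he' y))]
    rw [h1]
    exact (e.symm y).2
  · have h1 : e.symm (w - z • x) = ⟨(x, w), hxw⟩ := by rw [LinearEquiv.symm_apply_eq]; rfl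
    rw [hR, h1]

end Resolvent

/-! ### Compactness of resolvents -/

section CompactEmbedding
variable {E F : Type} [NormedAddCommGroup E] [InnerProductSpace ℂ E]
  [NormedAddCommGroup F] [InnerProductSpace ℂ F]

/-- The inclusion of the domain of `T`, with the graph norm, is compact: every bounded operator
`L` with values in the domain for which `T L` is bounded as well is compact. -/
def HasCompactEmbedding (T : E →ₗ.[ℂ] F) : Prop :=
  ∀ (X : Type) [NormedAddCommGroup X] [InnerProductSpace ℂ X] (L : X →L[ℂ] E) (B : X →L[ℂ] F),
    (∀ x, (L x, B x) ∈ T.graph) → IsCompactOperator L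

theorem HasCompactEmbedding.offDiag {S : F →ₗ.[ℂ] E} {T : E →ₗ.[ℂ] F}
    (hS : HasCompactEmbedding S) (hT : HasCompactEmbedding T) :
    HasCompactEmbedding (offDiag S T) := by
  intro X _ _ L B h
  have h1 := hT X (WithLp.fstL 2 ℂ E F ∘L L) (WithLp.sndL 2 ℂ E F ∘L B)
    fun x => (mem_offDiag_graph.1 (h x)).1
  have h2 := hS X (WithLp.sndL 2 ℂ E F ∘L L) (WithLp.fstL 2 ℂ E F ∘L B)
    fun x => (mem_offDiag_graph.1 (h x)).2
  let e := (WithLp.prodContinuousLinearEquiv 2 ℂ E F).symm.toContinuousLinearMap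
  have h3 := (h1.clm_comp (e ∘L ContinuousLinearMap.inl ℂ E F)).add
    (h2.clm_comp (e ∘L ContinuousLinearMap.inr ℂ E F))
  refine Eq.subst (motive := fun f : X → WithLp 2 (E × F) => IsCompactOperator f) ?_ h3
  funext x
  symm
  change L x = WithLp.toLp 2 ((L x).fst, 0) + WithLp.toLp 2 (0, (L x).snd)
  rw [← WithLp.toLp_add]
  simp
  rfl

theorem HasCompactEmbedding.hasCompactResolvent {D : E →ₗ.[ℂ] E} [CompleteSpace E]
    (hD : IsSelfAdjoint D) (h : HasCompactEmbedding D) : HasCompactResolvent D := by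
  intro z hz
  obtain ⟨R, h1, h2⟩ := exists_resolvent hD hz
  refine ⟨R, h E R (1 + z • R) h1, fun y => ?_, fun x => h2 _ _ (D.mem_graph x)⟩
  obtain ⟨hy, h3⟩ := mem_graph_iff_exists.1 (h1 y)
  exact ⟨hy, by rw [h3]; abel⟩

/-- Parseval's identity. -/
theorem hasSum_norm_inner_sq {ι : Type*} (b : HilbertBasis ι ℂ E) (x : E) :
    HasSum (fun i => ‖⟪b i, x⟫_ℂ‖ ^ 2) (‖x‖ ^ 2) := by
  have h := b.hasSum_inner_mul_inner x x
  rw [inner_self_eq_ofReal] at h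
  refine Complex.hasSum_ofReal.1 (h.congr_fun fun i => ?_)
  rw [← inner_conj_symm x, Complex.conj_mul', Complex.ofReal_pow]

/-- Rellich's criterion: an operator whose coefficients in a Hilbert basis are square summable
against weights that tend to infinity, uniformly on bounded sets, is compact. -/
theorem isCompactOperator_of_coeff [CompleteSpace E] {ι : Type} (b : HilbertBasis ι ℂ E) (w : ι → ℝ)
    (hw : Tendsto w cofinite atTop) {X : Type} [NormedAddCommGroup X] [InnerProductSpace ℂ X]
    (L : X →L[ℂ] E) (C : ℝ)
    (h : ∀ x (s : Finset ι), ∑ p ∈ s, w p * ‖⟪b p, L x⟫_ℂ‖ ^ 2 ≤ C * ‖x‖ ^ 2) :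
    IsCompactOperator L := by
  classical
  let Q (s : Finset ι) : E →L[ℂ] E := ∑ p ∈ s, InnerProductSpace.rankOne ℂ (b p) (b p)
  have hQ (s : Finset ι) (x : E) : Q s x = ∑ p ∈ s, ⟪b p, x⟫_ℂ • b p := by
    simp [Q]
  have hcoeff (s : Finset ι) (x : E) (q : ι) :
      ⟪b q, x - Q s x⟫_ℂ = if q ∈ s then 0 else ⟪b q, x⟫_ℂ := by
    rw [inner_sub_right, hQ, inner_sum]
    simp only [inner_smul_right, orthonormal_iff_ite.1 b.orthonormal, mul_ite, mul_one, mul_zero,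
      Finset.sum_ite_eq]
    split_ifs <;> simp
  have hC : 0 ≤ |C| + 1 := by positivity
  refine isCompactOperator_of_tendsto (l := (atTop : Filter (Finset ι))) (F := fun s => Q s ∘L L)
    ?_ (Eventually.of_forall fun s => ?_)
  · rw [tendsto_iff_norm_sub_tendsto_zero, Metric.tendsto_atTop]
    intro ε hε
    have hR : ∀ᶠ p in cofinite, (|C| + 1) / (ε / 2) ^ 2 ≤ w p := hw.eventually_ge_atTop _
    have hfin : {p | ¬ (|C| + 1) / (ε / 2) ^ 2 ≤ w p}.Finite := hR
    refine ⟨hfin.toFinset, fun s hs => ?_⟩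
    rw [dist_zero_right, norm_norm, norm_sub_rev]
    refine lt_of_le_of_lt (ContinuousLinearMap.opNorm_le_bound _ (half_pos hε).le fun x => ?_)
      (half_lt_self hε)
    change ‖L x - Q s (L x)‖ ≤ _
    have h1 : HasSum (fun q => ‖⟪b q, L x - Q s (L x)⟫_ℂ‖ ^ 2) (‖L x - Q s (L x)‖ ^ 2) :=
      hasSum_norm_inner_sq b _
    have h2 : ‖L x - Q s (L x)‖ ^ 2 ≤ (ε / 2 * ‖x‖) ^ 2 := by
      refine le_of_tendsto h1 (Eventually.of_forall fun t => ?_)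
      have hpos : 0 < (|C| + 1) / (ε / 2) ^ 2 := by positivity
      have h3 : (|C| + 1) / (ε / 2) ^ 2 * ∑ q ∈ t, ‖⟪b q, L x - Q s (L x)⟫_ℂ‖ ^ 2 ≤
          (|C| + 1) * ‖x‖ ^ 2 := by
        calc _ ≤ ∑ q ∈ t.filter (· ∉ s), w q * ‖⟪b q, L x⟫_ℂ‖ ^ 2 := by
              rw [Finset.mul_sum, Finset.sum_filter]
              refine Finset.sum_le_sum fun q _ => ?_
              rw [hcoeff]
              by_cases hq : q ∈ s
              · simp [hq]
              · simp only [hq, if_false, not_false_eq_true, if_true]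
                gcongr
                by_contra hq'
                exact hq (hs (hfin.mem_toFinset.2 hq'))
          _ ≤ C * ‖x‖ ^ 2 := h x _
          _ ≤ _ := by gcongr; linarith [le_abs_self C]
      rw [div_mul_eq_mul_div, div_le_iff₀ (by positivity), mul_assoc] at h3
      have h4 := le_of_mul_le_mul_left h3 (by positivity : 0 < |C| + 1)
      rw [mul_pow, mul_comm]
      exact h4
    exact (abs_le_of_sq_le_sq' h2 (by positivity)).2
  · have hfr (y : E) : IsCompactOperator (InnerProductSpace.rankOne ℂ y y ∘L L) := by
      rw [InnerProductSpace.rankOne_def', ContinuousLinearMap.comp_assoc]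
      have h1 : IsCompactOperator ((ContinuousLinearMap.toSpanSingleton ℂ y : ℂ →L[ℂ] E)) :=
        isCompactOperator_of_locallyCompactSpace_rng (ContinuousLinearMap.toSpanSingleton ℂ y)
      exact h1.comp_clm _
    have : Q s ∘L L ∈ compactOperator (RingHom.id ℂ) X E := by
      have e : Q s ∘L L = ∑ p ∈ s, (InnerProductSpace.rankOne ℂ (b p) (b p) ∘L L) := by
        ext x; simp [Q]
      rw [e]
      exact Submodule.sum_mem _ fun p _ => hfr (b p)
    exact this

end CompactEmbedding

/-! ### Singular systems and the spectrum of operator matrices -/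

section Spectral
variable {E F : Type} [NormedAddCommGroup E] [InnerProductSpace ℂ E] [CompleteSpace E]
  [NormedAddCommGroup F] [InnerProductSpace ℂ F] [CompleteSpace F]

theorem exists_hilbertBasis_eigenvectors {S : E →L[ℂ] E} (hS : IsCompactOperator S)
    (hS' : S.IsSymmetric) :
    ∃ (ι : Type) (b : HilbertBasis ι ℂ E) (s : ι → ℂ), ∀ i, S (b i) = s i • b i := by
  let V (μ : ℂ) : Submodule ℂ E := Module.End.eigenspace (S : Module.End ℂ E) μ
  have hV (μ : ℂ) (x : E) : x ∈ V μ ↔ S x = μ • x := Module.End.mem_eigenspace_iff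
  have hcl (μ : ℂ) : IsClosed (V μ : Set E) := by
    have : (V μ : Set E) = {x | S x = μ • x} := Set.ext fun x => hV μ x
    rw [this]
    exact isClosed_eq S.continuous (continuous_const_smul μ)
  have hcomp (μ : ℂ) : CompleteSpace (V μ) := (hcl μ).completeSpace_coe
  choose w b hb using fun μ => exists_hilbertBasis ℂ (V μ)
  let v : (Σ μ, w μ) → E := fun a => ((b a.1 a.2 : V a.1) : E)
  have hv : Orthonormal ℂ v := hS'.orthogonalFamily_eigenspaces.orthonormal_sigma_orthonormal
    fun μ => (b μ).orthonormal
  have hbot : (Submodule.span ℂ (Set.range v))ᗮ = ⊥ := by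
    rw [Submodule.eq_bot_iff]
    intro x hx
    have h1 : x ∈ (⨆ μ, V μ)ᗮ := by
      rw [← Submodule.iInf_orthogonal, Submodule.mem_iInf]
      intro μ
      rw [Submodule.mem_orthogonal']
      intro y hy
      have h2 := (b μ).hasSum_repr ⟨y, hy⟩
      have h3 := (h2.mapL (V μ).subtypeL).mapL (innerSL ℂ x)
      refine h3.unique ?_
      convert hasSum_zero using 1
      funext i
      have h4 : ⟪x, v ⟨μ, i⟩⟫_ℂ = 0 :=
        (Submodule.mem_orthogonal' _ _).1 hx _ (Submodule.subset_span ⟨_, rfl⟩)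
      change ⟪x, (b μ).repr ⟨y, hy⟩ i • v ⟨μ, i⟩⟫_ℂ = 0
      rw [inner_smul_right, h4, mul_zero]
    rw [ContinuousLinearMap.orthogonalComplement_iSup_eigenspaces_eq_bot hS hS'] at h1
    exact (Submodule.mem_bot ℂ).1 h1
  refine ⟨_, HilbertBasis.mkOfOrthogonalEqBot hv hbot, fun a => a.1, fun a => ?_⟩
  rw [HilbertBasis.coe_mkOfOrthogonalEqBot]
  exact (hV _ _).1 (b a.1 a.2).2

/-- `b` is a Hilbert basis of eigenvectors of `T† T`, with eigenvalues `μ`, and `g i = T (b i)`. -/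
structure IsSingularSystem (T : E →ₗ.[ℂ] F) {ι : Type} (b : HilbertBasis ι ℂ E) (μ : ι → ℝ)
    (g : ι → F) : Prop where
  nonneg : ∀ i, 0 ≤ μ i
  mem : ∀ i, (b i, g i) ∈ T.graph
  mem_adjoint : ∀ i, (g i, (μ i : ℂ) • b i) ∈ T.adjoint.graph

theorem exists_isSingularSystem {T : E →ₗ.[ℂ] F} (hT : Dense (T.domain : Set E))
    (hc : T.IsClosed) (hemb : HasCompactEmbedding T) :
    ∃ (ι : Type) (b : HilbertBasis ι ℂ E) (μ : ι → ℝ) (g : ι → F), IsSingularSystem T b μ g := by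
  obtain ⟨S₀, B₀, h⟩ := exists_graph_decomposition hT hc
  -- `S = (1 + T† T)⁻¹` and `B = T S`
  let S := S₀ ∘L ContinuousLinearMap.inl ℂ E F
  let B := B₀ ∘L ContinuousLinearMap.inl ℂ E F
  have h1 (y : E) : (S y, B y) ∈ T.graph := (h y 0).1
  have h2 (y : E) : (B y, y - S y) ∈ T.adjoint.graph := by
    have := (h y 0).2
    rwa [sub_zero] at this
  have hadj {y : F} {z : E} (hyz : (y, z) ∈ T.adjoint.graph) :=
    (mem_adjoint_graph_iff hT).1 hyz
  have hkey (x y : E) : ⟪x, S y⟫_ℂ = ⟪B x, B y⟫_ℂ + ⟪S x, S y⟫_ℂ := by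
    rw [← hadj (h2 x) _ _ (h1 y), inner_sub_left]; ring
  have hsymm : S.IsSymmetric := fun x y => by
    change ⟪S x, y⟫_ℂ = ⟪x, S y⟫_ℂ
    rw [hkey x y, ← inner_conj_symm (S x), hkey y x, _root_.map_add, inner_conj_symm,
      inner_conj_symm]
  obtain ⟨ι, b, s, hs⟩ := exists_hilbertBasis_eigenvectors (hemb E S B h1) hsymm
  have hb (i : ι) : ‖b i‖ = 1 := b.orthonormal.1 i
  have hs0 (i : ι) : s i ≠ 0 := fun h0 => by
    have hS : S (b i) = 0 := by rw [hs, h0, zero_smul]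
    have hB : B (b i) = 0 := T.graph_fst_eq_zero_snd (h1 (b i)) hS
    have h3 := T.adjoint.graph_fst_eq_zero_snd (h2 (b i)) hB
    rw [hS, sub_zero] at h3
    simpa [h3] using hb i
  let g (i : ι) : F := (s i)⁻¹ • B (b i)
  have hg (i : ι) : (b i, g i) ∈ T.graph := by
    have := T.graph.smul_mem (s i)⁻¹ (h1 (b i))
    rwa [hs, Prod.smul_mk, smul_smul, inv_mul_cancel₀ (hs0 i), one_smul] at this
  have hg' (i : ι) : (g i, ((s i)⁻¹ - 1) • b i) ∈ T.adjoint.graph := by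
    have := T.adjoint.graph.smul_mem (s i)⁻¹ (h2 (b i))
    rwa [hs, Prod.smul_mk, smul_sub, smul_smul, inv_mul_cancel₀ (hs0 i), ← sub_smul] at this
  have hμ (i : ι) : ((s i)⁻¹ - 1) = ((‖g i‖ ^ 2 : ℝ) : ℂ) := by
    have := hadj (hg' i) _ _ (hg i)
    rw [inner_smul_left, inner_self_eq_ofReal, inner_self_eq_ofReal, hb] at this
    have h4 := congrArg (starRingEnd ℂ) this
    simpa using h4
  exact ⟨ι, b, fun i => ‖g i‖ ^ 2, g, fun i => sq_nonneg _, hg, fun i => hμ i ▸ hg' i⟩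

namespace IsSingularSystem
variable {T : E →ₗ.[ℂ] F} {ι : Type} {b : HilbertBasis ι ℂ E} {μ : ι → ℝ} {g : ι → F}

theorem inner_image (h : IsSingularSystem T b μ g) (hT : Dense (T.domain : Set E)) (i j : ι) :
    ⟪g i, g j⟫_ℂ = (μ i : ℂ) * ⟪b i, b j⟫_ℂ := by
  rw [← (mem_adjoint_graph_iff hT).1 (h.mem_adjoint i) _ _ (h.mem j), inner_smul_left,
    Complex.conj_ofReal]

theorem orthonormal_image (h : IsSingularSystem T b μ g) (hT : Dense (T.domain : Set E)) :
    Orthonormal ℂ fun i : {i // μ i ≠ 0} => (((√(μ i))⁻¹ : ℝ) : ℂ) • g i := by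
  classical
  rw [orthonormal_iff_ite]
  intro i j
  rw [inner_smul_left, inner_smul_right, h.inner_image hT, orthonormal_iff_ite.1 b.orthonormal,
    Complex.conj_ofReal]
  by_cases hij : i = j
  · subst hij
    simp only [if_true, mul_one]
    have h1 : 0 < μ i := (h.nonneg i).lt_of_ne' i.2
    rw [← Complex.ofReal_mul, ← Complex.ofReal_mul, ← Complex.ofReal_one]
    congr 1
    have h2 := Real.mul_self_sqrt h1.le
    have h3 : √(μ i) ≠ 0 := (Real.sqrt_pos.2 h1).ne'
    nth_rw 3 [← h2]
    field_simp
  · have : (i : ι) ≠ j := fun h => hij (Subtype.ext h)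
    simp [hij, this]

/-- A vector orthogonal to all `T (b i)` lies in the kernel of `T†`. -/
theorem mem_ker_adjoint (h : IsSingularSystem T b μ g) (hT : Dense (T.domain : Set E))
    (hc : T.IsClosed) {z : F} (hz : ∀ i, ⟪g i, z⟫_ℂ = 0) : (z, (0 : E)) ∈ T.adjoint.graph := by
  obtain ⟨S, B, hSB⟩ := exists_graph_decomposition hT hc
  obtain ⟨h1, h2⟩ := hSB 0 z
  set x := S (0, z)
  set w := B (0, z)
  -- the projection `(x, w)` of `(0, z)` to the graph is orthogonal to all `(b i, g i)`
  have h3 (i : ι) : ⟪b i, x⟫_ℂ = 0 := by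
    have h4 := (mem_adjoint_graph_iff hT).1 h2 _ _ (h.mem i)
    have h5 := (mem_adjoint_graph_iff hT).1 (h.mem_adjoint i) _ _ h1
    have h6 := congrArg (starRingEnd ℂ) h4
    rw [inner_conj_symm, inner_conj_symm, zero_sub, inner_neg_right, inner_sub_right, hz, ← h5,
      inner_smul_left, Complex.conj_ofReal, sub_zero] at h6
    have h7 : ((1 + μ i : ℝ) : ℂ) * ⟪b i, x⟫_ℂ = 0 := by
      push_cast; linear_combination -h6
    have h8 : ((1 + μ i : ℝ) : ℂ) ≠ 0 := by
      have := h.nonneg i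
      exact_mod_cast (by positivity : 1 + μ i ≠ 0)
    exact (mul_eq_zero.1 h7).resolve_left h8
  have hx : x = 0 := by
    have := hasSum_norm_inner_sq b x
    simp only [h3, norm_zero, ne_eq, OfNat.ofNat_ne_zero, not_false_eq_true, zero_pow] at this
    exact norm_eq_zero.1 (pow_eq_zero_iff (two_ne_zero) |>.1 (this.unique hasSum_zero))
  have hw : w = 0 := T.graph_fst_eq_zero_snd h1 hx
  rw [hx, hw, zero_sub, sub_zero] at h2
  simpa using T.adjoint.graph.neg_mem h2

/-- The operator `[[0, T†], [T, 0]]` has a Hilbert basis of eigenvectors: the vectors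
`(b i, ± g i / √μ i) / √2` with eigenvalues `± √μ i` for `μ i ≠ 0`, completed by vectors of the
kernels of `T` and `T†`. -/
theorem exists_offDiag_eigenbasis (h : IsSingularSystem T b μ g) (hT : Dense (T.domain : Set E))
    (hc : T.IsClosed) : ∃ (J : Type) (c : HilbertBasis J ℂ (WithLp 2 (E × F))) (ν : J → ℝ),
      (∀ j, (c j, (ν j : ℂ) • c j) ∈ (offDiag T.adjoint T).graph) ∧
      ∀ (f : ℝ → ℂ) (t : ℂ), HasSum (fun i => if μ i = 0 then 0 else f √(μ i)) t →
        HasSum (fun j => if ν j = 0 then 0 else f |ν j|) (2 * t) := by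
  classical
  let P := {i // μ i ≠ 0}
  let f₁ : P → F := fun i => (((√(μ i))⁻¹ : ℝ) : ℂ) • g i
  have hf₁ : Orthonormal ℂ f₁ := h.orthonormal_image hT
  let K : Submodule ℂ F := (Submodule.span ℂ (Set.range f₁))ᗮ
  have hK : CompleteSpace K := (Submodule.isClosed_orthogonal _).completeSpace_coe
  obtain ⟨κ, d, -⟩ := exists_hilbertBasis ℂ K
  let r : ℂ := ((√2)⁻¹ : ℝ)
  have hr : r * r + r * r = 1 := by
    have h2 : (√2 * √2 : ℝ) = 2 := Real.mul_self_sqrt (by norm_num)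
    have h3 : (√2)⁻¹ * (√2)⁻¹ + (√2)⁻¹ * (√2)⁻¹ = (1 : ℝ) := by
      rw [← mul_inv, h2]; norm_num
    simp only [r]
    exact_mod_cast h3
  have hrc : (starRingEnd ℂ) r = r := Complex.conj_ofReal _
  have hr0 : r ≠ 0 := fun h0 => by simp [h0] at hr
  let v : (P ⊕ P) ⊕ ({i // μ i = 0} ⊕ κ) → WithLp 2 (E × F) := fun j => match j with
    | .inl (.inl i) => WithLp.toLp 2 (r • b i, r • f₁ i)
    | .inl (.inr i) => WithLp.toLp 2 (r • b i, -(r • f₁ i))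
    | .inr (.inl i) => WithLp.toLp 2 (b i, 0)
    | .inr (.inr k) => WithLp.toLp 2 (0, (d k : F))
  let ν : (P ⊕ P) ⊕ ({i // μ i = 0} ⊕ κ) → ℝ := fun j => match j with
    | .inl (.inl i) => √(μ i)
    | .inl (.inr i) => -√(μ i)
    | .inr _ => 0
  have hfd (i : P) (k : κ) : ⟪f₁ i, (d k : F)⟫_ℂ = 0 :=
    (Submodule.mem_orthogonal _ _).1 (d k).2 _ (Submodule.subset_span ⟨i, rfl⟩)
  have hdf (i : P) (k : κ) : ⟪(d k : F), f₁ i⟫_ℂ = 0 := inner_eq_zero_symm.1 (hfd i k)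
  have hbb := orthonormal_iff_ite.1 b.orthonormal
  have hbP (i j : P) : ⟪b i, b j⟫_ℂ = if i = j then 1 else 0 := by
    rw [hbb]; exact if_congr Subtype.ext_iff.symm rfl rfl
  have hb0 (i j : {i // μ i = 0}) : ⟪b i, b j⟫_ℂ = if i = j then 1 else 0 := by
    rw [hbb]; exact if_congr Subtype.ext_iff.symm rfl rfl
  have hP0 (i : P) (j : {i // μ i = 0}) : ⟪b i, b j⟫_ℂ = 0 := by
    rw [hbb]; exact if_neg fun hij : (i : ι) = j => i.2 (hij ▸ j.2)
  have h0P (i : P) (j : {i // μ i = 0}) : ⟪b j, b i⟫_ℂ = 0 := inner_eq_zero_symm.1 (hP0 i j)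
  have hff := orthonormal_iff_ite.1 hf₁
  have hdd (k l : κ) : ⟪(d k : F), (d l : F)⟫_ℂ = if k = l then 1 else 0 :=
    orthonormal_iff_ite.1 d.orthonormal k l
  have hv : Orthonormal ℂ v := by
    rw [orthonormal_iff_ite]
    rintro ((i | i) | (i | i)) ((j | j) | (j | j)) <;>
      simp only [v, WithLp.prod_inner_apply, inner_smul_left, inner_smul_right, hrc, hbP,
        hb0, hP0, h0P, hff, hdd, hfd, hdf, inner_zero_left, inner_zero_right, inner_neg_left,
        inner_neg_right, Sum.inl.injEq, Sum.inr.injEq, reduceCtorEq, if_false, mul_zero, add_zero,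
        zero_add, neg_zero] <;>
      split_ifs <;> simp [hr]
  have hbot : (Submodule.span ℂ (Set.range v))ᗮ = ⊥ := by
    rw [Submodule.eq_bot_iff]
    intro x hx
    have h1 (j) : ⟪v j, x⟫_ℂ = 0 :=
      (Submodule.mem_orthogonal _ _).1 hx _ (Submodule.subset_span ⟨j, rfl⟩)
    have h2 (i : P) : ⟪b i, x.fst⟫_ℂ + ⟪f₁ i, x.snd⟫_ℂ = 0 := by
      have := h1 (.inl (.inl i))
      simp only [v, WithLp.prod_inner_apply, inner_smul_left, hrc, ← mul_add] at this
      exact (mul_eq_zero.1 this).resolve_left hr0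
    have h3 (i : P) : ⟪b i, x.fst⟫_ℂ - ⟪f₁ i, x.snd⟫_ℂ = 0 := by
      have := h1 (.inl (.inr i))
      simp only [v, WithLp.prod_inner_apply, inner_smul_left, inner_neg_left, hrc,
        ← sub_eq_add_neg, ← mul_sub] at this
      exact (mul_eq_zero.1 this).resolve_left hr0
    have hx1 : x.fst = 0 := by
      have h4 (i : ι) : ⟪b i, x.fst⟫_ℂ = 0 := by
        by_cases hi : μ i = 0
        · simpa [v, WithLp.prod_inner_apply] using h1 (.inr (.inl ⟨i, hi⟩))
        · linear_combination (1 / 2) * h2 ⟨i, hi⟩ + (1 / 2) * h3 ⟨i, hi⟩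
      have := hasSum_norm_inner_sq b x.fst
      simp only [h4, norm_zero, ne_eq, OfNat.ofNat_ne_zero, not_false_eq_true, zero_pow] at this
      exact norm_eq_zero.1 (pow_eq_zero_iff (two_ne_zero) |>.1 (this.unique hasSum_zero))
    have hx2 : x.snd = 0 := by
      have h4 : x.snd ∈ K := by
        rw [Submodule.mem_orthogonal]
        intro y hy
        induction hy using Submodule.span_induction with
        | mem y hy =>
          obtain ⟨i, rfl⟩ := hy
          linear_combination (1 / 2) * h2 i - (1 / 2) * h3 i
        | zero => exact inner_zero_left _
        | add y z _ _ hy hz => rw [inner_add_left, hy, hz, add_zero]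
        | smul a y _ hy => rw [inner_smul_left, hy, mul_zero]
      have h5 (k : κ) : ⟪d k, (⟨x.snd, h4⟩ : K)⟫_ℂ = 0 := by
        simpa [v, WithLp.prod_inner_apply] using h1 (.inr (.inr k))
      have := hasSum_norm_inner_sq d ⟨x.snd, h4⟩
      simp only [h5, norm_zero, ne_eq, OfNat.ofNat_ne_zero, not_false_eq_true, zero_pow] at this
      exact norm_eq_zero.1 (pow_eq_zero_iff (two_ne_zero) |>.1 (this.unique hasSum_zero))
    exact (WithLp.ofLp_injective 2) (Prod.ext hx1 hx2)
  have hsq (i : P) : √(μ i) ≠ 0 :=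
    (Real.sqrt_pos.2 ((h.nonneg i).lt_of_ne' i.2)).ne'
  have hTf (i : P) : (b i, (√(μ i) : ℂ) • f₁ i) ∈ T.graph := by
    have e : (√(μ i) : ℂ) • f₁ i = g i := by
      rw [smul_smul, ← Complex.ofReal_mul, mul_inv_cancel₀ (hsq i), Complex.ofReal_one, one_smul]
    rw [e]
    exact h.mem i
  have hTf' (i : P) : (f₁ i, (√(μ i) : ℂ) • b i) ∈ T.adjoint.graph := by
    have := T.adjoint.graph.smul_mem (((√(μ i))⁻¹ : ℝ) : ℂ) (h.mem_adjoint i)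
    rw [Prod.smul_mk, smul_smul, ← Complex.ofReal_mul] at this
    have e : (√(μ i))⁻¹ * μ i = √(μ i) := by
      nth_rw 2 [← Real.mul_self_sqrt (h.nonneg i)]
      rw [inv_mul_cancel_left₀ (hsq i)]
    rwa [e] at this
  refine ⟨_, HilbertBasis.mkOfOrthogonalEqBot hv hbot, ν, ?_, ?_⟩
  · rw [HilbertBasis.coe_mkOfOrthogonalEqBot]
    rintro ((i | i) | (i | k)) <;> rw [mem_offDiag_graph]
    · refine ⟨?_, ?_⟩
      · have := T.graph.smul_mem r (hTf i)
        rwa [Prod.smul_mk, smul_comm] at this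
      · have := T.adjoint.graph.smul_mem r (hTf' i)
        rwa [Prod.smul_mk, smul_comm r (√(μ i) : ℂ)] at this
    · refine ⟨?_, ?_⟩
      · have := T.graph.smul_mem r (hTf i)
        rw [Prod.smul_mk, smul_comm] at this
        simpa [v, ν] using this
      · have := T.adjoint.graph.smul_mem (-r) (hTf' i)
        rw [Prod.smul_mk, smul_comm (-r) (√(μ i) : ℂ), neg_smul, neg_smul, smul_neg] at this
        rw [Complex.ofReal_neg, neg_smul]
        exact this
    · have h0 : g i = 0 := by
        have := h.inner_image hT i i
        rw [i.2, Complex.ofReal_zero, zero_mul] at this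
        exact inner_self_eq_zero.1 this
      have := h.mem i
      rw [h0] at this
      simpa [v, ν] using this
    · have hk : ((d k : F), (0 : E)) ∈ T.adjoint.graph := by
        refine h.mem_ker_adjoint hT hc fun i => ?_
        by_cases hi : μ i = 0
        · have h0 : g i = 0 := by
            have := h.inner_image hT i i
            rw [hi, Complex.ofReal_zero, zero_mul] at this
            exact inner_self_eq_zero.1 this
          rw [h0, inner_zero_left]
        · have e := hfd ⟨i, hi⟩ k
          simp only [f₁, inner_smul_left, Complex.conj_ofReal] at e
          refine (mul_eq_zero.1 e).resolve_left ?_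
          exact_mod_cast inv_ne_zero (hsq ⟨i, hi⟩)
      simpa [v, ν] using hk
  · intro f t ht
    have hP : HasSum (fun i : P => f √(μ i)) t := by
      have : HasSum ((fun i => if μ i = 0 then 0 else f √(μ i)) ∘ ((↑) : P → ι)) t := by
        refine (hasSum_subtype_iff_of_support_subset (s := {i | μ i ≠ 0}) fun i hi => ?_).2 ht
        intro h0
        simp [h0] at hi
      convert this using 1
      funext i
      simp [i.2]
    rw [two_mul, ← add_zero (t + t)]
    refine HasSum.sum (HasSum.sum ?_ ?_) ?_
    · simpa [Function.comp_def, ν, hsq, abs_of_nonneg, Real.sqrt_nonneg] using hP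
    · simpa [Function.comp_def, ν, hsq, abs_of_nonneg, Real.sqrt_nonneg] using hP
    · simp [Function.comp_def, ν]

end IsSingularSystem
end Spectral

/-! ### Diagonal operators of trace class -/

section Trace
variable {H : Type} [NormedAddCommGroup H] [InnerProductSpace ℂ H] [CompleteSpace H]

/-- A diagonal operator with summable entries is bounded, and its trace is the sum of the
entries. -/
theorem exists_diagonal_hasTrace {J : Type} (c : HilbertBasis J ℂ H) {ρ : J → ℂ}
    (hρ : Summable ρ) :
    ∃ P : H →L[ℂ] H, (∀ j, P (c j) = ρ j • c j) ∧ HasTrace P (∑' j, ρ j) := by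
  classical
  have hc (j : J) : ‖c j‖ = 1 := c.orthonormal.1 j
  let R (j : J) : H →L[ℂ] H := ρ j • InnerProductSpace.rankOne ℂ (c j) (c j)
  have hRn (j : J) : ‖R j‖ = ‖ρ j‖ := by
    simp only [R, norm_smul, InnerProductSpace.norm_rankOne, hc, mul_one]
  have hR : Summable R := by
    refine Summable.of_norm ?_
    simp only [hRn]
    exact hρ.norm
  have hP (x y : H) : HasSum (fun j => ρ j * (⟪c j, x⟫_ℂ * ⟪y, c j⟫_ℂ)) ⟪y, (∑' j, R j) x⟫_ℂ := by
    have h1 := (hR.hasSum.mapL (ContinuousLinearMap.apply ℂ H x)).mapL (innerSL ℂ y)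
    refine h1.congr_fun fun j => ?_
    change _ = ⟪y, ρ j • (⟪c j, x⟫_ℂ • c j)⟫_ℂ
    rw [inner_smul_right, inner_smul_right]
  refine ⟨∑' j, R j, fun i => ?_, fun ι b => ?_⟩
  · have h1 := hR.hasSum.mapL (ContinuousLinearMap.apply ℂ H (c i))
    refine h1.unique ?_
    have h2 (j : J) : ContinuousLinearMap.apply ℂ H (c i) (R j) =
        if j = i then ρ i • c i else 0 := by
      change ρ j • (⟪c j, c i⟫_ℂ • c j) = _
      rw [orthonormal_iff_ite.1 c.orthonormal]
      split_ifs with h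
      · rw [h, one_smul]
      · rw [zero_smul, smul_zero]
    simp only [h2]
    exact hasSum_ite_eq i _
  · let G : J × ι → ℂ := fun p => ρ p.1 * (‖⟪b p.2, c p.1⟫_ℂ‖ ^ 2 : ℝ)
    have hrow (j : J) : HasSum (fun i => ‖⟪b i, c j⟫_ℂ‖ ^ 2) (1 : ℝ) := by
      simpa [hc] using hasSum_norm_inner_sq b (c j)
    have hrow' (j : J) : HasSum (fun i => G (j, i)) (ρ j) := by
      simpa [G] using (Complex.hasSum_ofReal.2 (hrow j)).mul_left (ρ j)
    have hG : Summable G := by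
      refine Summable.of_norm ((summable_prod_of_nonneg fun _ => norm_nonneg _).2 ⟨fun j => ?_, ?_⟩)
      · simpa [G] using (hrow j).summable.mul_left ‖ρ j‖
      · have h3 (j : J) : ∑' i, ‖G (j, i)‖ = ‖ρ j‖ := by
          have : HasSum (fun i => ‖G (j, i)‖) ‖ρ j‖ := by
            simpa [G] using (hrow j).mul_left ‖ρ j‖
          exact this.tsum_eq
        simp only [h3]
        exact hρ.norm
    have hcol (i : ι) : HasSum (fun j => G (j, i)) ⟪b i, (∑' j, R j) (b i)⟫_ℂ := by
      refine (hP (b i) (b i)).congr_fun fun j => ?_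
      simp only [G]
      rw [← inner_conj_symm (c j), Complex.conj_mul', Complex.ofReal_pow]
    have hsum : ∑' p, G p = ∑' j, ρ j :=
      (hG.hasSum.prod_fiberwise hrow').tsum_eq.symm
    have h4 : HasSum (G ∘ Prod.swap) (∑' p, G p) := (Equiv.prodComm ι J).hasSum_iff.2 hG.hasSum
    rw [← hsum]
    exact h4.prod_fiberwise hcol

/-- The tangent line inequality for the convex function `x ↦ x ^ (-σ)` at `A`. -/
theorem tangent_le_rpow_neg {σ a A : ℝ} (hσ : 0 ≤ σ) (ha : 0 < a) (hA : 0 < A) :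
    A ^ (-σ) * (1 + σ - σ * (a / A)) ≤ a ^ (-σ) := by
  have h1 : 1 + σ - σ * (a / A) ≤ (a / A) ^ (-σ) := by
    have h2 := Real.log_le_sub_one_of_pos (div_pos ha hA)
    have h3 := Real.add_one_le_exp (-σ * Real.log (a / A))
    rw [Real.rpow_def_of_pos (div_pos ha hA), mul_comm (Real.log _)]
    nlinarith
  calc _ ≤ A ^ (-σ) * (a / A) ^ (-σ) := by gcongr
    _ = a ^ (-σ) := by
      rw [← Real.mul_rpow hA.le (div_pos ha hA).le, mul_div_cancel₀ _ hA.ne']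

/-- Jensen's inequality for `x ↦ x ^ (-σ)` and the spectral measure of a unit vector `y`: if the
mean of `1 + l` is at most `A`, then `A ^ (-σ)` is at most the mean of `(1 + l) ^ (-σ)`. -/
theorem rpow_neg_le_tsum {κ : Type} (e : HilbertBasis κ ℂ H) {l : κ → ℝ} (hl : ∀ p, 0 ≤ l p)
    {σ : ℝ} (hσ : 0 ≤ σ) {A : ℝ} (hA : 0 < A) {y : H} (hy : ‖y‖ = 1)
    (h : ∀ s : Finset κ, ∑ p ∈ s, (1 + l p) * ‖⟪e p, y⟫_ℂ‖ ^ 2 ≤ A)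
    (hs : Summable fun p => (1 + l p) ^ (-σ) * ‖⟪e p, y⟫_ℂ‖ ^ 2) :
    A ^ (-σ) ≤ ∑' p, (1 + l p) ^ (-σ) * ‖⟪e p, y⟫_ℂ‖ ^ 2 := by
  have h1 := hasSum_norm_inner_sq e y
  rw [hy, one_pow] at h1
  have h2 : Tendsto (fun s : Finset κ => A ^ (-σ) * ((1 + σ) * ∑ p ∈ s, ‖⟪e p, y⟫_ℂ‖ ^ 2 - σ)) atTop
      (𝓝 (A ^ (-σ) * ((1 + σ) * 1 - σ))) := ((h1.const_mul (1 + σ)).sub_const σ).const_mul _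
  rw [mul_one, add_sub_cancel_right, mul_one] at h2
  refine le_of_tendsto h2 (Eventually.of_forall fun s => ?_)
  refine le_trans ?_ (hs.sum_le_tsum s fun p _ =>
    mul_nonneg (Real.rpow_nonneg (by linarith [hl p]) _) (sq_nonneg _))
  have h3 : σ * ((∑ p ∈ s, (1 + l p) * ‖⟪e p, y⟫_ℂ‖ ^ 2) / A) ≤ σ :=
    mul_le_of_le_one_right hσ ((div_le_one hA).2 (h s))
  calc A ^ (-σ) * ((1 + σ) * ∑ p ∈ s, ‖⟪e p, y⟫_ℂ‖ ^ 2 - σ)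
      ≤ A ^ (-σ) * ((1 + σ) * ∑ p ∈ s, ‖⟪e p, y⟫_ℂ‖ ^ 2 -
          σ * ((∑ p ∈ s, (1 + l p) * ‖⟪e p, y⟫_ℂ‖ ^ 2) / A)) := by gcongr
    _ = ∑ p ∈ s, A ^ (-σ) * (1 + σ - σ * ((1 + l p) / A)) * ‖⟪e p, y⟫_ℂ‖ ^ 2 := by
      rw [Finset.sum_div, Finset.mul_sum, Finset.mul_sum, ← Finset.sum_sub_distrib, Finset.mul_sum]
      refine Finset.sum_congr rfl fun p _ => ?_
      ring
    _ ≤ _ := by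
      refine Finset.sum_le_sum fun p _ => ?_
      gcongr
      exact tangent_le_rpow_neg hσ (by linarith [hl p]) hA

end Trace

/-! ### Summability of the eigenvalues -/

section Singular
variable {E F : Type} [NormedAddCommGroup E] [InnerProductSpace ℂ E] [CompleteSpace E]
  [NormedAddCommGroup F] [InnerProductSpace ℂ F] [CompleteSpace F]

/-- If `T†` dominates a diagonal operator with squared entries `l` and `(1 + l) ^ (-σ)` is summable,
then the nonzero eigenvalues of `T† T` are summable to the power `-σ`. -/
theorem IsSingularSystem.summable_rpow {T : E →ₗ.[ℂ] F} {ι : Type} {b : HilbertBasis ι ℂ E}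
    {μ : ι → ℝ} {g : ι → F} (h : IsSingularSystem T b μ g) (hT : Dense (T.domain : Set E))
    {κ : Type} (e : HilbertBasis κ ℂ F) {l : κ → ℝ} (hl : ∀ p, 0 ≤ l p) {C : ℝ} (hC : 0 < C)
    (hlow : ∀ y z, (y, z) ∈ T.adjoint.graph → ∀ s : Finset κ,
      ∑ p ∈ s, l p * ‖⟪e p, y⟫_ℂ‖ ^ 2 ≤ C * ‖z‖ ^ 2)
    {σ : ℝ} (hσ : 0 < σ) (hs : Summable fun p => (1 + l p) ^ (-σ)) :
    Summable fun i => if μ i = 0 then 0 else μ i ^ (-σ) := by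
  let P := {i // μ i ≠ 0}
  let f : P → F := fun i => (((√(μ i))⁻¹ : ℝ) : ℂ) • g i
  have hf : Orthonormal ℂ f := h.orthonormal_image hT
  have hμ (i : P) : 0 < μ i := (h.nonneg i).lt_of_ne' i.2
  have hf' (i : P) : (f i, (((√(μ i))⁻¹ : ℝ) : ℂ) • (μ i : ℂ) • b i) ∈ T.adjoint.graph :=
    T.adjoint.graph.smul_mem (((√(μ i))⁻¹ : ℝ) : ℂ) (h.mem_adjoint i)
  have hz (i : P) : ‖(((√(μ i))⁻¹ : ℝ) : ℂ) • (μ i : ℂ) • b i‖ ^ 2 = μ i := by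
    rw [norm_smul, norm_smul, b.orthonormal.1, Complex.norm_real, Complex.norm_real, mul_one,
      mul_pow, Real.norm_eq_abs, Real.norm_eq_abs, sq_abs, sq_abs, inv_pow,
      Real.sq_sqrt (hμ i).le]
    field_simp [(hμ i).ne']
  have hw1 (i : P) (s : Finset κ) : ∑ p ∈ s, ‖⟪e p, f i⟫_ℂ‖ ^ 2 ≤ 1 := by
    have := sum_le_hasSum s (fun p _ => sq_nonneg _) (hasSum_norm_inner_sq e (f i))
    rwa [hf.1, one_pow] at this
  have hw2 (p : κ) (s : Finset P) : ∑ i ∈ s, ‖⟪e p, f i⟫_ℂ‖ ^ 2 ≤ 1 := by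
    have := hf.sum_inner_products_le (s := s) (e p)
    rw [e.orthonormal.1, one_pow] at this
    refine le_trans (Finset.sum_le_sum fun i _ => ?_) this
    rw [norm_inner_symm]
  have ha (p : κ) : 0 ≤ (1 + l p) ^ (-σ) := Real.rpow_nonneg (by linarith [hl p]) _
  have hsw (i : P) : Summable fun p => (1 + l p) ^ (-σ) * ‖⟪e p, f i⟫_ℂ‖ ^ 2 := by
    refine hs.of_nonneg_of_le (fun p => mul_nonneg (ha p) (sq_nonneg _)) fun p => ?_
    exact mul_le_of_le_one_right (ha p) (by simpa using hw1 i {p})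
  have hA (i : P) : 0 < 1 + C * μ i := by have := hμ i; positivity
  have hj (i : P) : (1 + C * μ i) ^ (-σ) ≤ ∑' p, (1 + l p) ^ (-σ) * ‖⟪e p, f i⟫_ℂ‖ ^ 2 := by
    refine rpow_neg_le_tsum e hl hσ.le (hA i) (hf.1 i) (fun s => ?_) (hsw i)
    have h1 := hlow _ _ (hf' i) s
    rw [hz] at h1
    simp only [add_mul, one_mul, Finset.sum_add_distrib]
    exact add_le_add (hw1 i s) h1
  have hsum : Summable fun i : P => (1 + C * μ i) ^ (-σ) := by
    refine summable_of_sum_le (c := ∑' p, (1 + l p) ^ (-σ))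
      (fun i => Real.rpow_nonneg (hA i).le _) fun u => ?_
    calc ∑ i ∈ u, (1 + C * μ i) ^ (-σ)
        ≤ ∑ i ∈ u, ∑' p, (1 + l p) ^ (-σ) * ‖⟪e p, f i⟫_ℂ‖ ^ 2 :=
          Finset.sum_le_sum fun i _ => hj i
      _ = ∑' p, ∑ i ∈ u, (1 + l p) ^ (-σ) * ‖⟪e p, f i⟫_ℂ‖ ^ 2 :=
          (Summable.tsum_finsetSum fun i _ => hsw i).symm
      _ ≤ ∑' p, (1 + l p) ^ (-σ) := by
          refine Summable.tsum_le_tsum (fun p => ?_) (summable_sum fun i _ => hsw i) hs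
          rw [← Finset.mul_sum]
          exact mul_le_of_le_one_right (ha p) (hw2 p u)
  -- all but finitely many `μ i` exceed `1 / C`, where `1 + C * μ i ≤ 2 * C * μ i`
  have hev : ∀ᶠ i : P in cofinite, (1 + C * μ i) ^ (-σ) < 2 ^ (-σ) :=
    hsum.tendsto_cofinite_zero.eventually_lt_const (by positivity)
  have hP : Summable fun i : P => μ i ^ (-σ) := by
    refine Summable.of_norm_bounded_eventually (hsum.mul_left ((2 * C) ^ σ)) ?_
    filter_upwards [hev] with i hi
    have h2 : 2 < 1 + C * μ i := (Real.rpow_lt_rpow_iff_of_neg (hA i) two_pos (by linarith)).1 hi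
    rw [Real.norm_of_nonneg (Real.rpow_nonneg (hμ i).le _)]
    calc μ i ^ (-σ) = (2 * C) ^ σ * (2 * C * μ i) ^ (-σ) := by
          rw [Real.mul_rpow (by positivity) (hμ i).le, ← mul_assoc,
            ← Real.rpow_add (by positivity), add_neg_cancel, Real.rpow_zero, one_mul]
      _ ≤ _ := by
          refine mul_le_mul_of_nonneg_left ?_ (by positivity)
          exact Real.rpow_le_rpow_of_nonpos (hA i) (by linarith) (by linarith)
  have : (fun i => if μ i = 0 then 0 else μ i ^ (-σ)) =
      Set.indicator {i | μ i ≠ 0} fun i => μ i ^ (-σ) := by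
    funext i
    by_cases hi : μ i = 0 <;> simp [Set.indicator, hi]
  rw [this]
  exact summable_subtype_iff_indicator.1 hP

end Singular

/-! ### Twisted commutators with operator matrices -/

section Commutator
variable {E F : Type*} [NormedAddCommGroup E] [InnerProductSpace ℂ E] [CompleteSpace E]
  [NormedAddCommGroup F] [InnerProductSpace ℂ F] [CompleteSpace F]

/-- If `T A - A' T` is bounded, then so is `T† A'† - A† T†`. -/
theorem adjoint_commutator {T : E →ₗ.[ℂ] F} (hT : Dense (T.domain : Set E)) {A : E →L[ℂ] E}
    {A' : F →L[ℂ] F} {B : E →L[ℂ] F}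
    (h : ∀ x w, (x, w) ∈ T.graph → (A x, A' w + B x) ∈ T.graph) {y : F} {z : E}
    (hyz : (y, z) ∈ T.adjoint.graph) :
    (star A' y, star A z + (-ContinuousLinearMap.adjoint B) y) ∈ T.adjoint.graph := by
  rw [mem_adjoint_graph_iff hT] at hyz ⊢
  intro x w hxw
  have h1 := hyz _ _ (h x w hxw)
  rw [inner_add_right] at h1
  rw [ContinuousLinearMap.star_eq_adjoint, ContinuousLinearMap.star_eq_adjoint, inner_add_left,
    ContinuousLinearMap.adjoint_inner_left, ContinuousLinearMap.adjoint_inner_left, h1,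
    _root_.neg_apply, inner_neg_left, ContinuousLinearMap.adjoint_inner_left]
  ring

theorem isBoundedTwistedCommutator_offDiag {S : F →ₗ.[ℂ] E} {T : E →ₗ.[ℂ] F} {A₁ A₂ : E →L[ℂ] E}
    {A₁' A₂' : F →L[ℂ] F} {B : E →L[ℂ] F} {B' : F →L[ℂ] E}
    (h : ∀ x w, (x, w) ∈ T.graph → (A₁ x, A₂' w + B x) ∈ T.graph)
    (h' : ∀ y z, (y, z) ∈ S.graph → (A₁' y, A₂ z + B' y) ∈ S.graph) :
    IsBoundedTwistedCommutator (offDiag S T) (diagOp A₁ A₁') (diagOp A₂ A₂') := by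
  let e := WithLp.prodContinuousLinearEquiv 2 ℂ E F
  refine ⟨e.symm.toContinuousLinearMap ∘L ((B' ∘L ContinuousLinearMap.snd ℂ E F).prod
    (B ∘L ContinuousLinearMap.fst ℂ E F)) ∘L e.toContinuousLinearMap, fun x => ?_⟩
  obtain ⟨h1, h2⟩ := mem_offDiag_graph.1 ((offDiag S T).mem_graph x)
  obtain ⟨hx, hx'⟩ := mem_graph_iff_exists.1 (mem_offDiag_graph.2 ⟨h _ _ h1, h' _ _ h2⟩ :
    (WithLp.toLp 2 (A₁ (x : WithLp 2 (E × F)).fst, A₁' (x : WithLp 2 (E × F)).snd),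
      WithLp.toLp 2 (A₂ (offDiag S T x).fst + B' (x : WithLp 2 (E × F)).snd,
        A₂' (offDiag S T x).snd + B (x : WithLp 2 (E × F)).fst)) ∈ (offDiag S T).graph)
  refine ⟨hx, ?_⟩
  rw [sub_eq_iff_eq_add]
  refine hx'.trans ?_
  refine (WithLp.ofLp_injective 2) (Prod.ext ?_ ?_)
  · exact add_comm _ _
  · exact add_comm _ _

end Commutator

/-! ### Diagonal operators -/

section Diagonal
variable {E F G : Type} [NormedAddCommGroup E] [InnerProductSpace ℂ E] [CompleteSpace E]
  [NormedAddCommGroup F] [InnerProductSpace ℂ F] [CompleteSpace F]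
  [NormedAddCommGroup G] [InnerProductSpace ℂ G] [CompleteSpace G] {κ : Type}

/-- The closed operator `N` is diagonal: it maps `b p` to `lam p • e p` for the Hilbert bases `b`
and `e`, and acts on its domain by multiplication of the coefficients with `lam`. -/
structure IsDiagonal (N : E →ₗ.[ℂ] F) (b : HilbertBasis κ ℂ E) (e : HilbertBasis κ ℂ F)
    (lam : κ → ℂ) : Prop where
  isClosed : N.IsClosed
  mem : ∀ p, (b p, lam p • e p) ∈ N.graph
  coeff : ∀ x w, (x, w) ∈ N.graph → ∀ p, ⟪e p, w⟫_ℂ = lam p * ⟪b p, x⟫_ℂ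

theorem sum_norm_inner_sq_le (b : HilbertBasis κ ℂ E) (x : E) (s : Finset κ) :
    ∑ p ∈ s, ‖⟪b p, x⟫_ℂ‖ ^ 2 ≤ ‖x‖ ^ 2 :=
  sum_le_hasSum s (fun _ _ => sq_nonneg _) (hasSum_norm_inner_sq b x)

theorem hilbertBasis_ext (b : HilbertBasis κ ℂ E) {x y : E}
    (h : ∀ p, ⟪b p, x⟫_ℂ = ⟪b p, y⟫_ℂ) : x = y := by
  refine b.repr.injective (lp.ext (funext fun p => ?_))
  rw [b.repr_apply_apply, b.repr_apply_apply, h]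

theorem exists_inner_eq (b : HilbertBasis κ ℂ E) (f : κ → ℂ)
    (hf : Summable fun p => ‖f p‖ ^ 2) : ∃ x : E, ∀ p, ⟪b p, x⟫_ℂ = f p := by
  have hf' : Memℓp f 2 := (memℓp_gen_iff (by norm_num)).2 (by simpa using hf)
  refine ⟨b.repr.symm ⟨f, hf'⟩, fun p => ?_⟩
  rw [← b.repr_apply_apply, LinearIsometryEquiv.apply_symm_apply]

namespace IsDiagonal
variable {N : E →ₗ.[ℂ] F} {b : HilbertBasis κ ℂ E} {e : HilbertBasis κ ℂ F} {lam : κ → ℂ}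

theorem dense_domain (h : IsDiagonal N b e lam) : Dense (N.domain : Set E) := by
  rw [Submodule.dense_iff_topologicalClosure_eq_top, eq_top_iff, ← b.dense_span]
  refine Submodule.topologicalClosure_mono (Submodule.span_le.2 ?_)
  rintro _ ⟨p, rfl⟩
  exact LinearPMap.mem_domain_of_mem_graph (h.mem p)

theorem mem_graph_iff (h : IsDiagonal N b e lam) {x : E} {w : F} :
    (x, w) ∈ N.graph ↔ ∀ p, ⟪e p, w⟫_ℂ = lam p * ⟪b p, x⟫_ℂ := by
  refine ⟨h.coeff x w, fun hp => ?_⟩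
  have h1 := b.hasSum_repr x
  have h2 := e.hasSum_repr w
  refine h.isClosed.mem_of_tendsto (h1.prodMk h2) (Eventually.of_forall fun s => ?_)
  refine Submodule.sum_mem _ fun p _ => ?_
  have h3 := N.graph.smul_mem ⟪b p, x⟫_ℂ (h.mem p)
  rw [Prod.smul_mk, smul_smul, mul_comm, ← hp] at h3
  rwa [b.repr_apply_apply, e.repr_apply_apply]

theorem mem_adjoint_graph_iff (h : IsDiagonal N b e lam) {y : F} {z : E} :
    (y, z) ∈ N.adjoint.graph ↔ ∀ p, ⟪b p, z⟫_ℂ = (starRingEnd ℂ) (lam p) * ⟪e p, y⟫_ℂ := by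
  rw [NCTorus.mem_adjoint_graph_iff h.dense_domain]
  constructor
  · intro hyz p
    have h1 := congrArg (starRingEnd ℂ) (hyz _ _ (h.mem p))
    rwa [inner_conj_symm, inner_conj_symm, inner_smul_left] at h1
  · intro hp x w hxw
    refine (b.hasSum_inner_mul_inner z x).unique ?_
    refine (e.hasSum_inner_mul_inner y w).congr_fun fun p => ?_
    rw [h.coeff _ _ hxw, ← inner_conj_symm z, hp, map_mul, Complex.conj_conj, inner_conj_symm]
    ring

/-- An antiunitary involution `J` for which `N` is diagonal also in the basis `J (b p)`, with the
entries `-lam p`, commutes with `N† N`. -/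
theorem conj_mem (h : IsDiagonal N b e lam) (J : E ≃ₗᵢ⋆[ℂ] E) (hJ : ∀ x, J (J x) = x)
    {b' : HilbertBasis κ ℂ E} {e' : HilbertBasis κ ℂ F} (hb' : ∀ p, b' p = J (b p))
    (h' : IsDiagonal N b' e' (-lam)) {z v : E} {w : F} (hzw : (z, w) ∈ N.graph)
    (hwv : (w, v) ∈ N.adjoint.graph) :
    ∃ w', (J z, w') ∈ N.graph ∧ (w', J v) ∈ N.adjoint.graph := by
  have hJb (p : κ) (x : E) : ⟪b p, J x⟫_ℂ = (starRingEnd ℂ) ⟪b' p, x⟫_ℂ := by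
    rw [hb', inner_conj_symm, ← inner_conj_swap J (J (b p)), hJ]
  have h1 (p : κ) : ⟪e' p, w⟫_ℂ = -lam p * ⟪b' p, z⟫_ℂ := h'.coeff _ _ hzw p
  have h2 (p : κ) : ⟪b' p, v⟫_ℂ = (starRingEnd ℂ) (-lam p) * ⟪e' p, w⟫_ℂ :=
    h'.mem_adjoint_graph_iff.1 hwv p
  obtain ⟨w', hw'⟩ := exists_inner_eq e (fun p => lam p * ⟪b p, J z⟫_ℂ) (by
    refine (hasSum_norm_inner_sq e' w).summable.congr fun p => ?_
    rw [h1, hJb, norm_mul, norm_mul, norm_neg, RCLike.norm_conj])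
  refine ⟨w', h.mem_graph_iff.2 hw', h.mem_adjoint_graph_iff.2 fun p => ?_⟩
  rw [hw', hJb, hJb, h2, h1]
  simp only [map_mul, _root_.map_neg, Complex.conj_conj]
  ring

section Comp
variable {T : G →ₗ.[ℂ] F} {M : G ≃L[ℂ] E}

theorem dense_domain_comp (h : IsDiagonal N b e lam)
    (hM : ∀ x w, (x, w) ∈ T.graph ↔ (M x, w) ∈ N.graph) : Dense (T.domain : Set G) := by
  have : (T.domain : Set G) = M ⁻¹' N.domain := by
    ext x
    simp only [SetLike.mem_coe, Set.mem_preimage, LinearPMap.mem_domain_iff, hM]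
  rw [this]
  exact h.dense_domain.preimage M.toHomeomorph.isOpenMap

theorem isClosed_comp (h : IsDiagonal N b e lam)
    (hM : ∀ x w, (x, w) ∈ T.graph ↔ (M x, w) ∈ N.graph) : T.IsClosed := by
  have : (T.graph : Set (G × F)) = (fun p : G × F => (M p.1, p.2)) ⁻¹' N.graph :=
    Set.ext fun p => hM p.1 p.2
  rw [LinearPMap.IsClosed, this]
  exact h.isClosed.preimage (by fun_prop)

theorem hasCompactEmbedding_comp (h : IsDiagonal N b e lam)
    (hM : ∀ x w, (x, w) ∈ T.graph ↔ (M x, w) ∈ N.graph)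
    (hlam : Tendsto (fun p => ‖lam p‖ ^ 2) cofinite atTop) : HasCompactEmbedding T := by
  intro X _ _ L B hLB
  have h1 : IsCompactOperator ((M : G →L[ℂ] E) ∘L L) := by
    refine isCompactOperator_of_coeff b _ hlam _ (‖B‖ ^ 2) fun x s => ?_
    calc _ = ∑ p ∈ s, ‖⟪e p, B x⟫_ℂ‖ ^ 2 := by
          refine Finset.sum_congr rfl fun p _ => ?_
          rw [h.coeff _ _ ((hM _ _).1 (hLB x)), norm_mul, mul_pow]
          rfl
      _ ≤ ‖B x‖ ^ 2 := sum_norm_inner_sq_le e _ s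
      _ ≤ (‖B‖ * ‖x‖) ^ 2 := by gcongr; exact B.le_opNorm x
      _ = _ := mul_pow _ _ _
  have h2 := h1.clm_comp (M.symm : E →L[ℂ] G)
  refine Eq.subst (motive := fun f : X → G => IsCompactOperator f) ?_ h2
  funext x
  exact M.symm_apply_apply (L x)

theorem adjoint_comp_lower_bound (h : IsDiagonal N b e lam)
    (hM : ∀ x w, (x, w) ∈ T.graph ↔ (M x, w) ∈ N.graph) {y : F} {z : G}
    (hyz : (y, z) ∈ T.adjoint.graph) (s : Finset κ) :
    ∑ p ∈ s, ‖lam p‖ ^ 2 * ‖⟪e p, y⟫_ℂ‖ ^ 2 ≤ (‖(M.symm : E →L[ℂ] G)‖ + 1) ^ 2 * ‖z‖ ^ 2 := by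
  let A : G →L[ℂ] E := ContinuousLinearMap.adjoint (M.symm : E →L[ℂ] G)
  have hA : ‖A‖ = ‖(M.symm : E →L[ℂ] G)‖ := LinearIsometryEquiv.norm_map _ _
  have h1 (p : κ) : lam p * ⟪y, e p⟫_ℂ = ⟪A z, b p⟫_ℂ := by
    have h2 : (M.symm (b p), lam p • e p) ∈ T.graph := by
      rw [hM, M.apply_symm_apply]; exact h.mem p
    have h3 := (NCTorus.mem_adjoint_graph_iff (h.dense_domain_comp hM)).1 hyz _ _ h2
    rw [inner_smul_right] at h3
    rw [← h3, ContinuousLinearMap.adjoint_inner_left]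
    rfl
  calc _ = ∑ p ∈ s, ‖⟪b p, A z⟫_ℂ‖ ^ 2 := by
        refine Finset.sum_congr rfl fun p _ => ?_
        rw [norm_inner_symm (b p), ← h1, norm_mul, mul_pow, norm_inner_symm]
    _ ≤ ‖A z‖ ^ 2 := sum_norm_inner_sq_le b _ s
    _ ≤ ((‖(M.symm : E →L[ℂ] G)‖ + 1) * ‖z‖) ^ 2 := by
        gcongr
        refine (A.le_opNorm z).trans ?_
        rw [hA]
        gcongr
        linarith
    _ = _ := mul_pow _ _ _

theorem hasCompactEmbedding_adjoint_comp (h : IsDiagonal N b e lam)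
    (hM : ∀ x w, (x, w) ∈ T.graph ↔ (M x, w) ∈ N.graph)
    (hlam : Tendsto (fun p => ‖lam p‖ ^ 2) cofinite atTop) : HasCompactEmbedding T.adjoint := by
  intro X _ _ L B hLB
  refine isCompactOperator_of_coeff e _ hlam L
    ((‖(M.symm : E →L[ℂ] G)‖ + 1) ^ 2 * ‖B‖ ^ 2) fun x s => ?_
  refine (h.adjoint_comp_lower_bound hM (hLB x) s).trans ?_
  rw [mul_assoc, ← mul_pow ‖B‖]
  gcongr
  exact B.le_opNorm x

end Comp
end IsDiagonal

theorem mem_pcomp_graph {E F G : Type*} [NormedAddCommGroup E] [InnerProductSpace ℂ E]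
    [NormedAddCommGroup F] [InnerProductSpace ℂ F] [NormedAddCommGroup G] [InnerProductSpace ℂ G]
    {S : F →ₗ.[ℂ] G} {T : E →ₗ.[ℂ] F} {x : E} {y : F} {z : G} (h₁ : (x, y) ∈ T.graph)
    (h₂ : (y, z) ∈ S.graph) : (x, z) ∈ (pcomp S T).graph := by
  obtain ⟨hx, rfl⟩ := mem_graph_iff_exists.1 h₁
  obtain ⟨hy, rfl⟩ := mem_graph_iff_exists.1 h₂
  exact mem_graph_iff_exists.2 ⟨⟨hx, hy⟩, rfl⟩

theorem mem_ofCLM_graph {E F : Type*} [NormedAddCommGroup E] [InnerProductSpace ℂ E]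
    [NormedAddCommGroup F] [InnerProductSpace ℂ F] (L : E →L[ℂ] F) (x : E) :
    (x, L x) ∈ (ofCLM L).graph :=
  mem_graph_iff_exists.2 ⟨Submodule.mem_top, rfl⟩

/-- The image of a Hilbert basis under an antiunitary operator. -/
theorem exists_hilbertBasis_antiunitary (J : E ≃ₗᵢ⋆[ℂ] F)
    (hJ : ∀ x y, ⟪J x, J y⟫_ℂ = ⟪y, x⟫_ℂ) (b : HilbertBasis κ ℂ E) :
    ∃ b' : HilbertBasis κ ℂ F, ∀ p, b' p = J (b p) := by
  classical
  have hv : Orthonormal ℂ fun p => J (b p) := by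
    rw [orthonormal_iff_ite]
    intro i j
    rw [hJ, orthonormal_iff_ite.1 b.orthonormal]
    exact if_congr eq_comm rfl rfl
  have hbot : (Submodule.span ℂ (Set.range fun p => J (b p)))ᗮ = ⊥ := by
    rw [Submodule.eq_bot_iff]
    intro x hx
    have h1 : J.symm x = 0 := hilbertBasis_ext b fun p => by
      have h2 : ⟪J (b p), x⟫_ℂ = 0 :=
        (Submodule.mem_orthogonal _ _).1 hx _ (Submodule.subset_span ⟨p, rfl⟩)
      rw [← J.apply_symm_apply x, hJ] at h2
      rw [inner_zero_right, ← inner_conj_symm, h2, _root_.map_zero]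
    simpa using h1
  exact ⟨HilbertBasis.mkOfOrthogonalEqBot hv hbot, fun p => by
    rw [HilbertBasis.coe_mkOfOrthogonalEqBot]⟩

end Diagonal

/-! ### Homogeneous elements of the rotation algebra and the diagonal form of `∂` -/

section Weights
variable {θ : ℝ}

/-- `c` is homogeneous of degree `q ∈ ℤ²` for the action `α`, like the monomial `U^{q₁} V^{q₂}`. -/
def IsWeight (q : ℤ × ℤ) (c : Alg θ) : Prop :=
  ∀ s : ℝ × ℝ, alpha θ s c = (Circle.exp (s.1 * q.1 + s.2 * q.2) : ℂ) • c

theorem IsWeight.mul {q r : ℤ × ℤ} {c d : Alg θ} (hc : IsWeight q c) (hd : IsWeight r d) :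
    IsWeight (q + r) (c * d) := fun s => by
  rw [_root_.map_mul, hc, hd, smul_mul_smul_comm, ← Circle.coe_mul, ← Circle.exp_add]
  congr 3
  push_cast [Prod.fst_add, Prod.snd_add]
  ring

theorem IsWeight.star {q : ℤ × ℤ} {c : Alg θ} (hc : IsWeight q c) : IsWeight (-q) (star c) :=
  fun s => by
  rw [map_star, hc, star_smul]
  congr 1
  rw [Complex.star_def, ← Circle.coe_inv_eq_conj, ← Circle.exp_neg]
  congr 2
  push_cast [Prod.fst_neg, Prod.snd_neg]
  ring

theorem isWeight_one : IsWeight 0 (1 : Alg θ) := fun s => by simp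

theorem isWeight_U : IsWeight (1, 0) (U θ) := fun s => by simp [alpha_U]

theorem isWeight_V : IsWeight (0, 1) (V θ) := fun s => by simp [alpha_V]

theorem IsWeight.mem_smooth {q : ℤ × ℤ} {c : Alg θ} (hc : IsWeight q c) : c ∈ smooth θ := by
  change ContDiff ℝ ∞ fun s : ℝ × ℝ => alpha θ s c
  have h : (fun s : ℝ × ℝ => alpha θ s c) = fun s : ℝ × ℝ =>
      Complex.exp (((s.1 * q.1 + s.2 * q.2 : ℝ) : ℂ) * Complex.I) • c := by
    funext s; rw [hc, Circle.coe_exp]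
  rw [h]
  have h1 : ContDiff ℝ ∞ fun s : ℝ × ℝ => (s.1 * q.1 + s.2 * q.2 : ℝ) := by fun_prop
  exact ((Complex.ofRealCLM.contDiff.comp h1).mul contDiff_const).cexp.smul contDiff_const

theorem hasDerivAt_exp_mul_smul (n : ℝ) (a : Alg θ) :
    HasDerivAt (fun t : ℝ => (Circle.exp (t * n) : ℂ) • a) ((n : ℂ) • Complex.I • a) 0 := by
  have h1 : HasDerivAt (fun t : ℝ => t * n) n 0 := by
    simpa using (hasDerivAt_id (0 : ℝ)).mul_const n
  have h2 : HasDerivAt (fun t : ℝ => (Circle.exp t : ℂ) • a) (Complex.I • a) ((0 : ℝ) * n) := by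
    rw [zero_mul]; exact hasDerivAt_exp_smul a
  have h3 := h2.scomp (0 : ℝ) h1
  rw [Complex.coe_smul]
  exact h3

theorem IsWeight.delta₁ {q : ℤ × ℤ} {c : Alg θ} (hc : IsWeight q c) :
    delta₁ c = (q.1 : ℂ) • c := by
  have h : (fun t : ℝ => alpha θ (t, 0) c) = fun t : ℝ => (Circle.exp (t * q.1) : ℂ) • c := by
    funext t; rw [hc]; simp
  rw [NCTorus.delta₁, h, (hasDerivAt_exp_mul_smul _ c).deriv, smul_smul, smul_smul]
  congr 1
  push_cast
  linear_combination -(q.1 : ℂ) * Complex.I_mul_I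

theorem IsWeight.delta₂ {q : ℤ × ℤ} {c : Alg θ} (hc : IsWeight q c) :
    delta₂ c = (q.2 : ℂ) • c := by
  have h : (fun t : ℝ => alpha θ (0, t) c) = fun t : ℝ => (Circle.exp (t * q.2) : ℂ) • c := by
    funext t; rw [hc]; simp
  rw [NCTorus.delta₂, h, (hasDerivAt_exp_mul_smul _ c).deriv, smul_smul, smul_smul]
  congr 1
  push_cast
  linear_combination -(q.2 : ℂ) * Complex.I_mul_I

/-- The eigenvalue `q₁ + i q₂` of `∂` on elements of degree `q`. -/
def delEig (q : ℤ × ℤ) : ℂ := q.1 + Complex.I * q.2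

theorem delEig_neg (q : ℤ × ℤ) : delEig (-q) = -delEig q := by
  simp [delEig]; ring

theorem norm_delEig_sq (q : ℤ × ℤ) : ‖delEig q‖ ^ 2 = (q.1 : ℝ) ^ 2 + (q.2 : ℝ) ^ 2 := by
  rw [Complex.sq_norm, Complex.normSq_apply]
  simp [delEig]
  ring

theorem IsWeight.del {q : ℤ × ℤ} {c : Alg θ} (hc : IsWeight q c) :
    del θ ⟨c, hc.mem_smooth⟩ = delEig q • c := by
  change NCTorus.delta₁ c + Complex.I • NCTorus.delta₂ c = _
  rw [hc.delta₁, hc.delta₂, smul_smul, ← add_smul]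
  rfl

theorem IsWeight.delStar {q : ℤ × ℤ} {c : Alg θ} (hc : IsWeight q c) :
    delStar θ c = (starRingEnd ℂ) (delEig q) • c := by
  rw [NCTorus.delStar, hc.delta₁, hc.delta₂, smul_smul, ← sub_smul]
  congr 1
  simp [delEig]
  ring

/-- In every degree there is a unitary, namely a monomial in `U` and `V`. -/
theorem exists_unitary_isWeight (q : ℤ × ℤ) : ∃ c : Alg θ, IsWeight q c ∧
    star c * c = 1 ∧ c * star c = 1 := by
  have hUs : U θ * star (U θ) = 1 := by
    refine toOp_injective θ ?_
    rw [_root_.map_mul, map_star, map_one, toOp_U]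
    have hst : star opU = ((phaseShift 1 (1, 0)).symm.toContinuousLinearEquiv : L2 →L[ℂ] L2) :=
      (phaseShift 1 (1, 0)).adjoint_eq_symm
    rw [hst]
    ext1 f
    exact (phaseShift 1 (1, 0)).apply_symm_apply f
  let W := phaseShift (fun p => Circle.exp (2 * Real.pi * θ * p.1)) (0, 1)
  have hVst : star (opV θ) = (W.symm.toContinuousLinearEquiv : L2 →L[ℂ] L2) := W.adjoint_eq_symm
  have hV : star (V θ) * V θ = 1 := by
    refine toOp_injective θ ?_
    rw [_root_.map_mul, map_star, map_one, toOp_V, hVst]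
    ext1 f
    exact W.symm_apply_apply f
  have hVs : V θ * star (V θ) = 1 := by
    refine toOp_injective θ ?_
    rw [_root_.map_mul, map_star, map_one, toOp_V, hVst]
    ext1 f
    exact W.apply_symm_apply f
  let S : AddSubgroup (ℤ × ℤ) :=
    { carrier := {q | ∃ c : Alg θ, IsWeight q c ∧ star c * c = 1 ∧ c * star c = 1}
      zero_mem' := ⟨1, isWeight_one, by simp, by simp⟩
      add_mem' := by
        rintro q r ⟨c, hc, h1, h2⟩ ⟨d, hd, h3, h4⟩
        refine ⟨c * d, hc.mul hd, ?_, ?_⟩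
        · rw [star_mul, mul_assoc, ← mul_assoc (Star.star c), h1, one_mul, h3]
        · rw [star_mul, mul_assoc, ← mul_assoc d, h4, one_mul, h2]
      neg_mem' := by
        rintro q ⟨c, hc, h1, h2⟩
        exact ⟨Star.star c, hc.star, by rw [star_star, h2], by rw [star_star, h1]⟩ }
  have h : q ∈ S := by
    have h1 : ((1, 0) : ℤ × ℤ) ∈ S := ⟨U θ, isWeight_U, star_U_mul_U, hUs⟩
    have h2 : ((0, 1) : ℤ × ℤ) ∈ S := ⟨V θ, isWeight_V, hV, hVs⟩
    have h3 : q = q.1 • ((1, 0) : ℤ × ℤ) + q.2 • ((0, 1) : ℤ × ℤ) := by ext <;> simp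
    rw [h3]
    exact S.add_mem (S.zsmul_mem h1 _) (S.zsmul_mem h2 _)
  exact h

theorem exists_exp_eq_neg_one {q : ℤ × ℤ} (hq : q ≠ 0) :
    ∃ s : ℝ × ℝ, (Circle.exp (s.1 * q.1 + s.2 * q.2) : ℂ) = -1 := by
  by_cases h1 : q.1 = 0
  · have h2 : (q.2 : ℝ) ≠ 0 := by
      intro h; exact hq (Prod.ext h1 (by exact_mod_cast h))
    refine ⟨(0, Real.pi / q.2), ?_⟩
    simp only [zero_mul, zero_add, div_mul_cancel₀ _ h2, Circle.coe_exp, Complex.exp_pi_mul_I]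
  · have h2 : (q.1 : ℝ) ≠ 0 := by exact_mod_cast h1
    refine ⟨(Real.pi / q.1, 0), ?_⟩
    simp only [zero_mul, add_zero, div_mul_cancel₀ _ h2, Circle.coe_exp, Complex.exp_pi_mul_I]

theorem norm_vac : ‖vac‖ = 1 := by
  rw [vac, lp.norm_single (by norm_num), norm_one]

theorem tau_one : tau θ (1 : Alg θ) = 1 := by
  rw [tau_apply, map_one]
  change ⟪vac, vac⟫_ℂ = 1
  rw [inner_self_eq_ofReal, norm_vac]
  simp

theorem IsWeight.tau_eq_zero {q : ℤ × ℤ} {c : Alg θ} (hc : IsWeight q c) (hq : q ≠ 0) :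
    tau θ c = 0 := by
  obtain ⟨s, hs⟩ := exists_exp_eq_neg_one hq
  have h := tau_alpha s c
  rw [hc, hs, _root_.map_smul, smul_eq_mul] at h
  linear_combination (-1 / 2) * h

theorem norm_toGNS_tau (a : Alg θ) : ‖toGNS (tau θ) a‖ = ‖toOp θ a vac‖ := by
  have h : ((‖toGNS (tau θ) a‖ ^ 2 : ℝ) : ℂ) = (‖toOp θ a vac‖ ^ 2 : ℝ) := by
    rw [← inner_self_eq_ofReal, inner_toGNS, ← tauLin_star_mul_self]
    rfl
  exact (sq_eq_sq₀ (norm_nonneg _) (norm_nonneg _)).1 (by exact_mod_cast h)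

/-- The elements of degree `0` are, in `H_0`, the scalars. -/
theorem IsWeight.toGNS_eq_smul_one {c : Alg θ} (hc : IsWeight 0 c) :
    toGNS (tau θ) c = tau θ c • toGNS (tau θ) 1 := by
  have hv (s : ℝ × ℝ) : diagUnitary s (toOp θ c vac) = toOp θ c vac := by
    have h1 : (diagUnitary s).symm vac = vac := by
      ext p
      by_cases hp : p = (0, 0)
      · subst hp; simp [diagUnitary]
      · simp [diagUnitary, vac, lp.single_apply, Pi.single_eq_of_ne hp]
    have h2 : toOp θ (alpha θ s c) = toOp θ c := by rw [hc]; simp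
    have h3 := congrArg (fun A : L2 →L[ℂ] L2 => A vac) h2
    change diagUnitary s (toOp θ c ((diagUnitary s).symm vac)) = toOp θ c vac at h3
    rwa [h1] at h3
  have h0 (p : ℤ × ℤ) (hp : p ≠ 0) : toOp θ c vac p = 0 := by
    obtain ⟨s, hs⟩ := exists_exp_eq_neg_one hp
    have h1 := congrArg (fun f : L2 => f p) (hv s)
    simp only [diagUnitary, phaseShift_apply, sub_zero, hs] at h1
    linear_combination (-1 / 2) * h1
  have h4 : toOp θ c vac = tau θ c • vac := by
    have ht : tau θ c = toOp θ c vac 0 := by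
      rw [tau_apply, vac, lp.inner_single_left]
      simp
      rfl
    rw [ht]
    ext p
    by_cases hp : p = 0
    · subst hp
      simp only [lp.coeFn_smul, Pi.smul_apply, smul_eq_mul]
      rw [show (vac : L2) 0 = 1 from by simp [vac, lp.single_apply]; rfl]
      simp
    · simp only [lp.coeFn_smul, Pi.smul_apply, smul_eq_mul, h0 p hp]
      rw [show (vac : L2) p = 0 from by
        simp [vac, lp.single_apply, Pi.single_eq_of_ne (show p ≠ (0, 0) from hp)], mul_zero]
  rw [← sub_eq_zero, ← _root_.map_smul, ← _root_.map_sub, ← norm_eq_zero, norm_toGNS_tau,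
    _root_.map_sub, _root_.map_smul, map_one]
  change ‖toOp θ c vac - tau θ c • vac‖ = 0
  rw [h4, sub_self, norm_zero]

/-- A choice of unitary homogeneous elements, one in each degree. -/
def mono (θ : ℝ) (q : ℤ × ℤ) : Alg θ := (exists_unitary_isWeight q).choose

theorem isWeight_mono (q : ℤ × ℤ) : IsWeight q (mono θ q) :=
  (exists_unitary_isWeight q).choose_spec.1

theorem star_mono_mul_mono (q : ℤ × ℤ) : star (mono θ q) * mono θ q = 1 :=
  (exists_unitary_isWeight q).choose_spec.2.1

theorem mono_mul_star_mono (q : ℤ × ℤ) : mono θ q * star (mono θ q) = 1 :=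
  (exists_unitary_isWeight q).choose_spec.2.2

/-- An element of degree `q` is, in `H_0`, a multiple of the chosen unitary of degree `q`. -/
theorem IsWeight.toGNS_mem_span {q : ℤ × ℤ} {c : Alg θ} (hc : IsWeight q c) :
    toGNS (tau θ) c ∈ Submodule.span ℂ (Set.range fun q => toGNS (tau θ) (mono θ q)) := by
  have h1 : IsWeight 0 (Star.star (mono θ q) * c) := by
    simpa using (isWeight_mono q).star.mul hc
  have h2 := congrArg ((tau θ).gnsStarAlgHom (mono θ q)) h1.toGNS_eq_smul_one
  rw [_root_.map_smul, gns_toGNS, gns_toGNS, ← mul_assoc, mono_mul_star_mono, one_mul,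
    mul_one] at h2
  rw [h2]
  exact Submodule.smul_mem _ _ (Submodule.subset_span ⟨q, rfl⟩)

/-- The span of the homogeneous elements, a `*`-subalgebra of `A_θ`. -/
def weightSpan (θ : ℝ) : StarSubalgebra ℂ (Alg θ) where
  carrier := Submodule.span ℂ {c : Alg θ | ∃ q, IsWeight q c}
  mul_mem' {a b} ha hb := by
    have h := Submodule.mul_mem_mul ha hb
    rw [Submodule.span_mul_span] at h
    refine Submodule.span_mono ?_ h
    rintro _ ⟨c, ⟨q, hc⟩, d, ⟨r, hd⟩, rfl⟩
    exact ⟨q + r, hc.mul hd⟩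
  add_mem' ha hb := add_mem ha hb
  algebraMap_mem' z := by
    rw [Algebra.algebraMap_eq_smul_one]
    exact Submodule.smul_mem _ _ (Submodule.subset_span ⟨0, isWeight_one⟩)
  star_mem' {a} ha := by
    induction ha using Submodule.span_induction with
    | mem c hc => obtain ⟨q, hc⟩ := hc; exact Submodule.subset_span ⟨-q, hc.star⟩
    | zero => rw [star_zero]; exact zero_mem _
    | add x y _ _ hx hy => rw [star_add]; exact add_mem hx hy
    | smul z x _ hx => rw [star_smul]; exact Submodule.smul_mem _ _ hx

theorem dense_weightSpan (θ : ℝ) : Dense (weightSpan θ : Set (Alg θ)) :=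
  dense_of_mem (Submodule.subset_span ⟨_, isWeight_U⟩) (Submodule.subset_span ⟨_, isWeight_V⟩)

theorem orthonormal_mono : Orthonormal ℂ fun q => toGNS (tau θ) (mono θ q) := by
  classical
  rw [orthonormal_iff_ite]
  intro p q
  rw [inner_toGNS]
  split_ifs with hpq
  · rw [hpq, star_mono_mul_mono, tau_one]
  · refine ((isWeight_mono p).star.mul (isWeight_mono q)).tau_eq_zero fun h => hpq ?_
    rwa [neg_add_eq_zero] at h

theorem span_mono_dense :
    ⊤ ≤ (Submodule.span ℂ (Set.range fun q => toGNS (tau θ) (mono θ q))).topologicalClosure := by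
  intro x _
  refine closure_mono ?_
    ((denseRange_toGNS (tau θ)).dense_image (continuous_toGNS _) (dense_weightSpan θ) x)
  rintro _ ⟨a, ha, rfl⟩
  have ha' : a ∈ Submodule.span ℂ {c : Alg θ | ∃ q, IsWeight q c} := ha
  change a ∈ (Submodule.span ℂ (Set.range fun q => toGNS (tau θ) (mono θ q))).comap
    (toGNS (tau θ))
  refine Submodule.span_le.2 ?_ ha'
  rintro c ⟨q, hc⟩
  exact hc.toGNS_mem_span

/-- The Hilbert basis of `H_0` given by the monomials in `U` and `V`. -/
def monoBasis (θ : ℝ) : HilbertBasis (ℤ × ℤ) ℂ (H0 θ) :=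
  HilbertBasis.mk orthonormal_mono span_mono_dense

theorem monoBasis_apply (q : ℤ × ℤ) : monoBasis θ q = toGNS (tau θ) (mono θ q) := by
  rw [monoBasis, HilbertBasis.coe_mk]

/-- The space `H^{(1,0)}` is all of `H_0`. -/
def formEquiv (θ : ℝ) : H10 θ ≃ₗᵢ[ℂ] H0 θ := LinearIsometryEquiv.ofTop (H0 θ) (H10 θ) H10_eq_top

theorem coe_formEquiv_symm (x : H0 θ) : (((formEquiv θ).symm x : H10 θ) : H0 θ) = x :=
  (formEquiv θ).apply_symm_apply x

/-- A Hilbert basis of `H_0`, as a Hilbert basis of `H^{(1,0)}`. -/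
def formBasis {κ : Type} (b : HilbertBasis κ ℂ (H0 θ)) : HilbertBasis κ ℂ (H10 θ) :=
  .ofRepr ((formEquiv θ).trans b.repr)

theorem formBasis_apply {κ : Type} (b : HilbertBasis κ ℂ (H0 θ)) (p : κ) :
    formBasis b p = (formEquiv θ).symm (b p) := by
  classical
  rw [← HilbertBasis.repr_symm_single, ← HilbertBasis.repr_symm_single]
  rfl

theorem mem_delGraph (ψ : Alg θ →ₚ[ℂ] ℂ) (a : smooth θ) :
    (toGNS ψ a, (formEquiv θ).symm (toGNS (tau θ) (del θ a))) ∈ delGraph ψ :=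
  ⟨a, Prod.ext rfl (Subtype.ext (coe_formEquiv_symm _).symm)⟩

/-- The operator `∂` on `H_0` is diagonal in a Hilbert basis of homogeneous elements. -/
theorem isDiagonal_delOp {κ : Type} (b : HilbertBasis κ ℂ (H0 θ)) (q : κ → ℤ × ℤ)
    (c : κ → Alg θ) (hc : ∀ p, IsWeight (q p) (c p)) (hb : ∀ p, b p = toGNS (tau θ) (c p)) :
    IsDiagonal (delOp (tau θ)) b (formBasis b) (fun p => delEig (q p)) where
  isClosed := by
    rw [LinearPMap.IsClosed, delOp_tau_graph]
    exact Submodule.isClosed_topologicalClosure _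
  mem p := by
    rw [delOp_tau_graph]
    refine Submodule.le_topologicalClosure _ ?_
    have h := mem_delGraph (tau θ) ⟨c p, (hc p).mem_smooth⟩
    rwa [(hc p).del, _root_.map_smul, _root_.map_smul, ← hb, ← formBasis_apply] at h
  coeff x w hxw p := by
    have hcl : _root_.IsClosed {z : H0 θ × H10 θ |
        ⟪formBasis b p, z.2⟫_ℂ = delEig (q p) * ⟪b p, z.1⟫_ℂ} :=
      isClosed_eq (by fun_prop) (by fun_prop)
    rw [delOp_tau_graph] at hxw
    refine hcl.closure_subset_iff.2 ?_ hxw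
    rintro _ ⟨a, rfl⟩
    rw [formBasis_apply, hb]
    change ⟪toGNS (tau θ) (c p), toGNS (tau θ) (del θ a)⟫_ℂ =
      delEig (q p) * ⟪toGNS (tau θ) (c p), toGNS (tau θ) a⟫_ℂ
    have h := tau_del a ⟨c p, (hc p).mem_smooth⟩
    simp only [(hc p).delStar] at h
    rw [← inner_conj_symm, ← inner_conj_symm (toGNS (tau θ) (c p)), inner_toGNS, inner_toGNS, h,
      mul_smul_comm, _root_.map_smul, smul_eq_mul, _root_.map_mul, Complex.conj_conj]

/-- A lattice sum, compared with the sum of the powers of the sup norm on `ℤ²`. -/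
theorem summable_delEig {σ : ℝ} (hσ : 1 < σ) :
    Summable fun q : ℤ × ℤ => (1 + ‖delEig q‖ ^ 2) ^ (-σ) := by
  have h := (finTwoArrowEquiv ℤ).symm.summable_iff.2
    (EisensteinSeries.summable_one_div_norm_rpow (k := 2 * σ) (by linarith))
  -- The comparison fails at the origin only, where the sup norm vanishes.
  refine Summable.of_norm_bounded_eventually h ?_
  rw [eventually_cofinite]
  refine (Set.finite_singleton (0 : ℤ × ℤ)).subset fun q hq => ?_
  by_contra h0
  refine hq ?_
  set x : Fin 2 → ℤ := (finTwoArrowEquiv ℤ).symm q with hx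
  have hx0 : 0 < ‖x‖ := by
    rw [norm_pos_iff]
    intro h
    refine h0 ?_
    exact Prod.ext (congrFun h 0) (congrFun h 1)
  have h1 : ‖x‖ ^ 2 ≤ 1 + ‖delEig q‖ ^ 2 := by
    rw [norm_delEig_sq]
    obtain ⟨i, hi⟩ : ∃ i, ‖x i‖ = ‖x‖ := by
      obtain ⟨i, hi⟩ := Finite.exists_max fun i => ‖x i‖
      exact ⟨i, le_antisymm (norm_le_pi_norm x i) ((pi_norm_le_iff_of_nonneg (norm_nonneg _)).2 hi)⟩
    rw [← hi]
    fin_cases i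
    · change ‖q.1‖ ^ 2 ≤ _
      rw [Int.norm_eq_abs, sq_abs]
      nlinarith [sq_nonneg (q.2 : ℝ)]
    · change ‖q.2‖ ^ 2 ≤ _
      rw [Int.norm_eq_abs, sq_abs]
      nlinarith [sq_nonneg (q.1 : ℝ)]
  change ‖(1 + ‖delEig q‖ ^ 2) ^ (-σ)‖ ≤ ‖x‖ ^ (-(2 * σ))
  rw [Real.norm_of_nonneg (by positivity), show -(2 * σ) = 2 * (-σ) by ring,
    Real.rpow_mul hx0.le, Real.rpow_two]
  exact Real.rpow_le_rpow_of_nonpos (by positivity) h1 (by linarith)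

theorem tendsto_norm_delEig_sq :
    Tendsto (fun q : ℤ × ℤ => ‖delEig q‖ ^ 2) cofinite atTop := by
  have h := (summable_delEig (σ := 2) (by norm_num)).tendsto_cofinite_zero
  have h2 : Tendsto (fun q : ℤ × ℤ => ((1 + ‖delEig q‖ ^ 2) ^ (-2 : ℝ))⁻¹) cofinite atTop := by
    refine Tendsto.inv_tendsto_nhdsGT_zero (tendsto_nhdsWithin_iff.2 ⟨h, Eventually.of_forall ?_⟩)
    intro q
    change (0 : ℝ) < _
    positivity
  rw [tendsto_atTop] at h2 ⊢
  intro C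
  filter_upwards [h2 ((1 + |C|) ^ 2)] with q hq
  rw [Real.rpow_neg (by positivity), inv_inv, Real.rpow_two,
    sq_le_sq₀ (by positivity) (by positivity)] at hq
  linarith [le_abs_self C]

end Weights

/-! ### The change of weight from `φ` to `τ` -/

section WeylTransform
variable {θ : ℝ} (h : selfAdjoint (smooth θ))

theorem coe_expS_half_mul_neg : (expS h (1 / 2) : Alg θ) * expS h (-(1 / 2)) = 1 := by
  rw [coe_expS_mul, add_neg_cancel, coe_expS_zero]

theorem coe_expS_neg_mul_half : (expS h (-(1 / 2)) : Alg θ) * expS h (1 / 2) = 1 := by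
  rw [coe_expS_mul, neg_add_cancel, coe_expS_zero]

/-- Right multiplication by `k⁻¹ = e^{-h/2}` on `A_θ`. -/
def mulRightInvWeyl : Alg θ ≃ₗ[ℂ] Alg θ where
  toFun a := a * expS h (-(1 / 2))
  invFun a := a * expS h (1 / 2)
  map_add' a b := add_mul _ _ _
  map_smul' z a := smul_mul_assoc _ _ _
  left_inv a := by
    beta_reduce
    rw [mul_assoc, coe_expS_neg_mul_half, mul_one]
  right_inv a := by
    beta_reduce
    rw [mul_assoc, coe_expS_half_mul_neg, mul_one]

theorem norm_toGNS_phi (a : Alg θ) :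
    ‖toGNS (tau θ) (a * expS h (-(1 / 2)))‖ = ‖toGNS (phi h) a‖ := by
  have h1 : ((‖toGNS (tau θ) (a * expS h (-(1 / 2)))‖ ^ 2 : ℝ) : ℂ) =
      (‖toGNS (phi h) a‖ ^ 2 : ℝ) := by
    rw [← inner_self_eq_ofReal, ← inner_self_eq_ofReal, inner_toGNS, inner_toGNS, phi_apply,
      tau_mul_exp, star_mul, coe_star_expS]
    simp only [mul_assoc]
  exact (sq_eq_sq₀ (norm_nonneg _) (norm_nonneg _)).1 (by exact_mod_cast h1)

/-- The unitary `H_φ → H_0` extending `a ↦ a k⁻¹`. -/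
def weylUnitary : (phi h).GNS ≃ₗᵢ[ℂ] H0 θ :=
  (mulRightInvWeyl h).extendOfIsometry (toGNS (phi h)) (toGNS (tau θ))
    (denseRange_toGNS _) (denseRange_toGNS _) (norm_toGNS_phi h)

theorem weylUnitary_toGNS (a : Alg θ) :
    weylUnitary h (toGNS (phi h) a) = toGNS (tau θ) (a * expS h (-(1 / 2))) :=
  LinearEquiv.extendOfIsometry_eq ..

theorem rightH0_rightH0 (a b : Alg θ) (x : H0 θ) :
    rightH0 θ (.op a) (rightH0 θ (.op b) x) = rightH0 θ (.op (b * a)) x := by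
  rw [MulOpposite.op_mul, _root_.map_mul]
  rfl

theorem rightH0_half_neg (x : H0 θ) :
    rightH0 θ (.op (expS h (1 / 2))) (rightH0 θ (.op (expS h (-(1 / 2)))) x) = x := by
  rw [rightH0_rightH0, coe_expS_neg_mul_half, MulOpposite.op_one, map_one]
  rfl

theorem rightH0_neg_half (x : H0 θ) :
    rightH0 θ (.op (expS h (-(1 / 2)))) (rightH0 θ (.op (expS h (1 / 2))) x) = x := by
  rw [rightH0_rightH0, coe_expS_half_mul_neg, MulOpposite.op_one, map_one]
  rfl

/-- The isomorphism of Hilbertable spaces `H_φ → H_0` extending the identity of `A_θ`. -/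
def changeOfWeight : (phi h).GNS ≃L[ℂ] H0 θ :=
  (weylUnitary h).toContinuousLinearEquiv.trans
    (ContinuousLinearEquiv.equivOfInverse (rightH0 θ (.op (expS h (1 / 2))))
      (rightH0 θ (.op (expS h (-(1 / 2))))) (rightH0_neg_half h) (rightH0_half_neg h))

theorem changeOfWeight_apply (x : (phi h).GNS) :
    changeOfWeight h x = rightH0 θ (.op (expS h (1 / 2))) (weylUnitary h x) := rfl

theorem changeOfWeight_symm_apply (x : H0 θ) :
    (changeOfWeight h).symm x =
      (weylUnitary h).symm (rightH0 θ (.op (expS h (-(1 / 2)))) x) := rfl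

theorem changeOfWeight_toGNS (a : Alg θ) :
    changeOfWeight h (toGNS (phi h) a) = toGNS (tau θ) a := by
  rw [changeOfWeight_apply, weylUnitary_toGNS, rightH0_toGNS, mul_assoc, coe_expS_neg_mul_half,
    mul_one]

theorem mem_closure_range_iff {X E F G : Type*} [NormedAddCommGroup E] [NormedSpace ℂ E]
    [NormedAddCommGroup F] [NormedAddCommGroup G] [NormedSpace ℂ G] (M : G ≃L[ℂ] E) (u : X → G)
    (v : X → F) (x : G) (w : F) :
    (x, w) ∈ closure (Set.range fun a => (u a, v a)) ↔
      (M x, w) ∈ closure (Set.range fun a => (M (u a), v a)) := by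
  let Φ : G × F ≃ₜ E × F := M.toHomeomorph.prodCongr (Homeomorph.refl F)
  have h1 : Set.range (fun a => (M (u a), v a)) = Φ '' Set.range fun a => (u a, v a) := by
    rw [← Set.range_comp]
    rfl
  rw [h1, ← Φ.image_closure]
  exact (Φ.injective.mem_set_image (a := (x, w))).symm

theorem mem_topologicalClosure_delGraph_iff (ψ : Alg θ →ₚ[ℂ] ℂ) (x : ψ.GNS) (w : H10 θ) :
    (x, w) ∈ (delGraph ψ).topologicalClosure ↔
      (x, w) ∈ closure (Set.range fun a : smooth θ =>
        (toGNS ψ a, (⟨toGNS (tau θ) (del θ a), toGNS_mem_H10 (del_mem_forms a)⟩ : H10 θ))) :=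
  Iff.rfl

/-- The operators `∂_φ` and `∂` agree up to the change of the inner product. -/
theorem mem_delOp_phi_graph_iff (x : (phi h).GNS) (w : H10 θ) :
    (x, w) ∈ (delOp (phi h)).graph ↔ (changeOfWeight h x, w) ∈ (delOp (tau θ)).graph := by
  rw [delOp_phi_graph, delOp_tau_graph, mem_topologicalClosure_delGraph_iff,
    mem_topologicalClosure_delGraph_iff, mem_closure_range_iff (changeOfWeight h)]
  simp only [changeOfWeight_toGNS]

theorem isDiagonal_monoBasis :
    IsDiagonal (delOp (tau θ)) (monoBasis θ) (formBasis (monoBasis θ)) delEig :=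
  isDiagonal_delOp _ (fun q => q) (mono θ) isWeight_mono monoBasis_apply

theorem starJ_toGNS (a : Alg θ) : starJ θ (toGNS (tau θ) a) = toGNS (tau θ) (star a) :=
  extendConj_toGNS _ _ _ a

/-- The involution `a ↦ a^*` maps degree `q` to degree `-q`, so it turns the eigenvalues of `∂` into
their negatives. -/
theorem exists_isDiagonal_starJ : ∃ b' : HilbertBasis (ℤ × ℤ) ℂ (H0 θ),
    (∀ q, b' q = starJ θ (monoBasis θ q)) ∧
      IsDiagonal (delOp (tau θ)) b' (formBasis b') (-delEig) := by
  obtain ⟨b', hb'⟩ :=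
    exists_hilbertBasis_antiunitary (starJ θ) (inner_conj_swap _) (monoBasis θ)
  refine ⟨b', hb', ?_⟩
  have h1 := isDiagonal_delOp b' (fun q => -q) (fun q => star (mono θ q))
    (fun q => (isWeight_mono q).star) fun q => by rw [hb', monoBasis_apply, starJ_toGNS]
  simp only [delEig_neg] at h1
  exact h1

theorem dense_delOp_phi_domain : Dense ((delOp (phi h)).domain : Set (phi h).GNS) :=
  isDiagonal_monoBasis.dense_domain_comp (mem_delOp_phi_graph_iff h)

theorem isClosed_delOp_phi : (delOp (phi h)).IsClosed :=
  isDiagonal_monoBasis.isClosed_comp (mem_delOp_phi_graph_iff h)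

theorem hasCompactEmbedding_delOp_phi : HasCompactEmbedding (delOp (phi h)) :=
  isDiagonal_monoBasis.hasCompactEmbedding_comp (mem_delOp_phi_graph_iff h)
    tendsto_norm_delEig_sq

theorem hasCompactEmbedding_adjoint_delOp_phi : HasCompactEmbedding (delOp (phi h)).adjoint :=
  isDiagonal_monoBasis.hasCompactEmbedding_adjoint_comp (mem_delOp_phi_graph_iff h)
    tendsto_norm_delEig_sq

theorem isSelfAdjoint_dirac : IsSelfAdjoint (dirac h) :=
  isSelfAdjoint_offDiag (dense_delOp_phi_domain h) (isClosed_delOp_phi h)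

theorem hasCompactResolvent_dirac : HasCompactResolvent (dirac h) :=
  ((hasCompactEmbedding_adjoint_delOp_phi h).offDiag
    (hasCompactEmbedding_delOp_phi h)).hasCompactResolvent (isSelfAdjoint_dirac h)

end WeylTransform

/-! ### The spectral triples -/

section Commutators
variable {θ : ℝ} (h : selfAdjoint (smooth θ))

theorem del_mul (a b : smooth θ) :
    del θ (a * b) = del θ a * (b : Alg θ) + (a : Alg θ) * del θ b := by
  have h0 (c : Alg θ) : alpha θ (0, 0) c = c := by
    refine toOp_injective θ ?_
    ext f p
    change diagUnitary (0, 0) (toOp θ c ((diagUnitary (0, 0)).symm f)) p = _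
    have : (diagUnitary (0, 0)).symm f = f := by ext q; simp [diagUnitary]
    rw [this]; simp [diagUnitary]
  have h1 : delta₁ ((a : Alg θ) * (b : Alg θ)) =
      delta₁ (a : Alg θ) * (b : Alg θ) + (a : Alg θ) * delta₁ (b : Alg θ) := by
    have := ((smooth_diff₁ a).hasDerivAt.mul (smooth_diff₁ b).hasDerivAt).deriv
    rw [h0, h0] at this
    simp only [delta₁, _root_.map_mul]
    rw [smul_mul_assoc, mul_smul_comm, ← smul_add]
    exact congrArg _ this
  have h2 : delta₂ ((a : Alg θ) * (b : Alg θ)) =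
      delta₂ (a : Alg θ) * (b : Alg θ) + (a : Alg θ) * delta₂ (b : Alg θ) := by
    have := ((smooth_diff₂ a).hasDerivAt.mul (smooth_diff₂ b).hasDerivAt).deriv
    rw [h0, h0] at this
    simp only [delta₂, _root_.map_mul]
    rw [smul_mul_assoc, mul_smul_comm, ← smul_add]
    exact congrArg _ this
  change delta₁ ((a : Alg θ) * (b : Alg θ)) + Complex.I • delta₂ ((a : Alg θ) * (b : Alg θ)) =
    (delta₁ (a : Alg θ) + Complex.I • delta₂ (a : Alg θ)) * (b : Alg θ) +
      (a : Alg θ) * (delta₁ (b : Alg θ) + Complex.I • delta₂ (b : Alg θ))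
  rw [h1, h2, add_mul, mul_add, smul_add, smul_mul_assoc, mul_smul_comm]
  abel

/-- A commutation relation with `∂_φ` up to a bounded operator holds if it holds on `A_θ^∞`. -/
theorem delOp_phi_commutator {A : (phi h).GNS →L[ℂ] (phi h).GNS} {A' : H10 θ →L[ℂ] H10 θ}
    {B : (phi h).GNS →L[ℂ] H10 θ}
    (hA : ∀ b : smooth θ, ∃ c : smooth θ, A (toGNS (phi h) b) = toGNS (phi h) c ∧
      A' ((formEquiv θ).symm (toGNS (tau θ) (del θ b))) + B (toGNS (phi h) b) =
        (formEquiv θ).symm (toGNS (tau θ) (del θ c)))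
    {x : (phi h).GNS} {w : H10 θ} (hxw : (x, w) ∈ (delOp (phi h)).graph) :
    (A x, A' w + B x) ∈ (delOp (phi h)).graph := by
  have hc : _root_.IsClosed ((fun p : (phi h).GNS × H10 θ => (A p.1, A' p.2 + B p.1)) ⁻¹'
      ((delOp (phi h)).graph : Set _)) :=
    (isClosed_delOp_phi h).preimage (by fun_prop)
  rw [delOp_phi_graph] at hxw
  refine hc.closure_subset_iff.2 ?_ hxw
  rintro _ ⟨b, rfl⟩
  obtain ⟨c, h1, h2⟩ := hA b
  have h3 : (toGNS (phi h) c, (formEquiv θ).symm (toGNS (tau θ) (del θ c))) ∈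
      (delOp (phi h)).graph := by
    rw [delOp_phi_graph]
    exact Submodule.le_topologicalClosure _ (mem_delGraph (phi h) c)
  rw [← h1, ← h2] at h3
  have h4 : (formEquiv θ).symm (toGNS (tau θ) (del θ b)) =
      ⟨toGNS (tau θ) (del θ b), toGNS_mem_H10 (del_mem_forms b)⟩ :=
    Subtype.ext (coe_formEquiv_symm _)
  rw [h4] at h3
  exact h3

/-- The operator `x ↦ L x` from `H_φ` to `H^{(1,0)}`, for an operator `L` on `H_0`. -/
def zeroOrder (L : H0 θ →L[ℂ] H0 θ) : (phi h).GNS →L[ℂ] H10 θ :=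
  ((formEquiv θ).symm.toContinuousLinearEquiv : H0 θ →L[ℂ] H10 θ) ∘L L ∘L
    (changeOfWeight h : (phi h).GNS →L[ℂ] H0 θ)

theorem zeroOrder_toGNS (L : H0 θ →L[ℂ] H0 θ) (b : Alg θ) :
    zeroOrder h L (toGNS (phi h) b) = (formEquiv θ).symm (L (toGNS (tau θ) b)) := by
  rw [← changeOfWeight_toGNS h]
  rfl

theorem leftH10_formEquiv_symm (a : Alg θ) (x : H0 θ) :
    leftH10 θ a ((formEquiv θ).symm x) = (formEquiv θ).symm ((tau θ).gnsStarAlgHom a x) := by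
  refine Subtype.ext ?_
  rw [coe_formEquiv_symm]
  change (tau θ).gnsStarAlgHom a (((formEquiv θ).symm x : H10 θ) : H0 θ) = _
  rw [coe_formEquiv_symm]

theorem rightH10_formEquiv_symm (a : (Alg θ)ᵐᵒᵖ) (x : H0 θ) :
    rightH10 θ a ((formEquiv θ).symm x) = (formEquiv θ).symm (rightH0 θ a x) := by
  refine Subtype.ext ?_
  rw [coe_formEquiv_symm]
  change rightH0 θ a (((formEquiv θ).symm x : H10 θ) : H0 θ) = _
  rw [coe_formEquiv_symm]

theorem delOp_phi_left (a : smooth θ) (x : (phi h).GNS) (w : H10 θ)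
    (hxw : (x, w) ∈ (delOp (phi h)).graph) :
    ((phi h).gnsStarAlgHom (a : Alg θ) x,
      leftH10 θ a w + zeroOrder h ((tau θ).gnsStarAlgHom (del θ a)) x) ∈
        (delOp (phi h)).graph := by
  refine delOp_phi_commutator h (fun b => ⟨a * b, gns_toGNS _ _ _, ?_⟩) hxw
  rw [zeroOrder_toGNS, leftH10_formEquiv_symm, ← _root_.map_add, gns_toGNS, gns_toGNS,
    ← _root_.map_add, del_mul, add_comm]

/-- The right action on `H_φ`. -/
def rightPhi : (Alg θ)ᵐᵒᵖ →⋆ₐ[ℂ] ((phi h).GNS →L[ℂ] (phi h).GNS) :=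
  opRep (tomitaJ h) (tomitaJ_involutive h) (phi h).gnsStarAlgHom

/-- The operator `J_φ a^* J_φ` is the right multiplication by `k⁻¹ a k`, not by `a`. -/
theorem rightPhi_toGNS (a b : Alg θ) :
    rightPhi h (.op a) (toGNS (phi h) b) =
      toGNS (phi h) (b * (expS h (-(1 / 2)) * a * expS h (1 / 2))) := by
  have hJ (x : Alg θ) : tomitaJ h (toGNS (phi h) x) =
      toGNS (phi h) (expS h (-(1 / 2)) * star x * expS h (1 / 2)) := by
    rw [tomitaJ, extendConj_toGNS, tomitaPre_apply, star_modularPow, neg_neg, modularPow_apply,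
      mul_assoc]
  rw [rightPhi, opRep_apply, hJ, MulOpposite.unop_op, gns_toGNS, hJ]
  congr 1
  simp only [star_mul, star_star, coe_star_expS]
  simp only [← mul_assoc]
  rw [coe_expS_neg_mul_half, one_mul]

theorem delOp_phi_right {a : Alg θ} {c : smooth θ}
    (hc : (c : Alg θ) = expS h (-(1 / 2)) * a * expS h (1 / 2)) (x : (phi h).GNS) (w : H10 θ)
    (hxw : (x, w) ∈ (delOp (phi h)).graph) :
    (rightPhi h (.op a) x,
      rightH10 θ (.op c) w + zeroOrder h (rightH0 θ (.op (del θ c))) x) ∈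
        (delOp (phi h)).graph := by
  refine delOp_phi_commutator h (fun b => ⟨b * c, ?_, ?_⟩) hxw
  · rw [rightPhi_toGNS, ← hc]
    rfl
  · rw [zeroOrder_toGNS, rightH10_formEquiv_symm, ← _root_.map_add, rightH0_toGNS, rightH0_toGNS,
      ← _root_.map_add, del_mul]

theorem isBoundedTwistedCommutator_left (a : smooth θ) :
    IsBoundedTwistedCommutator (dirac h) (leftAction h a) (leftAction h a) := by
  refine isBoundedTwistedCommutator_offDiag
    (B' := -ContinuousLinearMap.adjoint (zeroOrder h ((tau θ).gnsStarAlgHom (del θ (star a)))))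
    (delOp_phi_left h a) fun y z hyz => ?_
  have h1 := adjoint_commutator (dense_delOp_phi_domain h) (delOp_phi_left h (star a)) hyz
  have h2 : star ((star a : smooth θ) : Alg θ) = a := star_star (a : Alg θ)
  rwa [← map_star, ← map_star, h2] at h1

theorem isBoundedTwistedCommutator_right (a : (smooth θ)ᵐᵒᵖ) :
    IsBoundedTwistedCommutator (dirac h) (rightAction h (smoothOp θ a))
      (rightAction h (smoothOp θ (twist h a))) := by
  refine isBoundedTwistedCommutator_offDiag
    (B' := -ContinuousLinearMap.adjoint (zeroOrder h (rightH0 θ (.op (del θ (star a.unop))))))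
    (delOp_phi_right h (a := (a.unop : Alg θ)) (c := (twist h a).unop) rfl) fun y z hyz => ?_
  -- The twist `b ↦ k⁻¹ b k` maps `(k⁻¹ a k)^*` to `a^*`.
  have h1 : ((star a.unop : smooth θ) : Alg θ) = expS h (-(1 / 2)) *
      star (expS h (-(1 / 2)) * (a.unop : Alg θ) * expS h (1 / 2)) * expS h (1 / 2) := by
    simp only [star_mul, coe_star_expS]
    simp only [← mul_assoc]
    rw [coe_expS_neg_mul_half, one_mul, mul_assoc, coe_expS_neg_mul_half, mul_one]
    rfl
  have h2 := adjoint_commutator (dense_delOp_phi_domain h) (delOp_phi_right h h1) hyz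
  have h3 : star ((star a.unop : smooth θ) : Alg θ) = a.unop := star_star (a.unop : Alg θ)
  rwa [← map_star, ← map_star, ← MulOpposite.op_star, ← MulOpposite.op_star, h3, star_star] at h2

theorem star_twist (a : (smooth θ)ᵐᵒᵖ) : twist h (star a) = star ((twist h).symm a) := by
  refine MulOpposite.unop_injective (Subtype.ext ?_)
  change (expS h (-(1 / 2)) : Alg θ) * star (a.unop : Alg θ) * expS h (1 / 2) =
    star ((expS h (1 / 2) : Alg θ) * (a.unop : Alg θ) * expS h (-(1 / 2)))
  simp only [star_mul, coe_star_expS, mul_assoc]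

theorem isSelfAdjoint_grading : IsSelfAdjoint (grading h) := by
  rw [ContinuousLinearMap.isSelfAdjoint_iff', eq_comm, ContinuousLinearMap.eq_adjoint_iff]
  intro x y
  simp [grading, diagOp_apply, WithLp.prod_inner_apply]

theorem grading_mul_self : grading h * grading h = 1 := by
  ext1 x
  change grading h (grading h x) = x
  simp only [grading, diagOp_apply]
  refine congrArg (WithLp.toLp 2) (Prod.ext rfl (neg_neg _))

theorem grading_mul_diagOp (S : (phi h).GNS →L[ℂ] (phi h).GNS) (T : H10 θ →L[ℂ] H10 θ) :
    grading h * diagOp S T = diagOp S T * grading h := by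
  ext1 x
  exact congrArg (WithLp.toLp 2) (Prod.ext rfl (_root_.map_neg T _).symm)

theorem grading_anticomm (x : (dirac h).domain) :
    ∃ hx : grading h x ∈ (dirac h).domain, dirac h ⟨grading h x, hx⟩ = -grading h (dirac h x) := by
  refine mem_graph_iff_exists.1 (mem_offDiag_graph.2 ?_)
  obtain ⟨h1, h2⟩ := mem_offDiag_graph.1 ((dirac h).mem_graph x)
  refine ⟨?_, ?_⟩
  · have h3 : (-grading h (dirac h x)).snd = (dirac h x).snd := neg_neg _
    change ((x : HS h).fst, (-grading h (dirac h x)).snd) ∈ _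
    rwa [h3]
  · exact Submodule.neg_mem _ h2

theorem isEvenSpectralTriple_left :
    IsEvenSpectralTriple ((leftAction h).comp (smooth θ).subtype) (dirac h) (grading h) where
  star_twist _ := rfl
  selfAdjoint := isSelfAdjoint_dirac h
  compactResolvent := hasCompactResolvent_dirac h
  bounded a := isBoundedTwistedCommutator_left h a
  grading_star := isSelfAdjoint_grading h
  grading_sq := grading_mul_self h
  grading_comm _ := grading_mul_diagOp h _ _
  grading_anti := grading_anticomm h

theorem isEvenTwistedSpectralTriple_right :
    IsEvenTwistedSpectralTriple ((rightAction h).comp (smoothOp θ)) (twist h) (dirac h)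
      (grading h) where
  star_twist := star_twist h
  selfAdjoint := isSelfAdjoint_dirac h
  compactResolvent := hasCompactResolvent_dirac h
  bounded a := isBoundedTwistedCommutator_right h a
  grading_star := isSelfAdjoint_grading h
  grading_sq := grading_mul_self h
  grading_comm _ := grading_mul_diagOp h _ _
  grading_anti := grading_anticomm h

end Commutators

/-! ### The eigenvalues of `k ∂^* ∂ k` and the traces -/

section Trace
variable {θ : ℝ} (h : selfAdjoint (smooth θ))

theorem gns_starJ (a : Alg θ) (x : H0 θ) :
    (tau θ).gnsStarAlgHom a (starJ θ x) = starJ θ (rightH0 θ (.op (star a)) x) := by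
  rw [rightH0, opRep_apply, starJ_involutive, MulOpposite.unop_op, star_star]

theorem weyl_starJ (x : H0 θ) :
    (tau θ).gnsStarAlgHom (expS h (1 / 2) : Alg θ) (starJ θ x) =
      starJ θ (rightH0 θ (.op (expS h (1 / 2))) x) := by
  rw [gns_starJ, coe_star_expS]

/-- Taking adjoints in `∂_φ = ∂ R_k W`: the operator `∂^*` is `R_{k⁻¹} W ∂_φ^*`. -/
theorem mem_adjoint_delOp_tau_graph {y : H10 θ} {z : (phi h).GNS}
    (hyz : (y, z) ∈ (delOp (phi h)).adjoint.graph) :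
    (y, rightH0 θ (.op (expS h (-(1 / 2)))) (weylUnitary h z)) ∈
      (delOp (tau θ)).adjoint.graph := by
  rw [mem_adjoint_graph_iff isDiagonal_monoBasis.dense_domain]
  intro x w hxw
  have h1 : ((changeOfWeight h).symm x, w) ∈ (delOp (phi h)).graph := by
    rw [mem_delOp_phi_graph_iff, ContinuousLinearEquiv.apply_symm_apply]
    exact hxw
  have h2 := (mem_adjoint_graph_iff (dense_delOp_phi_domain h)).1 hyz _ _ h1
  rw [← h2, changeOfWeight_symm_apply, ← (weylUnitary h).inner_map_map z,
    LinearIsometryEquiv.apply_symm_apply, ← ContinuousLinearMap.adjoint_inner_right,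
    ← ContinuousLinearMap.star_eq_adjoint, ← map_star, ← MulOpposite.op_star, coe_star_expS]

/-- The antiunitary operator `a ↦ (a k⁻¹)^*` from `H_φ` to `H_0`; it carries the eigenvectors of
`∂_φ^* ∂_φ` to those of `k ∂^* ∂ k`. -/
def weylConj : (phi h).GNS ≃ₗᵢ⋆[ℂ] H0 θ := (weylUnitary h).trans (starJ θ)

theorem weylConj_apply (x : (phi h).GNS) : weylConj h x = starJ θ (weylUnitary h x) := rfl

theorem weylLaplacian_weylConj {x : (phi h).GNS} {w : H10 θ} {μ : ℝ}
    (hxw : (x, w) ∈ (delOp (phi h)).graph)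
    (hwx : (w, (μ : ℂ) • x) ∈ (delOp (phi h)).adjoint.graph) :
    (weylConj h x, (μ : ℂ) • weylConj h x) ∈ (weylLaplacian h).graph := by
  obtain ⟨b', hb', hdiag⟩ := exists_isDiagonal_starJ (θ := θ)
  obtain ⟨w', h1, h2⟩ := isDiagonal_monoBasis.conj_mem (starJ θ) starJ_involutive hb' hdiag
    ((mem_delOp_phi_graph_iff h x w).1 hxw) (mem_adjoint_delOp_tau_graph h hwx)
  let K : H0 θ →L[ℂ] H0 θ := (tau θ).gnsStarAlgHom (expS h (1 / 2) : Alg θ)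
  have h3 : K (weylConj h x) = starJ θ (changeOfWeight h x) := by
    rw [weylConj_apply, changeOfWeight_apply]
    exact weyl_starJ h _
  have h4 : K (starJ θ (rightH0 θ (.op (expS h (-(1 / 2)))) (weylUnitary h ((μ : ℂ) • x)))) =
      (μ : ℂ) • weylConj h x := by
    refine (weyl_starJ h _).trans ?_
    rw [rightH0_half_neg, weylConj_apply, _root_.map_smul,
      MulActionSemiHomClass.map_smulₛₗ, Complex.conj_ofReal]
  have h5 := mem_ofCLM_graph K (weylConj h x)
  rw [h3] at h5
  have h6 := mem_ofCLM_graph K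
    (starJ θ (rightH0 θ (.op (expS h (-(1 / 2)))) (weylUnitary h ((μ : ℂ) • x))))
  rw [h4] at h6
  exact mem_pcomp_graph (mem_pcomp_graph h5 (mem_pcomp_graph h1 h2)) h6

/-- The operators `|D|^{-s}` and `(k ∂^* ∂ k)^{-s/2}` are of trace class for `Re s > 2`, and the
first trace is twice the second. -/
theorem exists_traces {s : ℂ} (hs : 2 < s.re) :
    ∃ (P : HS h →L[ℂ] HS h) (Q : H0 θ →L[ℂ] H0 θ) (t : ℂ),
      IsAbsPower (dirac h) (-s) P ∧ IsPosPower (weylLaplacian h) (-s / 2) Q ∧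
        HasTrace Q t ∧ HasTrace P (2 * t) := by
  have hd := dense_delOp_phi_domain h
  have hcl := isClosed_delOp_phi h
  obtain ⟨ι, b, μ, g, hsing⟩ := exists_isSingularSystem hd hcl (hasCompactEmbedding_delOp_phi h)
  obtain ⟨J, c, ν, hc, hν⟩ := hsing.exists_offDiag_eigenbasis hd hcl
  obtain ⟨d, hdJ⟩ := exists_hilbertBasis_antiunitary (weylConj h) (fun x y => by
    rw [weylConj_apply, weylConj_apply, inner_conj_swap, LinearIsometryEquiv.inner_map_map]) b
  have hsum : Summable fun i => if μ i = 0 then 0 else μ i ^ (-(s.re / 2)) :=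
    hsing.summable_rpow hd (formBasis (monoBasis θ)) (fun q => sq_nonneg ‖delEig q‖)
      (C := (‖((changeOfWeight h).symm : H0 θ →L[ℂ] (phi h).GNS)‖ + 1) ^ 2) (by positivity)
      (fun y z hyz => isDiagonal_monoBasis.adjoint_comp_lower_bound
        (mem_delOp_phi_graph_iff h) hyz) (by linarith) (summable_delEig (by linarith))
  let ρ : ι → ℂ := fun i => if μ i = 0 then 0 else (μ i : ℂ) ^ (-s / 2)
  have hρ : Summable ρ := by
    refine .of_norm (hsum.congr fun i => ?_)
    change _ = ‖if μ i = 0 then (0 : ℂ) else (μ i : ℂ) ^ (-s / 2)‖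
    split_ifs with h0
    · simp
    · rw [Complex.norm_cpow_eq_rpow_re_of_pos (lt_of_le_of_ne (hsing.nonneg i) (Ne.symm h0))]
      congr 1
      simp
      ring
  have hD : HasSum (fun j => if ν j = 0 then 0 else ((|ν j| : ℝ) : ℂ) ^ (-s))
      (2 * ∑' i, ρ i) := by
    refine hν (fun x => (x : ℂ) ^ (-s)) _ (hρ.hasSum.congr_fun fun i => ?_)
    change (if μ i = 0 then (0 : ℂ) else ((√(μ i) : ℝ) : ℂ) ^ (-s)) =
      if μ i = 0 then 0 else (μ i : ℂ) ^ (-s / 2)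
    split_ifs with h0
    · rfl
    · rw [Real.sqrt_eq_rpow, ← Complex.cpow_mul_ofReal_nonneg (hsing.nonneg i)]
      congr 1
      push_cast
      ring
  obtain ⟨Q, hQ, hQt⟩ := exists_diagonal_hasTrace d hρ
  obtain ⟨P, hP, hPt⟩ := exists_diagonal_hasTrace c hD.summable
  rw [hD.tsum_eq] at hPt
  refine ⟨P, Q, ∑' i, ρ i, ⟨J, c, ν, fun j => mem_graph_iff_exists.1 (hc j), hP⟩,
    ⟨ι, d, μ, fun i => ⟨hsing.nonneg i, ?_⟩, hQ⟩, hQt, hPt⟩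
  rw [← mem_graph_iff_exists, hdJ]
  exact weylLaplacian_weylConj h (hsing.mem i) (hsing.mem_adjoint i)

end Trace

end NCTorus

end

theorem lemma2 (θ : ℝ) (hθ : Irrational θ) (h : selfAdjoint (NCTorus.smooth θ)) :
    Dense (NCTorus.smooth θ : Set (NCTorus.Alg θ)) ∧
    NCTorus.IsEvenSpectralTriple
      ((NCTorus.leftAction h).comp (NCTorus.smooth θ).subtype)
      (NCTorus.dirac h) (NCTorus.grading h) ∧
    NCTorus.IsEvenTwistedSpectralTriple
      ((NCTorus.rightAction h).comp (NCTorus.smoothOp θ)) (NCTorus.twist h)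
      (NCTorus.dirac h) (NCTorus.grading h) ∧
    ∀ s : ℂ, 2 < s.re →
      ∃ (P : NCTorus.HS h →L[ℂ] NCTorus.HS h) (Q : NCTorus.H0 θ →L[ℂ] NCTorus.H0 θ) (t : ℂ),
        NCTorus.IsAbsPower (NCTorus.dirac h) (-s) P ∧
        NCTorus.IsPosPower (NCTorus.weylLaplacian h) (-s / 2) Q ∧
        NCTorus.HasTrace Q t ∧ NCTorus.HasTrace P (2 * t) :=
  ⟨NCTorus.dense_smooth θ, NCTorus.isEvenSpectralTriple_left h,
    NCTorus.isEvenTwistedSpectralTriple_right h, fun _ hs => NCTorus.exists_traces h hs⟩
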